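/- **Definitions.** Let $I$ be a finite set of positive integers. A *partitioned hypergraph with index set $I$* is a finite $3$-uniform hypergraph whose vertex set is partitioned into sets $V_{ij}$, $i<j$, $i,j\in I$, such that for every edge there are $i<j<k$ in $I$ with one vertex of the edge in $V_{ij}$, one in $V_{jk}$ and one in $V_{ik}$. It is called *$m$-partitioned* if $|I|=m$; by default the index set of an $N$-partitioned hypergraph is $[N]=\{1,\dots,N\}$. For $i<j<k$ in $I$, the *$(i,j,k)$-triad* is the set of edges with exactly one vertex in each of $V_{ij}$, $V_{jk}$, $V_{ik}$; its *density* is the number of these edges divided by $|V_{ij}|\,|V_{ik}|\,|V_{jk}|$. The *density* of the hypergraph is the minimum density of a triad (it is at least $d$ if every triad has density at least $d$). If an edge of the $(i,j,k)$-triad contains $c\in V_{ik}$ and $a\in V_{ij}$, then $a$ is a *left neighbor* of $c$; if it contains $c\in V_{ik}$ and $b\in V_{jk}$, then $b$ is a *right neighbor* of $c$. A *subhypergraph* of $H$ with index set $I$ contained in that of $H$ is a partitioned hypergraph whose parts are the parts $V_{ij}$ of $H$ with $i,j\in I$ and whose edges are some of the edges of $H$ all of whose vertices lie in these parts. **Theorem.**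 For every real $\delta>0$ and every integer $n\ge 1$ there exists $N\in\mathbb N$ such that every $N$-partitioned hypergraph $H$ with density at least $4/27+\delta$ has a $4n$-partitioned subhypergraph $H_0$ with index set $I=\{i_1<i_2<\cdots<i_{4n}\}$ such that at least one of the following holds (edges, triads and neighbors are those of $H_0$). 1. There exist vertices $\alpha_{ij},\beta_{ij},\gamma^0_{ij},\omega_{ij},\alpha^{\omega}_{ij},\gamma^{\omega}_{ij}\in V_{ij}$ for all $i<j$ in $I$ such that for all $i<j<k$ in $I$ the sets $\{\alpha_{ij},\beta_{jk},\gamma^0_{ik}\}$, $\{\omega_{ij},\beta_{jk},\gamma^{\omega}_{ik}\}$ and $\{\alpha^{\omega}_{ij},\omega_{jk},\gamma^0_{ik}\}$ are edges. 2. There exist vertices $\alpha_{ij},\beta_{ij},\gamma^0_{ij},\omega_{ij},\beta^{\omega}_{ij},\gamma^{\omega}_{ij}\in V_{ij}$ for all $i<j$ in $I$ such that for all $i<j<k$ in $I$ the sets $\{\alpha_{ij},\beta_{jk},\gamma^0_{ik}\}$, $\{\alpha_{ij},\omega_{jk},\gamma^{\omega}_{ik}\}$ and $\{\omega_{ij},\beta^{\omega}_{jk},\gamma^0_{ik}\}$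 are edges. 3. There exist vertices $\alpha_{ij},\beta_{ij},\alpha'_{ij},\beta'_{ij},\gamma^0_{ij},\gamma^{\bullet}_{ij}\in V_{ij}$ for all $i<j$ in $I$, and vertices $\beta^{\bullet}_{ijkst}\in V_{jk}$ and $\alpha^{\bullet}_{ijkst}\in V_{ks}$ for all $i<j<k<s<t$ in $I$, such that for all $i<j<k<s<t$ in $I$: $\{\alpha_{ij},\beta_{jk},\gamma^0_{ik}\}$ and $\{\alpha'_{ij},\beta^{\bullet}_{ijkst},\gamma^0_{ik}\}$ are edges in the $(i,j,k)$-triad, $\{\beta^{\bullet}_{ijkst},\alpha^{\bullet}_{ijkst},\gamma^{\bullet}_{js}\}$ is an edge in the $(j,k,s)$-triad, and $\{\alpha^{\bullet}_{ijkst},\beta'_{st},\gamma^0_{kt}\}$ is an edge in the $(k,s,t)$-triad. 4. There exist vertices $\alpha^*_{ij},\beta^*_{ij},\gamma_{ij},\alpha^1_{ij},\beta^1_{ij},\gamma^1_{ij},\alpha^2_{ij},\beta^2_{ij},\gamma^2_{ij}\in V_{ij}$ for all $i<j$ in $I$ such that for all $i<j<k$ in $I$ the sets $\{\gamma^1_{ij},\beta^*_{jk},\gamma_{ik}\}$,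 $\{\alpha^*_{ij},\gamma^2_{jk},\gamma_{ik}\}$, $\{\alpha^1_{ij},\beta^1_{jk},\gamma^1_{ik}\}$ and $\{\alpha^2_{ij},\beta^2_{jk},\gamma^2_{ik}\}$ are edges. In addition, there exist $\alpha\in V_{i_{2n}i_{2n+1}}$ and $\beta\in V_{i_{2n+1}i_{2n+2}}$ such that $\alpha$ is a left neighbor of $\gamma^2_{i_{2n}i_{3n+1}}$, $\beta$ is a right neighbor of $\gamma^1_{i_ni_{2n+2}}$, and the $(i_{2n},i_{2n+1},i_{2n+2})$-triad contains an edge containing both $\alpha$ and $\beta$. -/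

import Mathlib

/-- A partitioned `3`-uniform hypergraph with (finite) index set `I`; an `n`-partitioned hypergraph
is the case of `n` indices, e.g. `I = Finset.Icc 1 n`.  Its vertex set is the disjoint union of the
finite parts `part i j` for `i < j` in `I` (the values of `part` at other pairs are irrelevant), and
each edge consists of one vertex of `part i j`, one of `part j k` and one of `part i k`
for some `i < j < k` in `I`. -/
structure PartitionedHypergraph (V : Type*) [DecidableEq V] (I : Finset ℕ) where
  part : ℕ → ℕ → Finset V
  edges : Finset (Finset V)
  part_disjoint : ∀ i ∈ I, ∀ j ∈ I, ∀ i' ∈ I, ∀ j' ∈ I, i < j → i' < j' → (i, j) ≠ (i', j') →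
    Disjoint (part i j) (part i' j')
  edges_spec : ∀ e ∈ edges, ∃ i ∈ I, ∃ j ∈ I, ∃ k ∈ I, i < j ∧ j < k ∧
    ∃ a ∈ part i j, ∃ b ∈ part j k, ∃ c ∈ part i k, e = {a, b, c}

namespace PartitionedHypergraph

variable {V : Type*} [DecidableEq V] {I J : Finset ℕ}

/-- The `(i, j, k)`-triad, for `i < j < k`: the set of all edges consisting of a (left) vertex of
`part i j`, a (right) vertex of `part j k` and a (top) vertex of `part i k`. -/
def triad (H : PartitionedHypergraph V I) (i j k : ℕ) : Finset (Finset V) :=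
  H.edges.filter fun e => ∃ a ∈ H.part i j, ∃ b ∈ H.part j k, ∃ c ∈ H.part i k, e = {a, b, c}

/-- The density of the `(i, j, k)`-triad. -/
noncomputable def triadDensity (H : PartitionedHypergraph V I) (i j k : ℕ) : ℝ :=
  ((H.triad i j k).card : ℝ) /
    (((H.part i j).card : ℝ) * ((H.part i k).card : ℝ) * ((H.part j k).card : ℝ))

/-- The density of a partitioned hypergraph: the minimum density of a triad
(`⊤` if there are fewer than three indices, and hence no triad). -/
noncomputable def density (H : PartitionedHypergraph V I) : WithTop ℝ :=
  ((I ×ˢ I ×ˢ I).filter fun t => t.1 < t.2.1 ∧ t.2.1 < t.2.2).inf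
    fun t => (H.triadDensity t.1 t.2.1 t.2.2 : WithTop ℝ)

theorem le_density_iff (H : PartitionedHypergraph V I) (d : ℝ) :
    (d : WithTop ℝ) ≤ H.density ↔
      ∀ i ∈ I, ∀ j ∈ I, ∀ k ∈ I, i < j → j < k → d ≤ H.triadDensity i j k := by
  simp only [density, Finset.le_inf_iff, Finset.mem_filter, Finset.mem_product, Prod.forall,
    WithTop.coe_le_coe]
  constructor
  · intro h i hi j hj k hk hij hjk
    exact h i j k ⟨⟨hi, hj, hk⟩, hij, hjk⟩
  · rintro h i j k ⟨⟨hi, hj, hk⟩, hij, hjk⟩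
    exact h i hi j hj k hk hij hjk

/-- `H'` is a subhypergraph of `H` with index set `J`, i.e. a spanning subhypergraph of the
subhypergraph of `H` induced by `J`: its parts are the parts of `H` with indices in `J`, and its
edges (which by definition contain only vertices of these parts) are edges of `H`. -/
def IsSubhypergraph (H' : PartitionedHypergraph V J) (H : PartitionedHypergraph V I) : Prop :=
  J ⊆ I ∧ (∀ i ∈ J, ∀ j ∈ J, i < j → H'.part i j = H.part i j) ∧ H'.edges ⊆ H.edges

/-- A choice of one vertex `x i j ∈ part i j` for all indices `i < j`. -/
def IsChoice (H : PartitionedHypergraph V I) (x : ℕ → ℕ → V) : Prop :=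
  ∀ i ∈ I, ∀ j ∈ I, i < j → x i j ∈ H.part i j

/-- The vertex `a` of `part i j` is a left neighbor (in the `(i, j, k)`-triad) of the top vertex
`c` of `part i k`. -/
def IsLeftNeighbor (H : PartitionedHypergraph V I) (i j k : ℕ) (a c : V) : Prop :=
  a ∈ H.part i j ∧ c ∈ H.part i k ∧ ∃ e ∈ H.triad i j k, a ∈ e ∧ c ∈ e

/-- The vertex `b` of `part j k` is a right neighbor (in the `(i, j, k)`-triad) of the top vertex
`c` of `part i k`. -/
def IsRightNeighbor (H : PartitionedHypergraph V I) (i j k : ℕ) (b c : V) : Prop :=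
  b ∈ H.part j k ∧ c ∈ H.part i k ∧ ∃ e ∈ H.triad i j k, b ∈ e ∧ c ∈ e

/-- The first configuration; `αω` and `γω` stand for `α^ω` and `γ^ω`. -/
def Config1 (H : PartitionedHypergraph V I) : Prop :=
  ∃ α β γ₀ ω αω γω : ℕ → ℕ → V,
    (H.IsChoice α ∧ H.IsChoice β ∧ H.IsChoice γ₀ ∧ H.IsChoice ω ∧ H.IsChoice αω ∧
      H.IsChoice γω) ∧
    ∀ i ∈ I, ∀ j ∈ I, ∀ k ∈ I, i < j → j < k →
      {α i j, β j k, γ₀ i k} ∈ H.edges ∧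
      {ω i j, β j k, γω i k} ∈ H.edges ∧
      {αω i j, ω j k, γ₀ i k} ∈ H.edges

/-- The second configuration; `βω` and `γω` stand for `β^ω` and `γ^ω`. -/
def Config2 (H : PartitionedHypergraph V I) : Prop :=
  ∃ α β γ₀ ω βω γω : ℕ → ℕ → V,
    (H.IsChoice α ∧ H.IsChoice β ∧ H.IsChoice γ₀ ∧ H.IsChoice ω ∧ H.IsChoice βω ∧
      H.IsChoice γω) ∧
    ∀ i ∈ I, ∀ j ∈ I, ∀ k ∈ I, i < j → j < k →
      {α i j, β j k, γ₀ i k} ∈ H.edges ∧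
      {α i j, ω j k, γω i k} ∈ H.edges ∧
      {ω i j, βω j k, γ₀ i k} ∈ H.edges

/-- The third configuration; `γb`, `βb` and `αb` stand for `γ^•`, `β^•` and `α^•`. -/
def Config3 (H : PartitionedHypergraph V I) : Prop :=
  ∃ (α β α' β' γ₀ γb : ℕ → ℕ → V) (βb αb : ℕ → ℕ → ℕ → ℕ → ℕ → V),
    (H.IsChoice α ∧ H.IsChoice β ∧ H.IsChoice α' ∧ H.IsChoice β' ∧ H.IsChoice γ₀ ∧
      H.IsChoice γb) ∧
    ∀ i ∈ I, ∀ j ∈ I, ∀ k ∈ I, ∀ s ∈ I, ∀ t ∈ I, i < j → j < k → k < s → s < t →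
      (βb i j k s t ∈ H.part j k ∧ αb i j k s t ∈ H.part k s) ∧
      {α i j, β j k, γ₀ i k} ∈ H.triad i j k ∧
      {α' i j, βb i j k s t, γ₀ i k} ∈ H.triad i j k ∧
      {βb i j k s t, αb i j k s t, γb j s} ∈ H.triad j k s ∧
      {αb i j k s t, β' s t, γ₀ k t} ∈ H.triad k s t

/-- The fourth configuration, for an index set `I` of `4 * n` elements listed in increasing order
as `idx 1 < idx 2 < ⋯ < idx (4 * n)`; `αs` and `βs` stand for `α^*` and `β^*`. -/
def Config4 (H : PartitionedHypergraph V I) (n : ℕ) (idx : ℕ → ℕ) : Prop :=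
  ∃ αs βs γ α₁ β₁ γ₁ α₂ β₂ γ₂ : ℕ → ℕ → V,
    (H.IsChoice αs ∧ H.IsChoice βs ∧ H.IsChoice γ ∧ H.IsChoice α₁ ∧ H.IsChoice β₁ ∧
      H.IsChoice γ₁ ∧ H.IsChoice α₂ ∧ H.IsChoice β₂ ∧ H.IsChoice γ₂) ∧
    (∀ i ∈ I, ∀ j ∈ I, ∀ k ∈ I, i < j → j < k →
      {γ₁ i j, βs j k, γ i k} ∈ H.edges ∧
      {αs i j, γ₂ j k, γ i k} ∈ H.edges ∧
      {α₁ i j, β₁ j k, γ₁ i k} ∈ H.edges ∧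
      {α₂ i j, β₂ j k, γ₂ i k} ∈ H.edges) ∧
    ∃ a ∈ H.part (idx (2 * n)) (idx (2 * n + 1)),
    ∃ b ∈ H.part (idx (2 * n + 1)) (idx (2 * n + 2)),
      H.IsLeftNeighbor (idx (2 * n)) (idx (2 * n + 1)) (idx (3 * n + 1)) a
        (γ₂ (idx (2 * n)) (idx (3 * n + 1))) ∧
      H.IsRightNeighbor (idx n) (idx (2 * n + 1)) (idx (2 * n + 2)) b
        (γ₁ (idx n) (idx (2 * n + 2))) ∧
      ∃ e ∈ H.triad (idx (2 * n)) (idx (2 * n + 1)) (idx (2 * n + 2)), a ∈ e ∧ b ∈ e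

end PartitionedHypergraph

/-! Fix a top vertex $c\in V_{ik}$ and an index $j$ between $i$ and $k$. The link of $c$ is a
bipartite graph between $V_{ij}$ and $V_{jk}$. Deleting vertices of small degree leaves a core with
a left side, a right side and all degrees at least an `ε` share; only `2ε` of density is lost
(`exists_core_frac`). The density of the core is the weight of $c$.

The tool for finding configurations is `exists_selection`: if the conditions on a vertex of $V_{ik}$
coming from one index before $i$, one between $i$ and $k$ and one after $k$ always hold together
with positive proportion, then on a large index set one vertex per part satisfies the conditions
from all indices at once. Hence an event on links that has positive proportion for all index tuples
produces a configuration.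

Suppose arbitrarily large dense systems avoid the configurations. Choose top vertices $x$ of the
largest weight $\lambda$ attainable on arbitrarily large index sets, then $y$ in the left sides of
the links of $x$ of the largest possible weight $\mu_1$, then $z$ in the right sides of largest
possible weight $\mu_2$. Weights are measured in multiples of `ε`, and attainability refers to all
systems together, so no limit object is needed. Maximality and the absence of configurations make
fourteen events negligible (`exists_not_quint_dense`), and Ramsey's theorem makes all parts look
alike up to `ε`.

Let $l,r$ be the proportions of the left and right sides of $x$. Up to multiples of `ε`, the density
is at most $l\mu_1+r\mu_2+(1-l-r)\lambda$, by splitting the top vertices into those in the left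
side, in the right side and in neither. Moreover $\lambda\le lr$, because the core of $x$ lives
between its two sides. The missing overlaps and edges between the sides of $y$ and $z$ give
$\mu_1+\mu_2\le\sigma(1-\sigma)$ for some $\sigma$; since the left sides, and likewise the right
sides, of $x$ span almost no edges of the links of $y$ and $z$, also
$\mu_1+\mu_2\le(1-\max(l,r))\sigma$. If $r\le l$ and $l\ge 1/2$, this bounds the density by
$lr(2-l-2r)\le 4/27$; if $l\le 1/2$ the bound is $9/64<4/27$ (`split_density_le`,
`density_le_of_profiles`). Taking `ε` small against `δ` gives the contradiction. -/

section

open Finset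
open scoped BigOperators

universe u

/-! ### Ramsey's theorem for finite subsets of `ℕ` -/

/-- Finite Ramsey theorem for `r`-element sets and finitely many colours. -/
theorem exists_homogeneous {κ : Type*} [Finite κ] (r m : ℕ) :
    ∃ N : ℕ, ∀ Y : Finset ℕ, N ≤ #Y → ∀ f : Finset ℕ → κ,
      ∃ Z ⊆ Y, #Z = m ∧ ∃ c, ∀ s ⊆ Z, #s = r → f s = c := by
  classical
  induction r generalizing m with
  | zero =>
    refine ⟨m, fun Y hY f => ?_⟩
    obtain ⟨Z, hZ, hm⟩ := exists_subset_card_eq hY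
    exact ⟨Z, hZ, hm, f ∅, fun s _ hs => by rw [card_eq_zero.1 hs]⟩
  | succ r ih =>
    -- First make the colour of a set depend only on its minimum; the pigeonhole principle on minima
    -- then finishes the step.
    have key : ∀ l : ℕ, ∃ N : ℕ, ∀ Y : Finset ℕ, N ≤ #Y → ∀ f : Finset ℕ → κ,
        ∃ Z ⊆ Y, #Z = l ∧ ∃ g : ℕ → κ, ∀ s ⊆ Z, #s = r + 1 →
          ∀ a ∈ s, (∀ b ∈ s, a ≤ b) → f s = g a := by
      intro l
      induction l with
      | zero =>
        refine ⟨0, fun Y _ f => ⟨∅, empty_subset _, rfl, fun _ => f ∅, fun s hs h => ?_⟩⟩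
        rw [subset_empty.1 hs] at h
        simp at h
      | succ l ihl =>
        obtain ⟨N₁, h₁⟩ := ihl
        obtain ⟨N₂, h₂⟩ := ih N₁
        refine ⟨N₂ + 1, fun Y hY f => ?_⟩
        have hne : Y.Nonempty := card_pos.1 (by omega)
        set a := Y.min' hne with ha
        have haY : a ∈ Y := Y.min'_mem hne
        obtain ⟨Y₁, hY₁, hc₁, c, hc⟩ := h₂ (Y.erase a) (by rw [card_erase_of_mem haY]; omega)
          (fun s => f (insert a s))
        obtain ⟨Z, hZ, hcZ, g, hg⟩ := h₁ Y₁ hc₁.ge f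
        have haZ : a ∉ Z := fun h => by simpa using hY₁ (hZ h)
        refine ⟨insert a Z, insert_subset haY ((hZ.trans hY₁).trans (erase_subset _ _)),
          by rw [card_insert_of_notMem haZ, hcZ], Function.update g a c, ?_⟩
        intro s hs hcs b hb hmin
        by_cases has : a ∈ s
        · have hba : b = a := le_antisymm (hmin a has) (by
            rcases mem_insert.1 (hs hb) with h | h
            · exact h.ge
            · exact Y.min'_le _ (erase_subset _ _ (hY₁ (hZ h))))
          rw [hba, Function.update_self, ← hc (s.erase a) _ _, insert_erase has]
          · intro x hx
            obtain ⟨hxb, hxs⟩ := mem_erase.1 hx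
            exact hZ ((mem_insert.1 (hs hxs)).resolve_left hxb)
          · rw [card_erase_of_mem has, hcs]; rfl
        · rw [Function.update_of_ne (ne_of_mem_of_not_mem hb has)]
          refine hg s (fun x hx => ?_) hcs b hb hmin
          exact (mem_insert.1 (hs hx)).resolve_left (ne_of_mem_of_not_mem hx has)
    have := Fintype.ofFinite κ
    obtain ⟨N, hN⟩ := key (Fintype.card κ * m + 1)
    refine ⟨N, fun Y hY f => ?_⟩
    obtain ⟨Z, hZ, hcZ, g, hg⟩ := hN Y hY f
    obtain ⟨c, -, hc⟩ := exists_lt_card_fiber_of_mul_lt_card_of_maps_to (s := Z) (t := univ)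
      (f := g) (n := m) (fun _ _ => mem_univ _) (by rw [hcZ, card_univ]; omega)
    obtain ⟨Z', hZ', hcZ'⟩ := exists_subset_card_eq hc.le
    refine ⟨Z', hZ'.trans ((filter_subset _ _).trans hZ), hcZ', c, fun s hs hcs => ?_⟩
    have hne : s.Nonempty := card_pos.1 (by omega)
    rw [hg s (hs.trans (hZ'.trans (filter_subset _ _))) hcs (s.min' hne) (s.min'_mem hne)
      (fun b hb => s.min'_le b hb)]
    exact (mem_filter.1 (hZ' (hs (s.min'_mem hne)))).2

/-- Ramsey's theorem for colourings of increasing quintuples. -/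
theorem exists_homogeneous_five {κ : Type*} [Finite κ] (m : ℕ) :
    ∃ N : ℕ, ∀ Y : Finset ℕ, N ≤ #Y → ∀ f : ℕ → ℕ → ℕ → ℕ → ℕ → κ,
      ∃ Z ⊆ Y, #Z = m ∧ ∃ c, ∀ h ∈ Z, ∀ i ∈ Z, ∀ j ∈ Z, ∀ k ∈ Z, ∀ t ∈ Z,
        h < i → i < j → j < k → k < t → f h i j k t = c := by
  classical
  obtain ⟨N, hN⟩ := exists_homogeneous (κ := κ) 5 m
  refine ⟨N, fun Y hY f => ?_⟩
  -- Quintuples are read off from sorted sets; the default 0 only affects sets with fewer than five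
  -- elements, whose colours play no role.
  obtain ⟨Z, hZ, hm, c, hc⟩ := hN Y hY (fun s =>
    f ((s.sort (· ≤ ·)).getD 0 0) ((s.sort (· ≤ ·)).getD 1 0) ((s.sort (· ≤ ·)).getD 2 0)
      ((s.sort (· ≤ ·)).getD 3 0) ((s.sort (· ≤ ·)).getD 4 0))
  refine ⟨Z, hZ, hm, c, fun h hh i hi j hj k hk t ht h1 h2 h3 h4 => ?_⟩
  have hl : ([h, i, j, k, t] : List ℕ).toFinset.sort (· ≤ ·) = [h, i, j, k, t] := by
    rw [List.toFinset_sort]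
    · simp; omega
    · simp; omega
  have := hc ([h, i, j, k, t] : List ℕ).toFinset (by
    intro x hx
    simp only [List.mem_toFinset, List.mem_cons, List.not_mem_nil, or_false] at hx
    rcases hx with rfl | rfl | rfl | rfl | rfl <;> assumption)
    (by rw [List.toFinset_card_of_nodup]; · rfl
        · simp; omega)
  rw [hl] at this
  simpa using this

/-- A finite set of naturals splits into an initial and a final segment of prescribed sizes. -/
theorem exists_split (Y : Finset ℕ) (a b : ℕ) (h : a + b ≤ #Y) :
    ∃ A ⊆ Y, ∃ B ⊆ Y, #A = a ∧ #B = b ∧ ∀ x ∈ A, ∀ y ∈ B, x < y := by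
  classical
  induction a generalizing Y with
  | zero =>
    obtain ⟨B, hB, hb⟩ := exists_subset_card_eq (show b ≤ #Y by omega)
    exact ⟨∅, empty_subset _, B, hB, rfl, hb, by simp⟩
  | succ a ih =>
    have hne : Y.Nonempty := card_pos.1 (by omega)
    have hm := Y.min'_mem hne
    obtain ⟨A, hA, B, hB, ha, hb, hlt⟩ := ih (Y.erase (Y.min' hne))
      (by rw [card_erase_of_mem hm]; omega)
    refine ⟨insert (Y.min' hne) A, insert_subset hm (hA.trans (erase_subset _ _)), B,
      hB.trans (erase_subset _ _), ?_, hb, ?_⟩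
    · rw [card_insert_of_notMem (fun h => by simpa using hA h), ha]
    · intro x hx y hy
      rcases mem_insert.1 hx with rfl | hx
      · exact Y.min'_lt_of_mem_erase_min' hne (hB hy)
      · exact hlt x hx y hy

/-! ### Proportions -/

/-- The real-valued indicator of a proposition. -/
noncomputable def ind (p : Prop) : ℝ := open Classical in if p then 1 else 0

theorem ind_of {p : Prop} (h : p) : ind p = 1 := if_pos h

theorem ind_of_not {p : Prop} (h : ¬p) : ind p = 0 := if_neg h

theorem ind_nonneg (p : Prop) : 0 ≤ ind p := by
  by_cases h : p <;> simp [ind, h]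

theorem ind_le_one (p : Prop) : ind p ≤ 1 := by
  by_cases h : p <;> simp [ind, h]

theorem ind_mono {p q : Prop} (h : p → q) : ind p ≤ ind q := by
  by_cases hp : p
  · rw [ind_of hp, ind_of (h hp)]
  · rw [ind_of_not hp]; exact ind_nonneg q

theorem ind_and (p q : Prop) : ind (p ∧ q) = ind p * ind q := by
  by_cases h : p <;> by_cases h' : q <;> simp [ind, h, h']

/-- The proportion of elements of `W` satisfying `p` (zero if `W` is empty). -/
noncomputable def frac {β : Type*} (W : Finset β) (p : β → Prop) : ℝ := 𝔼 v ∈ W, ind (p v)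

section frac

variable {β γ : Type*} {W : Finset β} {p q r : β → Prop}

theorem frac_eq_card_div (W : Finset β) (p : β → Prop) [DecidablePred p] :
    frac W p = (#{v ∈ W | p v} : ℝ) / #W := by
  rw [frac, expect_eq_sum_div_card, card_filter]
  push_cast
  congr 1
  refine sum_congr rfl fun v _ => ?_
  by_cases h : p v <;> simp [ind, h]

theorem frac_nonneg (W : Finset β) (p : β → Prop) : 0 ≤ frac W p :=
  expect_nonneg fun v _ => ind_nonneg (p v)

theorem expect_le_one_of_le_one {f : β → ℝ} (hf : ∀ v ∈ W, f v ≤ 1) : 𝔼 v ∈ W, f v ≤ 1 := by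
  rcases W.eq_empty_or_nonempty with rfl | h
  · simp
  · exact expect_le h hf

theorem frac_le_one (W : Finset β) (p : β → Prop) : frac W p ≤ 1 :=
  expect_le_one_of_le_one fun v _ => ind_le_one (p v)

theorem frac_mono (h : ∀ v ∈ W, p v → q v) : frac W p ≤ frac W q :=
  expect_le_expect fun v hv => ind_mono (h v hv)

theorem frac_congr (h : ∀ v ∈ W, (p v ↔ q v)) : frac W p = frac W q :=
  le_antisymm (frac_mono fun v hv => (h v hv).1) (frac_mono fun v hv => (h v hv).2)

theorem frac_le_add (h : ∀ v ∈ W, p v → q v ∨ r v) : frac W p ≤ frac W q + frac W r := by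
  rw [frac, frac, frac, ← expect_add_distrib]
  refine expect_le_expect fun v hv => ?_
  by_cases hp : p v
  · rw [ind_of hp]
    rcases h v hv hp with h | h
    · rw [ind_of h]; linarith [ind_nonneg (r v)]
    · rw [ind_of h]; linarith [ind_nonneg (q v)]
  · rw [ind_of_not hp]; linarith [ind_nonneg (r v), ind_nonneg (q v)]

theorem exists_of_frac_pos (h : 0 < frac W p) : ∃ v ∈ W, p v := by
  by_contra! hn
  refine h.ne' (expect_eq_zero fun v hv => ind_of_not (hn v hv))

theorem frac_product (A : Finset β) (B : Finset γ) (r : β × γ → Prop) :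
    frac (A ×ˢ B) r = 𝔼 a ∈ A, frac B fun b => r (a, b) :=
  expect_product _ _ _

theorem frac_product_right (A : Finset β) (B : Finset γ) (r : β × γ → Prop) :
    frac (A ×ˢ B) r = 𝔼 b ∈ B, frac A fun a => r (a, b) := by
  rw [frac_product]
  exact expect_comm _ _ _

theorem frac_product_and (A : Finset β) (B : Finset γ) (p : β → Prop) (q : γ → Prop) :
    (frac (A ×ˢ B) fun x => p x.1 ∧ q x.2) = frac A p * frac B q := by
  rw [frac_product, frac, expect_mul]
  refine expect_congr rfl fun a _ => ?_
  rw [frac, frac, mul_expect]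
  exact expect_congr rfl fun b _ => ind_and _ _

/-- Averaging: if the mean of `f ≤ 1` is at least `η`, then `f ≥ η / 2` on a proportion of at least
`η / 2`. -/
theorem half_le_frac {f : β → ℝ} {η : ℝ} (hη : 0 < η) (hf : ∀ v ∈ W, f v ≤ 1)
    (h : η ≤ 𝔼 v ∈ W, f v) : η / 2 ≤ frac W fun v => η / 2 ≤ f v := by
  have hW : W.Nonempty := by
    by_contra! hW
    subst hW
    simp at h
    linarith
  have h1 : 𝔼 v ∈ W, f v ≤ 𝔼 v ∈ W, (ind (η / 2 ≤ f v) + η / 2) := by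
    refine expect_le_expect fun v hv => ?_
    by_cases hv' : η / 2 ≤ f v
    · rw [ind_of hv']; linarith [hf v hv]
    · rw [ind_of_not hv']; linarith
  rw [expect_add_distrib, expect_const hW] at h1
  unfold frac
  linarith

theorem half_le_frac_left {A : Finset β} {B : Finset γ} {r : β × γ → Prop} {η : ℝ} (hη : 0 < η)
    (h : η ≤ frac (A ×ˢ B) r) : η / 2 ≤ frac A fun a => η / 2 ≤ frac B fun b => r (a, b) :=
  half_le_frac hη (fun _ _ => frac_le_one _ _) (by rwa [← frac_product])

theorem half_le_frac_right {A : Finset β} {B : Finset γ} {r : β × γ → Prop} {η : ℝ} (hη : 0 < η)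
    (h : η ≤ frac (A ×ˢ B) r) : η / 2 ≤ frac B fun b => η / 2 ≤ frac A fun a => r (a, b) :=
  half_le_frac hη (fun _ _ => frac_le_one _ _) (by rwa [← frac_product_right])

end frac

/-! ### Selection of common elements -/

/-- Among `Q` sets of average proportion at least `η`, some `q` have a large intersection. -/
theorem exists_large_inter {η : ℝ} (hη : 0 < η) (q : ℕ) :
    ∃ Q : ℕ, ∃ η' : ℝ, 0 < Q ∧ 0 < η' ∧ ∀ {ι β : Type*} (D : Finset ι) (W : Finset β) (C : ι → β → Prop),
      #D = Q → η ≤ (𝔼 t ∈ D, frac W (C t)) →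
        ∃ D' ⊆ D, #D' = q ∧ η' ≤ frac W fun v => ∀ t ∈ D', C t v := by
  classical
  -- With this `Q`, an element lying in an `η / 2` share of the `Q` sets lies in more than `q` of
  -- them.
  obtain ⟨Q, hQ⟩ := exists_nat_gt (2 * q / η)
  have hQ0 : (0 : ℝ) < Q := lt_of_le_of_lt (by positivity) hQ
  refine ⟨Q, η / 2 / 2 ^ Q, Nat.cast_pos.1 hQ0, by positivity, fun D W C hD h => ?_⟩
  have h1 : η ≤ 𝔼 v ∈ W, frac D fun t => C t v := by
    unfold frac at h ⊢
    rwa [expect_comm] at h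
  have h2 := half_le_frac hη (fun _ _ => frac_le_one _ _) h1
  -- Union bound: each such element lies in the intersection of some `q`-subfamily, and there are at
  -- most `2 ^ Q` of these.
  have h3 : frac W (fun v => η / 2 ≤ frac D fun t => C t v) ≤
      ∑ D' ∈ powersetCard q D, frac W fun v => ∀ t ∈ D', C t v := by
    unfold frac
    rw [← expect_sum_comm]
    refine expect_le_expect fun v _ => ?_
    by_cases hv : η / 2 ≤ 𝔼 t ∈ D, ind (C t v)
    · rw [ind_of hv]
      have hv' : η / 2 ≤ frac D fun t => C t v := hv
      rw [frac_eq_card_div, hD, le_div_iff₀ hQ0] at hv'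
      have h4 : (q : ℝ) ≤ #{t ∈ D | C t v} := by
        rw [div_lt_iff₀ hη] at hQ
        linarith
      obtain ⟨D', hD', hq⟩ := exists_subset_card_eq (Nat.cast_le.1 h4)
      calc (1 : ℝ) = ind (∀ t ∈ D', C t v) := (ind_of fun t ht => (mem_filter.1 (hD' ht)).2).symm
        _ ≤ _ := single_le_sum (f := fun D' : Finset _ => ind (∀ t ∈ D', C t v))
          (fun D' _ => ind_nonneg _)
          (mem_powersetCard.2 ⟨hD'.trans (filter_subset _ _), hq⟩)
    · rw [ind_of_not hv]
      exact sum_nonneg fun D' _ => ind_nonneg _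
  have hne : (powersetCard q D).Nonempty := by
    by_contra! hne
    rw [hne, sum_empty] at h3
    linarith
  have hcard : (#(powersetCard q D) : ℝ) ≤ 2 ^ Q := by
    have : #(powersetCard q D) ≤ 2 ^ Q := by
      rw [card_powersetCard, hD]
      exact Nat.choose_le_two_pow _ _
    exact_mod_cast this
  obtain ⟨D', hD', hle⟩ := exists_le_of_sum_le hne
    (f := fun _ => η / 2 / 2 ^ Q) (g := fun D' => frac W fun v => ∀ t ∈ D', C t v) (by
      refine le_trans ?_ (h2.trans h3)
      rw [sum_const, nsmul_eq_mul, mul_div_assoc', div_le_iff₀ (by positivity), mul_comm]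
      gcongr)
  exact ⟨D', (mem_powersetCard.1 hD').1, (mem_powersetCard.1 hD').2, hle⟩

/-- A three-dimensional version of the intersection property. -/
theorem exists_common_three {η : ℝ} (hη : 0 < η) (q : ℕ) :
    ∃ Q : ℕ, ∀ {β : Type*} (W : Finset β) (A B D : Finset ℕ) (C : ℕ → ℕ → ℕ → β → Prop),
      Q ≤ #A → Q ≤ #B → Q ≤ #D →
      (∀ h ∈ A, ∀ j ∈ B, ∀ t ∈ D, η ≤ frac W (C h j t)) →
      ∃ A' ⊆ A, ∃ B' ⊆ B, ∃ D' ⊆ D, #A' = q ∧ #B' = q ∧ #D' = q ∧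
        ∃ v ∈ W, ∀ h ∈ A', ∀ j ∈ B', ∀ t ∈ D', C h j t v := by
  obtain ⟨Q₁, η₁, hQ₁, hη₁, H₁⟩ := exists_large_inter hη q
  obtain ⟨Q₂, η₂, hQ₂, hη₂, H₂⟩ := exists_large_inter hη₁ q
  obtain ⟨Q₃, η₃, hQ₃, hη₃, H₃⟩ := exists_large_inter hη₂ q
  refine ⟨Q₁ + Q₂ + Q₃, fun W A B D C hA hB hD h => ?_⟩
  obtain ⟨D₁, hD₁, hcD⟩ := exists_subset_card_eq (show Q₁ ≤ #D by omega)
  obtain ⟨B₁, hB₁, hcB⟩ := exists_subset_card_eq (show Q₂ ≤ #B by omega)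
  obtain ⟨A₁, hA₁, hcA⟩ := exists_subset_card_eq (show Q₃ ≤ #A by omega)
  have hneA : A₁.Nonempty := card_pos.1 (by omega)
  have hneB : B₁.Nonempty := card_pos.1 (by omega)
  have hneD : D₁.Nonempty := card_pos.1 (by omega)
  -- One coordinate is thinned out at a time, the coordinates still to be treated being joined to
  -- `W` in a product.
  have f₁ : η ≤ 𝔼 t ∈ D₁, frac ((A₁ ×ˢ B₁) ×ˢ W) fun x => C x.1.1 x.1.2 t x.2 := by
    refine le_expect hneD fun t ht => ?_
    rw [frac_product]
    refine le_expect (hneA.product hneB) fun x hx => ?_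
    obtain ⟨hx₁, hx₂⟩ := mem_product.1 hx
    exact h _ (hA₁ hx₁) _ (hB₁ hx₂) _ (hD₁ ht)
  obtain ⟨D', hD', hcD', h₁⟩ := H₁ D₁ _ _ hcD f₁
  have f₂ : η₁ ≤ 𝔼 j ∈ B₁, frac (A₁ ×ˢ W) fun x => ∀ t ∈ D', C x.1 j t x.2 := by
    rw [frac_product, expect_product, expect_comm] at h₁
    simpa only [frac_product] using h₁
  obtain ⟨B', hB', hcB', h₂⟩ := H₂ B₁ _ _ hcB f₂
  have f₃ : η₂ ≤ 𝔼 h ∈ A₁, frac W fun v => ∀ j ∈ B', ∀ t ∈ D', C h j t v := by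
    rwa [frac_product] at h₂
  obtain ⟨A', hA', hcA', h₃⟩ := H₃ A₁ _ _ hcA f₃
  obtain ⟨v, hv, hv'⟩ := exists_of_frac_pos (hη₃.trans_le h₃)
  exact ⟨A', hA'.trans hA₁, B', hB'.trans hB₁, D', hD'.trans hD₁, hcA', hcB', hcD', v, hv, hv'⟩

/-- Selection lemma: if the conditions `p`, `q`, `r` on an element of `W i k` (with respect to an
index before `i`, between `i` and `k`, and after `k`, respectively) always hold simultaneously with
proportion at least `η`, then on a large set of indices there are elements satisfying all of them. -/
theorem exists_selection {η : ℝ} (hη : 0 < η) (M : ℕ) :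
    ∃ N : ℕ, ∀ {β : Type*} [Nonempty β] (Y : Finset ℕ) (W : ℕ → ℕ → Finset β)
      (p q r : ℕ → ℕ → ℕ → β → Prop), N ≤ #Y →
      (∀ h ∈ Y, ∀ i ∈ Y, ∀ j ∈ Y, ∀ k ∈ Y, ∀ t ∈ Y, h < i → i < j → j < k → k < t →
        η ≤ frac (W i k) fun v => p h i k v ∧ q i j k v ∧ r i k t v) →
      ∃ Z ⊆ Y, #Z = M ∧ ∃ v : ℕ → ℕ → β, ∀ i ∈ Z, ∀ k ∈ Z, i < k → v i k ∈ W i k ∧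
        (∀ h ∈ Z, h < i → p h i k (v i k)) ∧ (∀ j ∈ Z, i < j → j < k → q i j k (v i k)) ∧
        ∀ t ∈ Z, k < t → r i k t (v i k) := by
  classical
  -- Size `M + 1` leaves room for subsets of any size up to `M` and guarantees the representatives
  -- `h₀`, `j₀`, `t₀` below.
  obtain ⟨Q₀, hQ₀⟩ := exists_common_three hη (M + 1)
  set Q := Q₀ + M with hQdef
  obtain ⟨N, hN⟩ := exists_homogeneous (κ := Fin (M + 1) → Fin (M + 1) → Prop) M (Q + 1 + Q + 1 + Q)
  refine ⟨N, fun {β} _ Y W p q r hY hyp => ?_⟩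
  let Good : ℕ → ℕ → Finset ℕ → Prop := fun i k s => ∃ v ∈ W i k,
    (∀ h ∈ s, h < i → p h i k v) ∧ (∀ j ∈ s, i < j → j < k → q i j k v) ∧
      ∀ t ∈ s, k < t → r i k t v
  -- The colour of an `M`-set records which pairs of positions (counted from 0) are good in it. By
  -- homogeneity, one `M`-set in which positions `a`, `b` are good makes them good in all.
  obtain ⟨Z, hZ, hcZ, c, hc⟩ := hN Y hY fun s a b => ∃ i ∈ s, ∃ k ∈ s, i < k ∧
    #{x ∈ s | x < i} = a ∧ #{x ∈ s | x < k} = b ∧ Good i k s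
  have hgood : ∀ a b : Fin (M + 1), a < b → (b : ℕ) < M → c a b := by
    intro a b hab hb
    obtain ⟨Z₁, hZ₁, D, hD, hcZ₁, hcD, hlt₁⟩ := exists_split Z (Q + 1 + Q + 1) Q hcZ.ge
    obtain ⟨Z₂, hZ₂, K, hK, hcZ₂, hcK, hlt₂⟩ := exists_split Z₁ (Q + 1 + Q) 1 hcZ₁.ge
    obtain ⟨Z₃, hZ₃, B, hB, hcZ₃, hcB, hlt₃⟩ := exists_split Z₂ (Q + 1) Q hcZ₂.ge
    obtain ⟨A, hA, I, hI, hcA, hcI, hlt₄⟩ := exists_split Z₃ Q 1 hcZ₃.ge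
    obtain ⟨i, rfl⟩ := card_eq_one.1 hcI
    obtain ⟨k, rfl⟩ := card_eq_one.1 hcK
    have hiZ₃ : i ∈ Z₃ := hI (mem_singleton_self i)
    have hiZ₂ := hZ₃ hiZ₃
    have hiZ₁ := hZ₂ hiZ₂
    have hkZ₁ : k ∈ Z₁ := hK (mem_singleton_self k)
    have hAi : ∀ h ∈ A, h < i := fun h hh => hlt₄ h hh i (mem_singleton_self i)
    have hiB : ∀ j ∈ B, i < j := fun j hj => hlt₃ i hiZ₃ j hj
    have hBk : ∀ j ∈ B, j < k := fun j hj => hlt₂ j (hB hj) k (mem_singleton_self k)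
    have hik : i < k := hlt₂ i hiZ₂ k (mem_singleton_self k)
    have hkD : ∀ t ∈ D, k < t := fun t ht => hlt₁ k hkZ₁ t ht
    have hAZ : A ⊆ Z := ((hA.trans hZ₃).trans hZ₂).trans hZ₁
    have hBZ : B ⊆ Z := (hB.trans hZ₂).trans hZ₁
    obtain ⟨A', hA', B', hB', D', hD', hcA', hcB', hcD', v, hv, hpqr⟩ := hQ₀ (W i k) A B D
      (fun h j t v => p h i k v ∧ q i j k v ∧ r i k t v) (by omega) (by omega) (by omega)
      (fun h hh j hj t ht => hyp h (hZ (hAZ hh)) i (hZ (hZ₁ hiZ₁)) j (hZ (hBZ hj)) k (hZ (hZ₁ hkZ₁))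
        t (hZ (hD ht)) (hAi h hh) (hiB j hj) (hBk j hj) (hkD t ht))
    obtain ⟨h₀, hh₀⟩ : A'.Nonempty := card_pos.1 (by omega)
    obtain ⟨j₀, hj₀⟩ : B'.Nonempty := card_pos.1 (by omega)
    obtain ⟨t₀, ht₀⟩ : D'.Nonempty := card_pos.1 (by omega)
    -- These three sizes put `i` at position `a` and `k` at position `b` of an `M`-set.
    obtain ⟨A'', hA'', hcA''⟩ := exists_subset_card_eq (show (a : ℕ) ≤ #A' by omega)
    obtain ⟨B'', hB'', hcB''⟩ := exists_subset_card_eq (show (b - a - 1 : ℕ) ≤ #B' by omega)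
    obtain ⟨D'', hD'', hcD''⟩ := exists_subset_card_eq (show (M - 1 - b : ℕ) ≤ #D' by omega)
    have hAi'' : ∀ h ∈ A'', h < i := fun h hh => hAi h (hA' (hA'' hh))
    have hiB'' : ∀ h ∈ B'', i < h := fun h hh => hiB h (hB' (hB'' hh))
    have hBk'' : ∀ h ∈ B'', h < k := fun h hh => hBk h (hB' (hB'' hh))
    have hkD'' : ∀ h ∈ D'', k < h := fun h hh => hkD h (hD' (hD'' hh))
    have hmem : ∀ x, x ∈ A'' ∪ {i} ∪ B'' ∪ {k} ∪ D'' ↔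
        x ∈ A'' ∨ x = i ∨ x ∈ B'' ∨ x = k ∨ x ∈ D'' := by
      intro x; simp only [mem_union, mem_singleton, or_assoc]
    have hsplit : ∀ x ∈ A'' ∪ {i} ∪ B'' ∪ {k} ∪ D'', (x < i → x ∈ A'') ∧
        (i < x → x < k → x ∈ B'') ∧ (k < x → x ∈ D'') ∧ (x < k → x ∈ A'' ∪ {i} ∪ B'') := by
      intro x hx
      rcases (hmem x).1 hx with h | h | h | h | h
      · have := hAi'' x h
        exact ⟨fun _ => h, fun _ _ => by omega, fun _ => by omega, fun _ => by simp [h]⟩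
      · exact ⟨fun _ => by omega, fun _ _ => by omega, fun _ => by omega, fun _ => by simp [h]⟩
      · have := hiB'' x h
        have := hBk'' x h
        exact ⟨fun _ => by omega, fun _ _ => h, fun _ => by omega, fun _ => by simp [h]⟩
      · exact ⟨fun _ => by omega, fun _ _ => by omega, fun _ => by omega, fun _ => by omega⟩
      · have := hkD'' x h
        exact ⟨fun _ => by omega, fun _ _ => by omega, fun _ => h, fun _ => by omega⟩
    have e₁ : #(A'' ∪ {i}) = a + 1 := by
      rw [card_union_of_disjoint, hcA'', card_singleton]
      rw [disjoint_singleton_right]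
      exact fun h => (hAi'' i h).false
    have e₂ : #(A'' ∪ {i} ∪ B'') = b := by
      rw [card_union_of_disjoint, e₁, hcB'']
      · have : (a : ℕ) < b := hab
        omega
      · rw [disjoint_left]
        intro x hx hx'
        have := hiB'' x hx'
        rcases mem_union.1 hx with h | h
        · have := hAi'' x h
          omega
        · have := mem_singleton.1 h
          omega
    have e₃ : #(A'' ∪ {i} ∪ B'' ∪ {k} ∪ D'') = M := by
      rw [card_union_of_disjoint, card_union_of_disjoint, e₂, hcD'', card_singleton]
      · omega
      · rw [disjoint_singleton_right]
        intro h
        simp only [mem_union, mem_singleton] at h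
        rcases h with (h | h) | h
        · have := hAi'' _ h
          omega
        · omega
        · have := hBk'' _ h
          omega
      · rw [disjoint_left]
        intro x hx hx'
        have := hkD'' x hx'
        simp only [mem_union, mem_singleton] at hx
        rcases hx with ((h | h) | h) | h
        · have := hAi'' _ h
          omega
        · omega
        · have := hBk'' _ h
          omega
        · omega
    have hsub : A'' ∪ {i} ∪ B'' ∪ {k} ∪ D'' ⊆ Z := by
      intro x hx
      rcases (hmem x).1 hx with h | h | h | h | h
      · exact hAZ (hA' (hA'' h))
      · exact h ▸ hZ₁ hiZ₁
      · exact hBZ (hB' (hB'' h))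
      · exact h ▸ hZ₁ hkZ₁
      · exact hD (hD' (hD'' h))
    have := hc _ hsub e₃
    rw [← this]
    refine ⟨i, by simp, k, by simp, hik, ?_, ?_, v, hv, ?_, ?_, ?_⟩
    · rw [← hcA'']
      congr 1
      ext x
      refine ⟨fun h => (hsplit x (mem_filter.1 h).1).1 (mem_filter.1 h).2, fun h => ?_⟩
      exact mem_filter.2 ⟨(hmem x).2 (Or.inl h), hAi'' x h⟩
    · rw [← e₂]
      congr 1
      ext x
      refine ⟨fun h => (hsplit x (mem_filter.1 h).1).2.2.2 (mem_filter.1 h).2, fun h => ?_⟩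
      refine mem_filter.2 ⟨mem_union_left _ (mem_union_left _ h), ?_⟩
      simp only [mem_union, mem_singleton] at h
      rcases h with (h | h) | h
      · exact (hAi'' _ h).trans hik
      · exact h ▸ hik
      · exact hBk'' _ h
    · exact fun h hh hlt => (hpqr h (hA'' ((hsplit h hh).1 hlt)) j₀ hj₀ t₀ ht₀).1
    · exact fun j hj h1 h2 => (hpqr h₀ hh₀ j (hB'' ((hsplit j hj).2.1 h1 h2)) t₀ ht₀).2.1
    · exact fun t ht h1 => (hpqr h₀ hh₀ j₀ hj₀ t (hD'' ((hsplit t ht).2.2.1 h1))).2.2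
  obtain ⟨Z', hZ', hcZ'⟩ := exists_subset_card_eq (show M ≤ #Z by omega)
  have hsel : ∀ i ∈ Z', ∀ k ∈ Z', i < k → Good i k Z' := by
    intro i hi k hk hik
    have hlt : #{x ∈ Z' | x < i} < #{x ∈ Z' | x < k} := by
      refine card_lt_card ((ssubset_iff_of_subset ?_).2 ⟨i, by simp [hi, hik], by simp⟩)
      exact fun x hx => mem_filter.2 ⟨(mem_filter.1 hx).1, (mem_filter.1 hx).2.trans hik⟩
    have hltM : #{x ∈ Z' | x < k} < M := by
      rw [← hcZ']
      exact card_lt_card ((ssubset_iff_of_subset (filter_subset _ _)).2 ⟨k, hk, by simp⟩)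
    have := hgood ⟨#{x ∈ Z' | x < i}, by omega⟩ ⟨#{x ∈ Z' | x < k}, by omega⟩ hlt hltM
    rw [← hc Z' hZ' hcZ'] at this
    obtain ⟨i', hi', k', hk', -, h1, h2, hG⟩ := this
    have inj : ∀ x ∈ Z', ∀ y ∈ Z', #{z ∈ Z' | z < x} = #{z ∈ Z' | z < y} → x = y := by
      have aux : ∀ x ∈ Z', ∀ y ∈ Z', x < y → #{z ∈ Z' | z < x} < #{z ∈ Z' | z < y} := by
        intro x hx y _ hxy
        refine card_lt_card ((ssubset_iff_of_subset ?_).2 ⟨x, by simp [hx, hxy], by simp⟩)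
        exact fun z hz => mem_filter.2 ⟨(mem_filter.1 hz).1, (mem_filter.1 hz).2.trans hxy⟩
      intro x hx y hy hxy
      rcases lt_trichotomy x y with h | h | h
      · have := aux x hx y hy h
        omega
      · exact h
      · have := aux y hy x hx h
        omega
    rwa [inj i' hi' i hi h1, inj k' hk' k hk h2] at hG
  choose! v hv using hsel
  exact ⟨Z', hZ'.trans hZ, hcZ', v, hv⟩

/-- In this and the next two specialisations no condition comes from an index inside the interval.
The suffix tells on which side of the interval the conditioning indices lie. -/
theorem exists_selection_right {η : ℝ} (hη : 0 < η) (M : ℕ) :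
    ∃ N : ℕ, ∀ {β : Type*} [Nonempty β] (Y : Finset ℕ) (W : ℕ → ℕ → Finset β)
      (r : ℕ → ℕ → ℕ → β → Prop), N ≤ #Y →
      (∀ i ∈ Y, ∀ j ∈ Y, ∀ k ∈ Y, i < j → j < k → η ≤ frac (W i j) (r i j k)) →
      ∃ Z ⊆ Y, #Z = M ∧ ∃ v : ℕ → ℕ → β, ∀ i ∈ Z, ∀ j ∈ Z, i < j → v i j ∈ W i j ∧
        ∀ k ∈ Z, j < k → r i j k (v i j) := by
  obtain ⟨N, hN⟩ := exists_selection hη M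
  refine ⟨N, fun Y W r hY h => ?_⟩
  obtain ⟨Z, hZ, hM, v, hv⟩ := hN Y W (fun _ _ _ _ => True) (fun _ _ _ _ => True) r hY
    (fun _ _ i hi _ _ k hk t ht _ h2 h3 h4 => by simpa using h i hi k hk t ht (h2.trans h3) h4)
  exact ⟨Z, hZ, hM, v, fun i hi j hj hij => ⟨(hv i hi j hj hij).1, (hv i hi j hj hij).2.2.2⟩⟩

theorem exists_selection_left {η : ℝ} (hη : 0 < η) (M : ℕ) :
    ∃ N : ℕ, ∀ {β : Type*} [Nonempty β] (Y : Finset ℕ) (W : ℕ → ℕ → Finset β)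
      (p : ℕ → ℕ → ℕ → β → Prop), N ≤ #Y →
      (∀ i ∈ Y, ∀ j ∈ Y, ∀ k ∈ Y, i < j → j < k → η ≤ frac (W j k) (p i j k)) →
      ∃ Z ⊆ Y, #Z = M ∧ ∃ v : ℕ → ℕ → β, ∀ j ∈ Z, ∀ k ∈ Z, j < k → v j k ∈ W j k ∧
        ∀ i ∈ Z, i < j → p i j k (v j k) := by
  obtain ⟨N, hN⟩ := exists_selection hη M
  refine ⟨N, fun Y W p hY h => ?_⟩
  obtain ⟨Z, hZ, hM, v, hv⟩ := hN Y W p (fun _ _ _ _ => True) (fun _ _ _ _ => True) hY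
    (fun g hg i hi _ _ k hk _ _ h1 h2 h3 _ => by simpa using h g hg i hi k hk h1 (h2.trans h3))
  exact ⟨Z, hZ, hM, v, fun i hi j hj hij => ⟨(hv i hi j hj hij).1, (hv i hi j hj hij).2.1⟩⟩

theorem exists_selection_left_right {η : ℝ} (hη : 0 < η) (M : ℕ) :
    ∃ N : ℕ, ∀ {β : Type*} [Nonempty β] (Y : Finset ℕ) (W : ℕ → ℕ → Finset β)
      (p r : ℕ → ℕ → ℕ → β → Prop), N ≤ #Y →
      (∀ h ∈ Y, ∀ i ∈ Y, ∀ j ∈ Y, ∀ k ∈ Y, h < i → i < j → j < k →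
        η ≤ frac (W i j) fun v => p h i j v ∧ r i j k v) →
      ∃ Z ⊆ Y, #Z = M ∧ ∃ v : ℕ → ℕ → β, ∀ i ∈ Z, ∀ j ∈ Z, i < j → v i j ∈ W i j ∧
        (∀ h ∈ Z, h < i → p h i j (v i j)) ∧ ∀ k ∈ Z, j < k → r i j k (v i j) := by
  obtain ⟨N, hN⟩ := exists_selection hη M
  refine ⟨N, fun Y W p r hY h => ?_⟩
  obtain ⟨Z, hZ, hM, v, hv⟩ := hN Y W p (fun _ _ _ _ => True) r hY
    (fun g hg i hi _ _ k hk t ht h1 h2 h3 h4 => by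
      simpa using h g hg i hi k hk t ht h1 (h2.trans h3) h4)
  exact ⟨Z, hZ, hM, v, fun i hi j hj hij =>
    ⟨(hv i hi j hj hij).1, (hv i hi j hj hij).2.1, (hv i hi j hj hij).2.2.2⟩⟩

/-! ### Cores of bipartite graphs and of links -/

/-- A bipartite graph contains a subgraph of minimum degrees at least `s` and `t` that misses few
edges. -/
theorem exists_core {β γ : Type*} (A : Finset β) (B : Finset γ) (g : β → γ → Prop) {s t : ℝ}
    (hs : 0 ≤ s) (ht : 0 ≤ t) :
    ∃ A' ⊆ A, ∃ B' ⊆ B, (∀ x ∈ A', s ≤ ∑ y ∈ B', ind (g x y)) ∧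
      (∀ y ∈ B', t ≤ ∑ x ∈ A', ind (g x y)) ∧
      ∑ x ∈ A, ∑ y ∈ B, ind (g x y ∧ ¬(x ∈ A' ∧ y ∈ B')) ≤ s * #A + t * #B := by
  classical
  induction hn : #A + #B using Nat.strong_induction_on generalizing A B with
  | _ n ih =>
    -- Removing a vertex of too small degree loses fewer than `s` (or `t`) edges; the loss is
    -- charged to that vertex.
    by_cases hA : ∃ x ∈ A, ∑ y ∈ B, ind (g x y) < s
    · obtain ⟨x, hx, hlt⟩ := hA
      have hc := card_erase_add_one hx
      obtain ⟨A', hA', B', hB', h1, h2, h3⟩ := ih _ (by omega) (A.erase x) B rfl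
      refine ⟨A', hA'.trans (erase_subset _ _), B', hB', h1, h2, ?_⟩
      rw [← add_sum_erase A _ hx]
      have h4 : ∑ y ∈ B, ind (g x y ∧ ¬(x ∈ A' ∧ y ∈ B')) ≤ s :=
        (sum_le_sum fun y _ => ind_mono And.left).trans hlt.le
      have h5 : (#A : ℝ) = #(A.erase x) + 1 := by exact_mod_cast hc.symm
      rw [h5]
      linarith
    by_cases hB : ∃ y ∈ B, ∑ x ∈ A, ind (g x y) < t
    · obtain ⟨y, hy, hlt⟩ := hB
      have hc := card_erase_add_one hy
      obtain ⟨A', hA', B', hB', h1, h2, h3⟩ := ih _ (by omega) A (B.erase y) rfl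
      refine ⟨A', hA', B', hB'.trans (erase_subset _ _), h1, h2, ?_⟩
      rw [sum_comm] at h3 ⊢
      rw [← add_sum_erase B _ hy]
      have h4 : ∑ x ∈ A, ind (g x y ∧ ¬(x ∈ A' ∧ y ∈ B')) ≤ t :=
        (sum_le_sum fun y _ => ind_mono And.left).trans hlt.le
      have h5 : (#B : ℝ) = #(B.erase y) + 1 := by exact_mod_cast hc.symm
      rw [h5]
      linarith
    push Not at hA hB
    refine ⟨A, Subset.rfl, B, Subset.rfl, hA, hB, ?_⟩
    rw [sum_eq_zero fun x hx => sum_eq_zero fun y hy => ind_of_not fun h => h.2 ⟨hx, hy⟩]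
    positivity

/-- The thresholds `ε * #B` and `ε * #A` make the total loss at most `2 * ε * #A * #B`. -/
theorem exists_core_frac {β γ : Type*} (A : Finset β) (B : Finset γ) (g : β → γ → Prop) {ε : ℝ}
    (hε : 0 ≤ ε) (hA : A.Nonempty) (hB : B.Nonempty) :
    ∃ A' ⊆ A, ∃ B' ⊆ B, (∀ x ∈ A', ε ≤ frac B fun y => y ∈ B' ∧ g x y) ∧
      (∀ y ∈ B', ε ≤ frac A fun x => x ∈ A' ∧ g x y) ∧
      (frac (A ×ˢ B) fun x => g x.1 x.2) ≤
        (frac (A ×ˢ B) fun x => x.1 ∈ A' ∧ x.2 ∈ B' ∧ g x.1 x.2) + 2 * ε := by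
  classical
  obtain ⟨A', hA', B', hB', h1, h2, h3⟩ := exists_core A B g (s := ε * #B) (t := ε * #A)
    (by positivity) (by positivity)
  have hA0 : (0 : ℝ) < #A := by exact_mod_cast hA.card_pos
  have hB0 : (0 : ℝ) < #B := by exact_mod_cast hB.card_pos
  refine ⟨A', hA', B', hB', fun x hx => ?_, fun y hy => ?_, ?_⟩
  · rw [frac, expect_eq_sum_div_card, le_div_iff₀ hB0]
    refine (h1 x hx).trans ((sum_le_sum fun y hy => ?_).trans
      (sum_le_sum_of_subset_of_nonneg hB' fun _ _ _ => ind_nonneg _))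
    exact ind_mono fun h => ⟨hy, h⟩
  · rw [frac, expect_eq_sum_div_card, le_div_iff₀ hA0]
    refine (h2 y hy).trans ((sum_le_sum fun x hx => ?_).trans
      (sum_le_sum_of_subset_of_nonneg hA' fun _ _ _ => ind_nonneg _))
    exact ind_mono fun h => ⟨hx, h⟩
  · have h4 : (frac (A ×ˢ B) fun x => g x.1 x.2 ∧ ¬(x.1 ∈ A' ∧ x.2 ∈ B')) ≤ 2 * ε := by
      rw [frac, expect_eq_sum_div_card, sum_product, card_product, div_le_iff₀ (by positivity)]
      push_cast
      linarith
    refine (frac_le_add fun x _ hg => ?_).trans (add_le_add_right h4 _)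
    by_cases hx : x.1 ∈ A' ∧ x.2 ∈ B'
    · exact Or.inl ⟨hx.1, hx.2, hg⟩
    · exact Or.inr ⟨hg, hx⟩

/-- A family of finite parts together with a ternary relation `edge a b c` between left, right and
top vertices. -/
structure TriSystem (V : Type*) where
  part : ℕ → ℕ → Finset V
  edge : V → V → V → Prop

namespace TriSystem

variable {V : Type*} (S : TriSystem V) (ε : ℝ)

/-- All parts indexed by `Y` are nonempty. -/
def NonemptyOn (Y : Finset ℕ) : Prop := ∀ i ∈ Y, ∀ j ∈ Y, i < j → (S.part i j).Nonempty

/-- A choice of vertices, one in each part indexed by `Y`. -/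
def Choice (Y : Finset ℕ) (x : ℕ → ℕ → V) : Prop := ∀ i ∈ Y, ∀ j ∈ Y, i < j → x i j ∈ S.part i j

/-- Stated so that a choice of core exists for every link: the inclusions are unconditional, and
empty sets serve when the degree conditions are not claimed. -/
theorem exists_core_sets (i j k : ℕ) (c : V) :
    ∃ AB : Finset V × Finset V, AB.1 ⊆ S.part i j ∧ AB.2 ⊆ S.part j k ∧
      (0 ≤ ε → (S.part i j).Nonempty → (S.part j k).Nonempty →
        (∀ a ∈ AB.1, ε ≤ frac (S.part j k) fun b => b ∈ AB.2 ∧ S.edge a b c) ∧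
        (∀ b ∈ AB.2, ε ≤ frac (S.part i j) fun a => a ∈ AB.1 ∧ S.edge a b c) ∧
        (frac (S.part i j ×ˢ S.part j k) fun u => S.edge u.1 u.2 c) ≤
          (frac (S.part i j ×ˢ S.part j k) fun u => u.1 ∈ AB.1 ∧ u.2 ∈ AB.2 ∧ S.edge u.1 u.2 c)
            + 2 * ε) := by
  by_cases h : 0 ≤ ε ∧ (S.part i j).Nonempty ∧ (S.part j k).Nonempty
  · obtain ⟨A, hA, B, hB, h'⟩ := exists_core_frac _ _ (fun a b => S.edge a b c) h.1 h.2.1 h.2.2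
    exact ⟨(A, B), hA, hB, fun _ _ _ => h'⟩
  · exact ⟨(∅, ∅), empty_subset _, empty_subset _, fun h1 h2 h3 => (h ⟨h1, h2, h3⟩).elim⟩

/-- The left side of the core of the link of `c` in the triad `i, j, k`. -/
noncomputable def coreL (i j k : ℕ) (c : V) : Finset V := (S.exists_core_sets ε i j k c).choose.1

/-- The right side of the core of the link of `c` in the triad `i, j, k`. -/
noncomputable def coreR (i j k : ℕ) (c : V) : Finset V := (S.exists_core_sets ε i j k c).choose.2

/-- The density of the core of the link of `c` in the triad `i, j, k`. -/
noncomputable def weight (i j k : ℕ) (c : V) : ℝ :=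
  frac (S.part i j ×ˢ S.part j k) fun u =>
    u.1 ∈ S.coreL ε i j k c ∧ u.2 ∈ S.coreR ε i j k c ∧ S.edge u.1 u.2 c

variable {S ε} {i j k : ℕ} {a b c : V}

theorem le_frac_of_mem_coreL (hε : 0 ≤ ε) (hij : (S.part i j).Nonempty)
    (hjk : (S.part j k).Nonempty) (ha : a ∈ S.coreL ε i j k c) :
    ε ≤ frac (S.part j k) fun b => b ∈ S.coreR ε i j k c ∧ S.edge a b c :=
  ((S.exists_core_sets ε i j k c).choose_spec.2.2 hε hij hjk).1 a ha

theorem le_frac_of_mem_coreR (hε : 0 ≤ ε) (hij : (S.part i j).Nonempty)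
    (hjk : (S.part j k).Nonempty) (hb : b ∈ S.coreR ε i j k c) :
    ε ≤ frac (S.part i j) fun a => a ∈ S.coreL ε i j k c ∧ S.edge a b c :=
  ((S.exists_core_sets ε i j k c).choose_spec.2.2 hε hij hjk).2.1 b hb

theorem frac_link_le (hε : 0 ≤ ε) (hij : (S.part i j).Nonempty) (hjk : (S.part j k).Nonempty) :
    (frac (S.part i j ×ˢ S.part j k) fun u => S.edge u.1 u.2 c) ≤ S.weight ε i j k c + 2 * ε :=
  ((S.exists_core_sets ε i j k c).choose_spec.2.2 hε hij hjk).2.2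

theorem weight_le_one : S.weight ε i j k c ≤ 1 := frac_le_one _ _

theorem weight_nonneg : 0 ≤ S.weight ε i j k c := frac_nonneg _ _

/-- A link of weight at least `ε` has sides large enough to select further top vertices from. -/
theorem weight_le_frac_coreL :
    S.weight ε i j k c ≤ frac (S.part i j) (· ∈ S.coreL ε i j k c) := by
  rcases (S.part j k).eq_empty_or_nonempty with h | h
  · rw [weight, h, product_empty, frac, expect_empty]
    exact frac_nonneg _ _
  · rw [weight, frac_product]
    refine expect_le_expect fun a _ => ?_
    by_cases ha : a ∈ S.coreL ε i j k c
    · rw [ind_of ha]; exact frac_le_one _ _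
    · rw [ind_of_not ha, frac, expect_eq_zero fun b _ => ind_of_not fun h => ha h.1]

theorem weight_le_frac_coreR :
    S.weight ε i j k c ≤ frac (S.part j k) (· ∈ S.coreR ε i j k c) := by
  rw [weight, frac_product_right]
  refine expect_le_expect fun b _ => ?_
  by_cases hb : b ∈ S.coreR ε i j k c
  · rw [ind_of hb]; exact frac_le_one _ _
  · rw [ind_of_not hb, frac, expect_eq_zero fun a _ => ind_of_not fun h => hb h.2.1]

end TriSystem

/-! ### The configurations, and dense events that force them -/

namespace TriSystem

section configurations

variable {V : Type*} (S : TriSystem V) (J : Finset ℕ)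

/-- The first configuration on the index set `J`. -/
def Conf1 : Prop :=
  ∃ α β γ₀ ω αω γω : ℕ → ℕ → V,
    (S.Choice J α ∧ S.Choice J β ∧ S.Choice J γ₀ ∧ S.Choice J ω ∧ S.Choice J αω ∧
      S.Choice J γω) ∧
    ∀ i ∈ J, ∀ j ∈ J, ∀ k ∈ J, i < j → j < k →
      S.edge (α i j) (β j k) (γ₀ i k) ∧ S.edge (ω i j) (β j k) (γω i k) ∧
        S.edge (αω i j) (ω j k) (γ₀ i k)

/-- The second configuration on the index set `J`. -/
def Conf2 : Prop :=
  ∃ α β γ₀ ω βω γω : ℕ → ℕ → V,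
    (S.Choice J α ∧ S.Choice J β ∧ S.Choice J γ₀ ∧ S.Choice J ω ∧ S.Choice J βω ∧
      S.Choice J γω) ∧
    ∀ i ∈ J, ∀ j ∈ J, ∀ k ∈ J, i < j → j < k →
      S.edge (α i j) (β j k) (γ₀ i k) ∧ S.edge (α i j) (ω j k) (γω i k) ∧
        S.edge (ω i j) (βω j k) (γ₀ i k)

/-- The third configuration on the index set `J`. -/
def Conf3 : Prop :=
  ∃ (α β α' β' γ₀ γb : ℕ → ℕ → V) (βb αb : ℕ → ℕ → ℕ → ℕ → ℕ → V),
    (S.Choice J α ∧ S.Choice J β ∧ S.Choice J α' ∧ S.Choice J β' ∧ S.Choice J γ₀ ∧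
      S.Choice J γb) ∧
    (∀ i ∈ J, ∀ j ∈ J, ∀ k ∈ J, i < j → j < k → S.edge (α i j) (β j k) (γ₀ i k)) ∧
    ∀ i ∈ J, ∀ j ∈ J, ∀ k ∈ J, ∀ s ∈ J, ∀ t ∈ J, i < j → j < k → k < s → s < t →
      βb i j k s t ∈ S.part j k ∧ αb i j k s t ∈ S.part k s ∧
      S.edge (α' i j) (βb i j k s t) (γ₀ i k) ∧
      S.edge (βb i j k s t) (αb i j k s t) (γb j s) ∧
      S.edge (αb i j k s t) (β' s t) (γ₀ k t)

/-- A strengthening of the fourth configuration on the index set `J`, where the additional vertices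
`u`, `v` are available in all parts. -/
def Conf4 : Prop :=
  ∃ αs βs γ α₁ β₁ γ₁ α₂ β₂ γ₂ u v : ℕ → ℕ → V,
    (S.Choice J αs ∧ S.Choice J βs ∧ S.Choice J γ ∧ S.Choice J α₁ ∧ S.Choice J β₁ ∧
      S.Choice J γ₁ ∧ S.Choice J α₂ ∧ S.Choice J β₂ ∧ S.Choice J γ₂ ∧ S.Choice J u ∧
      S.Choice J v) ∧
    ∀ i ∈ J, ∀ j ∈ J, ∀ k ∈ J, i < j → j < k →
      (S.edge (γ₁ i j) (βs j k) (γ i k) ∧ S.edge (αs i j) (γ₂ j k) (γ i k) ∧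
        S.edge (α₁ i j) (β₁ j k) (γ₁ i k) ∧ S.edge (α₂ i j) (β₂ j k) (γ₂ i k)) ∧
      (∃ b ∈ S.part j k, S.edge (u i j) b (γ₂ i k)) ∧
      (∃ a ∈ S.part i j, S.edge a (v j k) (γ₁ i k)) ∧
      ∃ c ∈ S.part i k, S.edge (u i j) (v j k) c

end configurations

theorem NonemptyOn.mono {V : Type*} {S : TriSystem V} {Y Z : Finset ℕ} (h : S.NonemptyOn Y)
    (hZ : Z ⊆ Y) : S.NonemptyOn Z := fun i hi j hj hij => h i (hZ hi) j (hZ hj) hij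

theorem Choice.mono {V : Type*} {S : TriSystem V} {Y Z : Finset ℕ} {x : ℕ → ℕ → V}
    (h : S.Choice Y x) (hZ : Z ⊆ Y) : S.Choice Z x :=
  fun i hi j hj hij => h i (hZ hi) j (hZ hj) hij

/-- If many pairs within the right sides of the links of `x` are joined via `y`, then the first
configuration exists. -/
theorem exists_conf1 {ε η : ℝ} (hε : 0 < ε) (hη : 0 < η) (M : ℕ) :
    ∃ N : ℕ, ∀ {V : Type*} [Nonempty V] (S : TriSystem V) (Y : Finset ℕ) (x y : ℕ → ℕ → V),
      N ≤ #Y → S.NonemptyOn Y → S.Choice Y x → S.Choice Y y →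
      (∀ h ∈ Y, ∀ i ∈ Y, ∀ j ∈ Y, ∀ k ∈ Y, h < i → i < j → j < k →
        η ≤ frac (S.part i j ×ˢ S.part j k) fun u =>
          u.1 ∈ S.coreR ε h i j (x h j) ∧ u.2 ∈ S.coreR ε i j k (x i k) ∧
            S.edge u.1 u.2 (y i k)) →
      ∃ J ⊆ Y, #J = M ∧ S.Conf1 J := by
  obtain ⟨N₄, H₄⟩ := exists_selection_right hε M
  obtain ⟨N₃, H₃⟩ := exists_selection_right hε N₄
  obtain ⟨N₂, H₂⟩ := exists_selection_left (half_pos hη) N₃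
  obtain ⟨N₁, H₁⟩ := exists_selection_left_right (half_pos hη) N₂
  refine ⟨N₁, fun S Y x y hY hne hx hy hbad => ?_⟩
  -- The vertex `ω` lies in the right sides belonging to all lower indices and keeps many partners,
  -- joined through `y`, for all higher ones.
  obtain ⟨Z₁, hZ₁, hc₁, ω, hω⟩ := H₁ Y S.part (fun h i j u => u ∈ S.coreR ε h i j (x h j))
    (fun i j k u => η / 2 ≤ frac (S.part j k) fun v => v ∈ S.coreR ε i j k (x i k) ∧
      S.edge u v (y i k)) hY (by
    intro h hh i hi j hj k hk h1 h2 h3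
    refine (half_le_frac_left hη (hbad h hh i hi j hj k hk h1 h2 h3)).trans
      (frac_mono fun u _ hu => ?_)
    obtain ⟨v, -, hv⟩ := exists_of_frac_pos ((half_pos hη).trans_le hu)
    exact ⟨hv.1, hu.trans (frac_mono fun v _ h => h.2)⟩)
  -- Both `β` and `ω` lie in right sides of cores of `x`, so the minimum degree leaves an `ε` share
  -- of candidates for `α` and for `αω`; `y` plays the role of `γω`.
  obtain ⟨Z₂, hZ₂, hc₂, β, hβ⟩ := H₂ Z₁ S.part (fun i j k v => v ∈ S.coreR ε i j k (x i k) ∧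
      S.edge (ω i j) v (y i k)) hc₁.ge
      (fun i hi j hj k hk h1 h2 => (hω i hi j hj h1).2.2 k hk h2)
  obtain ⟨Z₃, hZ₃, hc₃, α, hα⟩ := H₃ Z₂ S.part (fun i j k a => S.edge a (β j k) (x i k)) hc₂.ge
      (fun i hi j hj k hk h1 h2 => by
        have hi' := hZ₁ (hZ₂ hi)
        have hj' := hZ₁ (hZ₂ hj)
        have hk' := hZ₁ (hZ₂ hk)
        exact (le_frac_of_mem_coreR hε.le (hne i hi' j hj' h1) (hne j hj' k hk' h2)
          ((hβ j hj k hk h2).2 i hi h1).1).trans (frac_mono fun v _ h => h.2))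
  obtain ⟨Z₄, hZ₄, hc₄, αω, hαω⟩ := H₄ Z₃ S.part (fun i j k a => S.edge a (ω j k) (x i k)) hc₃.ge
      (fun i hi j hj k hk h1 h2 => by
        have hi' := hZ₂ (hZ₃ hi)
        have hj' := hZ₂ (hZ₃ hj)
        have hk' := hZ₂ (hZ₃ hk)
        exact (le_frac_of_mem_coreR hε.le (hne i (hZ₁ hi') j (hZ₁ hj') h1)
          (hne j (hZ₁ hj') k (hZ₁ hk') h2)
          ((hω j hj' k hk' h2).2.1 i hi' h1)).trans (frac_mono fun v _ h => h.2))
  have s₃ := hZ₄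
  have s₂ := s₃.trans hZ₃
  have s₁ := s₂.trans hZ₂
  have s₀ := s₁.trans hZ₁
  refine ⟨Z₄, s₀, hc₄, α, β, x, ω, αω, y, ⟨fun i hi j hj h => (hα i (s₃ hi) j (s₃ hj) h).1,
    fun i hi j hj h => (hβ i (s₂ hi) j (s₂ hj) h).1, hx.mono s₀,
    fun i hi j hj h => (hω i (s₁ hi) j (s₁ hj) h).1, fun i hi j hj h => (hαω i hi j hj h).1,
    hy.mono s₀⟩, fun i hi j hj k hk h1 h2 => ⟨?_, ?_, ?_⟩⟩
  · exact (hα i (s₃ hi) j (s₃ hj) h1).2 k (s₃ hk) h2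
  · exact ((hβ j (s₂ hj) k (s₂ hk) h2).2 i (s₂ hi) h1).2
  · exact (hαω i hi j hj h1).2 k hk h2

/-- If many pairs within the left sides of the links of `x` are joined via `y`, then the second
configuration exists. -/
theorem exists_conf2 {ε η : ℝ} (hε : 0 < ε) (hη : 0 < η) (M : ℕ) :
    ∃ N : ℕ, ∀ {V : Type*} [Nonempty V] (S : TriSystem V) (Y : Finset ℕ) (x y : ℕ → ℕ → V),
      N ≤ #Y → S.NonemptyOn Y → S.Choice Y x → S.Choice Y y →
      (∀ i ∈ Y, ∀ j ∈ Y, ∀ k ∈ Y, ∀ t ∈ Y, i < j → j < k → k < t →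
        η ≤ frac (S.part i j ×ˢ S.part j k) fun u =>
          u.1 ∈ S.coreL ε i j k (x i k) ∧ u.2 ∈ S.coreL ε j k t (x j t) ∧
            S.edge u.1 u.2 (y i k)) →
      ∃ J ⊆ Y, #J = M ∧ S.Conf2 J := by
  obtain ⟨N₄, H₄⟩ := exists_selection_left hε M
  obtain ⟨N₃, H₃⟩ := exists_selection_left hε N₄
  obtain ⟨N₂, H₂⟩ := exists_selection_right (half_pos hη) N₃
  obtain ⟨N₁, H₁⟩ := exists_selection_left_right (half_pos hη) N₂
  refine ⟨N₁, fun S Y x y hY hne hx hy hbad => ?_⟩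
  -- Mirror image of the previous argument: `ω` lies in left sides, and the partner `α` is found
  -- below it.
  obtain ⟨Z₁, hZ₁, hc₁, ω, hω⟩ := H₁ Y S.part
    (fun i j k v => η / 2 ≤ frac (S.part i j) fun u => u ∈ S.coreL ε i j k (x i k) ∧
      S.edge u v (y i k)) (fun j k t v => v ∈ S.coreL ε j k t (x j t)) hY (by
    intro i hi j hj k hk t ht h1 h2 h3
    refine (half_le_frac_right hη (hbad i hi j hj k hk t ht h1 h2 h3)).trans
      (frac_mono fun u _ hu => ?_)
    obtain ⟨v, -, hv⟩ := exists_of_frac_pos ((half_pos hη).trans_le hu)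
    exact ⟨hu.trans (frac_mono fun v _ h => ⟨h.1, h.2.2⟩), hv.2.1⟩)
  obtain ⟨Z₂, hZ₂, hc₂, α, hα⟩ := H₂ Z₁ S.part (fun i j k u => u ∈ S.coreL ε i j k (x i k) ∧
      S.edge u (ω j k) (y i k)) hc₁.ge
      (fun i hi j hj k hk h1 h2 => (hω j hj k hk h2).2.1 i hi h1)
  obtain ⟨Z₃, hZ₃, hc₃, β, hβ⟩ := H₃ Z₂ S.part (fun i j k b => S.edge (α i j) b (x i k)) hc₂.ge
      (fun i hi j hj k hk h1 h2 => by
        have hi' := hZ₁ (hZ₂ hi)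
        have hj' := hZ₁ (hZ₂ hj)
        have hk' := hZ₁ (hZ₂ hk)
        exact (le_frac_of_mem_coreL hε.le (hne i hi' j hj' h1) (hne j hj' k hk' h2)
          ((hα i hi j hj h1).2 k hk h2).1).trans (frac_mono fun v _ h => h.2))
  obtain ⟨Z₄, hZ₄, hc₄, βω, hβω⟩ := H₄ Z₃ S.part (fun i j k b => S.edge (ω i j) b (x i k)) hc₃.ge
      (fun i hi j hj k hk h1 h2 => by
        have hi' := hZ₂ (hZ₃ hi)
        have hj' := hZ₂ (hZ₃ hj)
        have hk' := hZ₂ (hZ₃ hk)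
        exact (le_frac_of_mem_coreL hε.le (hne i (hZ₁ hi') j (hZ₁ hj') h1)
          (hne j (hZ₁ hj') k (hZ₁ hk') h2)
          ((hω i hi' j hj' h1).2.2 k hk' h2)).trans (frac_mono fun v _ h => h.2))
  have s₃ := hZ₄
  have s₂ := s₃.trans hZ₃
  have s₁ := s₂.trans hZ₂
  have s₀ := s₁.trans hZ₁
  refine ⟨Z₄, s₀, hc₄, α, β, x, ω, βω, y, ⟨fun i hi j hj h => (hα i (s₂ hi) j (s₂ hj) h).1,
    fun i hi j hj h => (hβ i (s₃ hi) j (s₃ hj) h).1, hx.mono s₀,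
    fun i hi j hj h => (hω i (s₁ hi) j (s₁ hj) h).1, fun i hi j hj h => (hβω i hi j hj h).1,
    hy.mono s₀⟩, fun i hi j hj k hk h1 h2 => ⟨?_, ?_, ?_⟩⟩
  · exact (hβ j (s₃ hj) k (s₃ hk) h2).2 i (s₃ hi) h1
  · exact ((hα i (s₂ hi) j (s₂ hj) h1).2 k (s₂ hk) h2).2
  · exact (hβω j hj k hk h2).2 i hi h1

/-- If the left and right sides of the links of `x` overlap, then the first configuration exists. -/
theorem exists_conf1_of_overlap {ε η : ℝ} (hε : 0 < ε) (hη : 0 < η) (M : ℕ) :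
    ∃ N : ℕ, ∀ {V : Type*} [Nonempty V] (S : TriSystem V) (Y : Finset ℕ) (x : ℕ → ℕ → V),
      N ≤ #Y → S.NonemptyOn Y → S.Choice Y x →
      (∀ i ∈ Y, ∀ j ∈ Y, ∀ k ∈ Y, ∀ t ∈ Y, i < j → j < k → k < t →
        η ≤ frac (S.part j k) fun u =>
          u ∈ S.coreR ε i j k (x i k) ∧ u ∈ S.coreL ε j k t (x j t)) →
      ∃ J ⊆ Y, #J = M ∧ S.Conf1 J := by
  obtain ⟨N, H⟩ := exists_conf1 hε (mul_pos hη hε) M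
  -- A vertex of the overlap has an `ε` share of core neighbours, all in the right side of the next
  -- link. This gives density `η * ε` of right-side pairs joined through `x` itself.
  refine ⟨N, fun S Y x hY hne hx hbad => H S Y x x hY hne hx hx ?_⟩
  intro h hh i hi j hj k hk h1 h2 h3
  rw [frac_product]
  calc η * ε ≤ (frac (S.part i j) fun u =>
          u ∈ S.coreR ε h i j (x h j) ∧ u ∈ S.coreL ε i j k (x i k)) * ε := by
        gcongr
        exact hbad h hh i hi j hj k hk h1 h2 h3
    _ ≤ _ := by
        rw [frac, expect_mul]
        refine expect_le_expect fun u _ => ?_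
        by_cases hu : u ∈ S.coreR ε h i j (x h j) ∧ u ∈ S.coreL ε i j k (x i k)
        · rw [ind_of hu, one_mul]
          exact (le_frac_of_mem_coreL hε.le (hne i hi j hj h2) (hne j hj k hk h3) hu.2).trans
            (frac_mono fun v _ h => ⟨hu.1, h⟩)
        · rw [ind_of_not hu, zero_mul]
          exact frac_nonneg _ _

end TriSystem

/-! ### Dominating tuples and the third configuration -/

theorem frac_product_fst_le {β γ : Type*} (A : Finset β) (B : Finset γ) (p : β → Prop) :
    (frac (A ×ˢ B) fun u => p u.1) ≤ frac A p := by
  rw [frac_product]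
  refine expect_le_expect fun a _ => ?_
  by_cases ha : p a
  · rw [ind_of ha]; exact frac_le_one _ _
  · rw [ind_of_not ha, frac, expect_eq_zero fun b _ => ind_of_not ha]

theorem frac_product_snd_le {β γ : Type*} (A : Finset β) (B : Finset γ) (p : γ → Prop) :
    (frac (A ×ˢ B) fun u => p u.2) ≤ frac B p := by
  rw [frac_product_right]
  refine expect_le_expect fun a _ => ?_
  by_cases ha : p a
  · rw [ind_of ha]; exact frac_le_one _ _
  · rw [ind_of_not ha, frac, expect_eq_zero fun b _ => ind_of_not ha]

theorem frac_piFinset_forall {β : Type*} (A : Finset β) (p : β → Prop) (m : ℕ) :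
    (frac (Fintype.piFinset fun _ : Fin m => A) fun f => ∀ a, p (f a)) = frac A p ^ m := by
  classical
  rw [frac_eq_card_div, frac_eq_card_div, div_pow, Fintype.card_piFinset_const,
    ← Nat.cast_pow, ← Nat.cast_pow]
  congr 2
  rw [← Fintype.card_piFinset_const]
  congr 1
  ext f
  simp [Fintype.mem_piFinset, forall_and]

theorem frac_not {β : Type*} {A : Finset β} (hA : A.Nonempty) (p : β → Prop) :
    (frac A fun a => ¬p a) = 1 - frac A p := by
  rw [eq_sub_iff_add_eq, frac, frac, ← expect_add_distrib, ← expect_const hA (1 : ℝ)]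
  refine expect_congr rfl fun a _ => ?_
  by_cases ha : p a <;> simp [ind, ha]

/-- If every element of `B'` has degree at least `ε` into `A`, then at least half of all `m`-tuples
in `A` dominate all but a proportion `θ` of `B'`, provided `m` is large. -/
theorem half_le_frac_covering {β γ : Type*} {A : Finset β} {B : Finset γ} (hA : A.Nonempty)
    (q : γ → Prop) (g : β → γ → Prop) {ε θ : ℝ} (hθ : 0 < θ) {m : ℕ}
    (hm : (1 - ε) ^ m ≤ θ / 2) (h : ∀ b ∈ B, q b → ε ≤ frac A fun a => g a b) :
    1 / 2 ≤ frac (Fintype.piFinset fun _ : Fin m => A) fun f =>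
      (frac B fun b => q b ∧ ∀ a, ¬g (f a) b) ≤ θ := by
  have hW : (Fintype.piFinset fun _ : Fin m => A).Nonempty :=
    Fintype.piFinset_nonempty.2 fun _ => hA
  -- A fixed `b` satisfying `q` is missed by all `m` independent random choices with probability at
  -- most `(1 - ε) ^ m`.
  have h1 : (𝔼 f ∈ Fintype.piFinset fun _ : Fin m => A, frac B fun b => q b ∧ ∀ a, ¬g (f a) b)
      ≤ θ / 2 := by
    unfold frac
    rw [expect_comm]
    rcases B.eq_empty_or_nonempty with rfl | hB
    · rw [expect_empty]; positivity
    refine expect_le hB fun b hb => ?_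
    by_cases hq : q b
    · refine le_trans (le_of_eq ?_) (le_trans (pow_le_pow_left₀ (frac_nonneg A fun a => ¬g a b)
        (by rw [frac_not hA]; linarith [h b hb hq]) m) hm)
      rw [← frac_piFinset_forall]
      exact frac_congr fun f _ => by simp [hq]
    · rw [expect_eq_zero fun f _ => ind_of_not fun h => hq h.1]
      positivity
  -- Markov's inequality.
  have h2 : (1 : ℝ) - (θ / 2) / θ ≤ frac (Fintype.piFinset fun _ : Fin m => A) fun f =>
      (frac B fun b => q b ∧ ∀ a, ¬g (f a) b) ≤ θ := by
    calc (1 : ℝ) - (θ / 2) / θ ≤ 1 - (𝔼 f ∈ Fintype.piFinset fun _ : Fin m => A,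
            frac B fun b => q b ∧ ∀ a, ¬g (f a) b) / θ := by gcongr
      _ = 𝔼 f ∈ Fintype.piFinset fun _ : Fin m => A,
            (1 - (frac B fun b => q b ∧ ∀ a, ¬g (f a) b) / θ) := by
          rw [expect_sub_distrib, expect_const hW, expect_div]
      _ ≤ _ := by
          refine expect_le_expect fun f _ => ?_
          by_cases hf : (frac B fun b => q b ∧ ∀ a, ¬g (f a) b) ≤ θ
          · rw [ind_of hf]
            have := frac_nonneg B fun b => q b ∧ ∀ a, ¬g (f a) b
            have : 0 ≤ (frac B fun b => q b ∧ ∀ a, ¬g (f a) b) / θ := by positivity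
            linarith
          · rw [ind_of_not hf]
            have : 1 ≤ (frac B fun b => q b ∧ ∀ a, ¬g (f a) b) / θ := by
              rw [le_div_iff₀ hθ]
              linarith
            linarith
  have h3 : (1 : ℝ) - (θ / 2) / θ = 1 / 2 := by field_simp; norm_num
  linarith

namespace TriSystem

/-- If many pairs leading from the right sides to the left sides of the links of `x` are joined via
`y`, then the third configuration exists. -/
theorem exists_conf3 {ε η : ℝ} (hε : 0 < ε) (hε1 : ε ≤ 1) (hη : 0 < η) (M : ℕ) :
    ∃ N : ℕ, ∀ {V : Type*} [Nonempty V] (S : TriSystem V) (Y : Finset ℕ) (x y : ℕ → ℕ → V),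
      N ≤ #Y → S.NonemptyOn Y → S.Choice Y x → S.Choice Y y →
      (∀ i ∈ Y, ∀ j ∈ Y, ∀ k ∈ Y, ∀ s ∈ Y, ∀ t ∈ Y, i < j → j < k → k < s → s < t →
        η ≤ frac (S.part j k ×ˢ S.part k s) fun u =>
          u.1 ∈ S.coreR ε i j k (x i k) ∧ u.2 ∈ S.coreL ε k s t (x k t) ∧
            S.edge u.1 u.2 (y j s)) →
      ∃ J ⊆ Y, #J = M ∧ S.Conf3 J := by
  -- Tuples will miss at most `η / 4` on each of the two sides, which leaves half of the `η` share
  -- of joined pairs. Length `m + 1` ensures that a tuple has an entry.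
  obtain ⟨m, hm⟩ := exists_pow_lt_of_lt_one (show 0 < η / 4 / 2 by positivity)
    (show 1 - ε < 1 by linarith)
  have hm' : (1 - ε) ^ (m + 1) ≤ η / 4 / 2 :=
    (pow_le_pow_of_le_one (by linarith) (by linarith) (Nat.le_succ m)).trans hm.le
  obtain ⟨N₅, H₅⟩ := exists_homogeneous_five (κ := Fin (m + 1) × Fin (m + 1)) M
  obtain ⟨N₄, H₄⟩ := exists_selection_left (show (0 : ℝ) < 1 / 2 by norm_num) N₅
  obtain ⟨N₃, H₃⟩ := exists_selection_right (show (0 : ℝ) < 1 / 2 by norm_num) N₄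
  obtain ⟨N₂, H₂⟩ := exists_selection_left hε N₃
  obtain ⟨N₁, H₁⟩ := exists_selection_right hε N₂
  refine ⟨N₁ + 2, fun {V} _ S Y x y hY hne hx hy hbad => ?_⟩
  -- Two top indices are reserved to extend triples to quintuples: the hypothesis then gives a
  -- vertex in each right side, whose degree makes the left side large.
  obtain ⟨Y', hY', T, hT, hcY', hcT, hlt⟩ := exists_split Y N₁ 2 hY
  obtain ⟨s, t, hst, hsT, htT⟩ : ∃ s t, s < t ∧ s ∈ T ∧ t ∈ T := by
    obtain ⟨s, t, hst, rfl⟩ := card_eq_two.1 hcT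
    rcases lt_or_gt_of_ne hst with h | h
    · exact ⟨s, t, h, by simp, by simp⟩
    · exact ⟨t, s, h, by simp, by simp⟩
  have hL : ∀ i ∈ Y', ∀ j ∈ Y', ∀ k ∈ Y', i < j → j < k →
      ε ≤ frac (S.part i j) (· ∈ S.coreL ε i j k (x i k)) := by
    intro i hi j hj k hk h1 h2
    obtain ⟨u, -, hu⟩ := exists_of_frac_pos (hη.trans_le (hbad i (hY' hi) j (hY' hj) k (hY' hk)
      s (hT hsT) t (hT htT) h1 h2 (hlt k hk s hsT) hst))
    exact (le_frac_of_mem_coreR hε.le (hne i (hY' hi) j (hY' hj) h1)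
      (hne j (hY' hj) k (hY' hk) h2) hu.1).trans (frac_mono fun v _ h => h.1)
  obtain ⟨Z₁, hZ₁, hc₁, α, hα⟩ := H₁ Y' S.part (fun i j k a => a ∈ S.coreL ε i j k (x i k))
    hcY'.ge hL
  have t₁ := hZ₁.trans hY'
  obtain ⟨Z₂, hZ₂, hc₂, β, hβ⟩ := H₂ Z₁ S.part (fun i j k b => S.edge (α i j) b (x i k)) hc₁.ge
    (fun i hi j hj k hk h1 h2 => (le_frac_of_mem_coreL hε.le (hne i (t₁ hi) j (t₁ hj) h1)
      (hne j (t₁ hj) k (t₁ hk) h2) ((hα i hi j hj h1).2 k hk h2)).trans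
        (frac_mono fun v _ h => h.2))
  have t₂ := hZ₂.trans t₁
  -- No single `α'` need reach a suitable joined pair for all higher indices, but a bounded tuple
  -- can dominate nearly the whole right side of every link at once. The tuple `g` does the same for
  -- left sides.
  obtain ⟨Z₃, hZ₃, hc₃, f, hf⟩ := H₃ Z₂
    (fun i j => Fintype.piFinset fun _ : Fin (m + 1) => S.part i j)
    (fun i j k f => (frac (S.part j k) fun b => b ∈ S.coreR ε i j k (x i k) ∧
      ∀ a, ¬S.edge (f a) b (x i k)) ≤ η / 4) hc₂.ge (fun i hi j hj k hk h1 h2 =>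
        half_le_frac_covering (hne i (t₂ hi) j (t₂ hj) h1)
          (fun b => b ∈ S.coreR ε i j k (x i k)) (fun a b => S.edge a b (x i k)) (by positivity) hm'
          fun b _ hb => (le_frac_of_mem_coreR hε.le (hne i (t₂ hi) j (t₂ hj) h1)
            (hne j (t₂ hj) k (t₂ hk) h2) hb).trans (frac_mono fun v _ h => h.2))
  have t₃ := hZ₃.trans t₂
  obtain ⟨Z₄, hZ₄, hc₄, g, hg⟩ := H₄ Z₃
    (fun i j => Fintype.piFinset fun _ : Fin (m + 1) => S.part i j)
    (fun i j k g => (frac (S.part i j) fun a => a ∈ S.coreL ε i j k (x i k) ∧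
      ∀ b, ¬S.edge a (g b) (x i k)) ≤ η / 4) hc₃.ge (fun i hi j hj k hk h1 h2 =>
        half_le_frac_covering (hne j (t₃ hj) k (t₃ hk) h2)
          (fun a => a ∈ S.coreL ε i j k (x i k)) (fun b a => S.edge a b (x i k)) (by positivity) hm'
          fun b _ hb => (le_frac_of_mem_coreL hε.le (hne i (t₃ hi) j (t₃ hj) h1)
            (hne j (t₃ hj) k (t₃ hk) h2) hb).trans (frac_mono fun v _ h => h.2))
  have t₄ := hZ₄.trans t₃
  let P : ℕ → ℕ → ℕ → ℕ → ℕ → Fin (m + 1) × Fin (m + 1) → Prop := fun i j k s t ab =>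
    ∃ v ∈ S.part j k, ∃ w ∈ S.part k s, S.edge (f i j ab.1) v (x i k) ∧ S.edge v w (y j s) ∧
      S.edge w (g s t ab.2) (x k t)
  have hP : ∀ i ∈ Z₄, ∀ j ∈ Z₄, ∀ k ∈ Z₄, ∀ s ∈ Z₄, ∀ t ∈ Z₄, i < j → j < k → k < s → s < t →
      ∃ ab, P i j k s t ab := by
    intro i hi j hj k hk s hs t ht h1 h2 h3 h4
    have e1 := hbad i (t₄ hi) j (t₄ hj) k (t₄ hk) s (t₄ hs) t (t₄ ht) h1 h2 h3 h4
    have e2 := (hf i (hZ₄ hi) j (hZ₄ hj) h1).2 k (hZ₄ hk) h2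
    have e3 := (hg s hs t ht h4).2 k hk h3
    have e4 : (frac (S.part j k ×ˢ S.part k s) fun u =>
          u.1 ∈ S.coreR ε i j k (x i k) ∧ u.2 ∈ S.coreL ε k s t (x k t) ∧
            S.edge u.1 u.2 (y j s)) ≤
        (frac (S.part j k ×ˢ S.part k s) fun u => (∃ a, S.edge (f i j a) u.1 (x i k)) ∧
          S.edge u.1 u.2 (y j s) ∧ ∃ b, S.edge u.2 (g s t b) (x k t)) +
        (frac (S.part j k ×ˢ S.part k s) fun u =>
          (u.1 ∈ S.coreR ε i j k (x i k) ∧ ∀ a, ¬S.edge (f i j a) u.1 (x i k)) ∨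
          (u.2 ∈ S.coreL ε k s t (x k t) ∧ ∀ b, ¬S.edge u.2 (g s t b) (x k t))) := by
      refine frac_le_add fun u _ hu => ?_
      by_cases c1 : ∃ a, S.edge (f i j a) u.1 (x i k)
      · by_cases c2 : ∃ b, S.edge u.2 (g s t b) (x k t)
        · exact Or.inl ⟨c1, hu.2.2, c2⟩
        · exact Or.inr (Or.inr ⟨hu.2.1, not_exists.1 c2⟩)
      · exact Or.inr (Or.inl ⟨hu.1, not_exists.1 c1⟩)
    have e5 := frac_le_add (W := S.part j k ×ˢ S.part k s) (p := fun u =>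
          (u.1 ∈ S.coreR ε i j k (x i k) ∧ ∀ a, ¬S.edge (f i j a) u.1 (x i k)) ∨
          (u.2 ∈ S.coreL ε k s t (x k t) ∧ ∀ b, ¬S.edge u.2 (g s t b) (x k t)))
      (fun u _ hu => hu)
    have e6 := frac_product_fst_le (S.part j k) (S.part k s) fun v =>
      v ∈ S.coreR ε i j k (x i k) ∧ ∀ a, ¬S.edge (f i j a) v (x i k)
    have e7 := frac_product_snd_le (S.part j k) (S.part k s) fun w =>
      w ∈ S.coreL ε k s t (x k t) ∧ ∀ b, ¬S.edge w (g s t b) (x k t)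
    obtain ⟨u, hu, ⟨a, ha⟩, he, b, hb⟩ := exists_of_frac_pos
      (p := fun u : V × V => (∃ a, S.edge (f i j a) u.1 (x i k)) ∧
          S.edge u.1 u.2 (y j s) ∧ ∃ b, S.edge u.2 (g s t b) (x k t))
      (W := S.part j k ×ˢ S.part k s) (by linarith)
    exact ⟨(a, b), u.1, (mem_product.1 hu).1, u.2, (mem_product.1 hu).2, ha, he, hb⟩
  -- Ramsey's theorem fixes which entries of the two tuples are used, so that `α'` and `β'` depend
  -- on two indices only.
  obtain ⟨Z₅, hZ₅, hc₅, c, hc⟩ := H₅ Z₄ hc₄.ge fun i j k s t => Classical.epsilon (P i j k s t)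
  have hP' : ∀ i ∈ Z₅, ∀ j ∈ Z₅, ∀ k ∈ Z₅, ∀ s ∈ Z₅, ∀ t ∈ Z₅, i < j → j < k → k < s → s < t →
      P i j k s t c := by
    intro i hi j hj k hk s hs t ht h1 h2 h3 h4
    rw [← hc i hi j hj k hk s hs t ht h1 h2 h3 h4]
    exact Classical.epsilon_spec (hP i (hZ₅ hi) j (hZ₅ hj) k (hZ₅ hk) s (hZ₅ hs) t (hZ₅ ht)
      h1 h2 h3 h4)
  choose! v hv w hw he using hP'
  have u₃ := hZ₅.trans hZ₄
  have u₂ := u₃.trans hZ₃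
  have u₁ := u₂.trans hZ₂
  have u₀ := u₁.trans t₁
  refine ⟨Z₅, u₀, hc₅, α, β, fun i j => f i j c.1, fun i j => g i j c.2, x, y, v, w,
    ⟨fun i hi j hj h => (hα i (u₁ hi) j (u₁ hj) h).1,
    fun i hi j hj h => (hβ i (u₂ hi) j (u₂ hj) h).1,
    fun i hi j hj h => Fintype.mem_piFinset.1 (hf i (u₃ hi) j (u₃ hj) h).1 _,
    fun i hi j hj h => Fintype.mem_piFinset.1 (hg i (hZ₅ hi) j (hZ₅ hj) h).1 _,
    hx.mono u₀, hy.mono u₀⟩,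
    fun i hi j hj k hk h1 h2 => (hβ j (u₂ hj) k (u₂ hk) h2).2 i (u₂ hi) h1, ?_⟩
  intro i hi j hj k hk s hs t ht h1 h2 h3 h4
  exact ⟨hv i hi j hj k hk s hs t ht h1 h2 h3 h4, hw i hi j hj k hk s hs t ht h1 h2 h3 h4,
    he i hi j hj k hk s hs t ht h1 h2 h3 h4⟩

/-- Vertices completing `y₁` and `y₂` to edges with top vertices `x`. -/
theorem exists_conf4_tops {ε : ℝ} (hε : 0 < ε) (M : ℕ) :
    ∃ N : ℕ, ∀ {V : Type*} [Nonempty V] (S : TriSystem V) (Y : Finset ℕ)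
      (x y₁ y₂ : ℕ → ℕ → V), N ≤ #Y → S.NonemptyOn Y →
      (∀ i ∈ Y, ∀ j ∈ Y, ∀ k ∈ Y, i < j → j < k → y₁ i j ∈ S.coreL ε i j k (x i k)) →
      (∀ i ∈ Y, ∀ j ∈ Y, ∀ k ∈ Y, i < j → j < k → y₂ j k ∈ S.coreR ε i j k (x i k)) →
      ∃ Z ⊆ Y, #Z = M ∧ ∃ αs βs : ℕ → ℕ → V, S.Choice Z αs ∧ S.Choice Z βs ∧
        ∀ i ∈ Z, ∀ j ∈ Z, ∀ k ∈ Z, i < j → j < k →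
          S.edge (y₁ i j) (βs j k) (x i k) ∧ S.edge (αs i j) (y₂ j k) (x i k) := by
  obtain ⟨N₂, H₂⟩ := exists_selection_left hε M
  obtain ⟨N₁, H₁⟩ := exists_selection_right hε N₂
  refine ⟨N₁, fun S Y x y₁ y₂ hY hne hy₁ hy₂ => ?_⟩
  obtain ⟨Z₁, hZ₁, hc₁, αs, hα⟩ := H₁ Y S.part (fun i j k a => S.edge a (y₂ j k) (x i k)) hY
    (fun i hi j hj k hk h1 h2 => (le_frac_of_mem_coreR hε.le (hne i hi j hj h1)
      (hne j hj k hk h2) (hy₂ i hi j hj k hk h1 h2)).trans (frac_mono fun v _ h => h.2))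
  obtain ⟨Z₂, hZ₂, hc₂, βs, hβ⟩ := H₂ Z₁ S.part (fun i j k b => S.edge (y₁ i j) b (x i k)) hc₁.ge
    (fun i hi j hj k hk h1 h2 => (le_frac_of_mem_coreL hε.le (hne i (hZ₁ hi) j (hZ₁ hj) h1)
      (hne j (hZ₁ hj) k (hZ₁ hk) h2) (hy₁ i (hZ₁ hi) j (hZ₁ hj) k (hZ₁ hk) h1 h2)).trans
        (frac_mono fun v _ h => h.2))
  exact ⟨Z₂, hZ₂.trans hZ₁, hc₂, αs, βs, fun i hi j hj h => (hα i (hZ₂ hi) j (hZ₂ hj) h).1,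
    fun i hi j hj h => (hβ i hi j hj h).1, fun i hi j hj k hk h1 h2 =>
    ⟨(hβ j hj k hk h2).2 i hi h1, (hα i (hZ₂ hi) j (hZ₂ hj) h1).2 k (hZ₂ hk) h2⟩⟩

/-- If the left sides of the links of `y₁` and `y₂` overlap, then the fourth configuration
exists. -/
theorem exists_conf4_of_left {ε η : ℝ} (hε : 0 < ε) (hη : 0 < η) (M : ℕ) :
    ∃ N : ℕ, ∀ {V : Type*} [Nonempty V] (S : TriSystem V) (Y : Finset ℕ)
      (x y₁ y₂ : ℕ → ℕ → V), N ≤ #Y → S.NonemptyOn Y →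
      S.Choice Y x → S.Choice Y y₁ → S.Choice Y y₂ →
      (∀ i ∈ Y, ∀ j ∈ Y, ∀ k ∈ Y, i < j → j < k → y₁ i j ∈ S.coreL ε i j k (x i k)) →
      (∀ i ∈ Y, ∀ j ∈ Y, ∀ k ∈ Y, i < j → j < k → y₂ j k ∈ S.coreR ε i j k (x i k)) →
      (∀ i ∈ Y, ∀ j ∈ Y, ∀ k ∈ Y, i < j → j < k → η ≤ frac (S.part i j) fun u =>
        u ∈ S.coreL ε i j k (y₁ i k) ∧ u ∈ S.coreL ε i j k (y₂ i k)) →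
      ∃ J ⊆ Y, #J = M ∧ S.Conf4 J := by
  obtain ⟨N₄, H₄⟩ := exists_conf4_tops hε M
  obtain ⟨N₃, H₃⟩ := exists_selection_left hε N₄
  obtain ⟨N₂, H₂⟩ := exists_selection_left hε N₃
  obtain ⟨N₁, H₁⟩ := exists_selection_right hη N₂
  refine ⟨N₁, fun S Y x y₁ y₂ hY hne hx hc₁ hc₂ hy₁ hy₂ hbad => ?_⟩
  -- The common vertex `u` serves as `α₁`, as `α₂` and as the extra left vertex; `v` completes it
  -- with `y₁`, and this edge contains both extra vertices.
  obtain ⟨Z₁, hZ₁, hcZ₁, u, hu⟩ := H₁ Y S.part (fun i j k u =>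
    u ∈ S.coreL ε i j k (y₁ i k) ∧ u ∈ S.coreL ε i j k (y₂ i k)) hY hbad
  obtain ⟨Z₂, hZ₂, hcZ₂, v, hv⟩ := H₂ Z₁ S.part (fun i j k b => S.edge (u i j) b (y₁ i k)) hcZ₁.ge
    (fun i hi j hj k hk h1 h2 => (le_frac_of_mem_coreL hε.le (hne i (hZ₁ hi) j (hZ₁ hj) h1)
      (hne j (hZ₁ hj) k (hZ₁ hk) h2) ((hu i hi j hj h1).2 k hk h2).1).trans
        (frac_mono fun v _ h => h.2))
  have t₂ := hZ₂.trans hZ₁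
  obtain ⟨Z₃, hZ₃, hcZ₃, β₂, hβ₂⟩ := H₃ Z₂ S.part (fun i j k b => S.edge (u i j) b (y₂ i k)) hcZ₂.ge
    (fun i hi j hj k hk h1 h2 => (le_frac_of_mem_coreL hε.le (hne i (t₂ hi) j (t₂ hj) h1)
      (hne j (t₂ hj) k (t₂ hk) h2) ((hu i (hZ₂ hi) j (hZ₂ hj) h1).2 k (hZ₂ hk) h2).2).trans
        (frac_mono fun v _ h => h.2))
  have t₃ := hZ₃.trans t₂
  obtain ⟨Z₄, hZ₄, hcZ₄, αs, βs, hαs, hβs, he⟩ := H₄ S Z₃ x y₁ y₂ hcZ₃.ge (hne.mono t₃)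
    (fun i hi j hj k hk => hy₁ i (t₃ hi) j (t₃ hj) k (t₃ hk))
    (fun i hi j hj k hk => hy₂ i (t₃ hi) j (t₃ hj) k (t₃ hk))
  have t₄ := hZ₄.trans t₃
  have u₂ := hZ₄.trans hZ₃
  have u₁ := u₂.trans hZ₂
  have hcu : S.Choice Z₄ u := fun i hi j hj h => (hu i (u₁ hi) j (u₁ hj) h).1
  have hcv : S.Choice Z₄ v := fun i hi j hj h => (hv i (u₂ hi) j (u₂ hj) h).1
  have hcβ : S.Choice Z₄ β₂ := fun i hi j hj h => (hβ₂ i (hZ₄ hi) j (hZ₄ hj) h).1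
  refine ⟨Z₄, t₄, hcZ₄, αs, βs, x, u, v, y₁, u, β₂, y₂, u, v,
    ⟨hαs, hβs, hx.mono t₄, hcu, hcv, hc₁.mono t₄, hcu, hcβ, hc₂.mono t₄, hcu, hcv⟩,
    fun i hi j hj k hk h1 h2 => ?_⟩
  have e1 := (hv j (u₂ hj) k (u₂ hk) h2).2 i (u₂ hi) h1
  have e2 := (hβ₂ j (hZ₄ hj) k (hZ₄ hk) h2).2 i (hZ₄ hi) h1
  exact ⟨⟨(he i hi j hj k hk h1 h2).1, (he i hi j hj k hk h1 h2).2, e1, e2⟩,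
    ⟨_, hcβ j hj k hk h2, e2⟩, ⟨_, hcu i hi j hj h1, e1⟩,
    ⟨_, hc₁.mono t₄ i hi k hk (h1.trans h2), e1⟩⟩

/-- If the right sides of the links of `y₁` and `y₂` overlap, then the fourth configuration
exists. -/
theorem exists_conf4_of_right {ε η : ℝ} (hε : 0 < ε) (hη : 0 < η) (M : ℕ) :
    ∃ N : ℕ, ∀ {V : Type*} [Nonempty V] (S : TriSystem V) (Y : Finset ℕ)
      (x y₁ y₂ : ℕ → ℕ → V), N ≤ #Y → S.NonemptyOn Y →
      S.Choice Y x → S.Choice Y y₁ → S.Choice Y y₂ →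
      (∀ i ∈ Y, ∀ j ∈ Y, ∀ k ∈ Y, i < j → j < k → y₁ i j ∈ S.coreL ε i j k (x i k)) →
      (∀ i ∈ Y, ∀ j ∈ Y, ∀ k ∈ Y, i < j → j < k → y₂ j k ∈ S.coreR ε i j k (x i k)) →
      (∀ i ∈ Y, ∀ j ∈ Y, ∀ k ∈ Y, i < j → j < k → η ≤ frac (S.part j k) fun u =>
        u ∈ S.coreR ε i j k (y₁ i k) ∧ u ∈ S.coreR ε i j k (y₂ i k)) →
      ∃ J ⊆ Y, #J = M ∧ S.Conf4 J := by
  obtain ⟨N₄, H₄⟩ := exists_conf4_tops hε M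
  obtain ⟨N₃, H₃⟩ := exists_selection_right hε N₄
  obtain ⟨N₂, H₂⟩ := exists_selection_right hε N₃
  obtain ⟨N₁, H₁⟩ := exists_selection_left hη N₂
  refine ⟨N₁, fun S Y x y₁ y₂ hY hne hx hc₁ hc₂ hy₁ hy₂ hbad => ?_⟩
  -- Here `v` is the common right vertex, and the edge containing both extra vertices has top `y₂`.
  obtain ⟨Z₁, hZ₁, hcZ₁, v, hv⟩ := H₁ Y S.part (fun i j k u =>
    u ∈ S.coreR ε i j k (y₁ i k) ∧ u ∈ S.coreR ε i j k (y₂ i k)) hY hbad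
  obtain ⟨Z₂, hZ₂, hcZ₂, u, hu⟩ := H₂ Z₁ S.part (fun i j k a => S.edge a (v j k) (y₂ i k)) hcZ₁.ge
    (fun i hi j hj k hk h1 h2 => (le_frac_of_mem_coreR hε.le (hne i (hZ₁ hi) j (hZ₁ hj) h1)
      (hne j (hZ₁ hj) k (hZ₁ hk) h2) ((hv j hj k hk h2).2 i hi h1).2).trans
        (frac_mono fun v _ h => h.2))
  have t₂ := hZ₂.trans hZ₁
  obtain ⟨Z₃, hZ₃, hcZ₃, α₁, hα₁⟩ := H₃ Z₂ S.part (fun i j k a => S.edge a (v j k) (y₁ i k)) hcZ₂.ge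
    (fun i hi j hj k hk h1 h2 => (le_frac_of_mem_coreR hε.le (hne i (t₂ hi) j (t₂ hj) h1)
      (hne j (t₂ hj) k (t₂ hk) h2) ((hv j (hZ₂ hj) k (hZ₂ hk) h2).2 i (hZ₂ hi) h1).1).trans
        (frac_mono fun v _ h => h.2))
  have t₃ := hZ₃.trans t₂
  obtain ⟨Z₄, hZ₄, hcZ₄, αs, βs, hαs, hβs, he⟩ := H₄ S Z₃ x y₁ y₂ hcZ₃.ge (hne.mono t₃)
    (fun i hi j hj k hk => hy₁ i (t₃ hi) j (t₃ hj) k (t₃ hk))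
    (fun i hi j hj k hk => hy₂ i (t₃ hi) j (t₃ hj) k (t₃ hk))
  have t₄ := hZ₄.trans t₃
  have u₂ := hZ₄.trans hZ₃
  have u₁ := u₂.trans hZ₂
  have hcv : S.Choice Z₄ v := fun i hi j hj h => (hv i (u₁ hi) j (u₁ hj) h).1
  have hcu : S.Choice Z₄ u := fun i hi j hj h => (hu i (u₂ hi) j (u₂ hj) h).1
  have hcα : S.Choice Z₄ α₁ := fun i hi j hj h => (hα₁ i (hZ₄ hi) j (hZ₄ hj) h).1
  refine ⟨Z₄, t₄, hcZ₄, αs, βs, x, α₁, v, y₁, u, v, y₂, u, v,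
    ⟨hαs, hβs, hx.mono t₄, hcα, hcv, hc₁.mono t₄, hcu, hcv, hc₂.mono t₄, hcu, hcv⟩,
    fun i hi j hj k hk h1 h2 => ?_⟩
  have e1 := (hα₁ i (hZ₄ hi) j (hZ₄ hj) h1).2 k (hZ₄ hk) h2
  have e2 := (hu i (u₂ hi) j (u₂ hj) h1).2 k (u₂ hk) h2
  exact ⟨⟨(he i hi j hj k hk h1 h2).1, (he i hi j hj k hk h1 h2).2, e1, e2⟩,
    ⟨_, hcv j hj k hk h2, e2⟩, ⟨_, hcα i hi j hj h1, e1⟩,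
    ⟨_, hc₂.mono t₄ i hi k hk (h1.trans h2), e2⟩⟩

end TriSystem

/-! ### Numerical estimates -/

/-- AM-GM for `l`, `2 * r` and `2 - l - 2 * r`, whose sum is 2; equality holds at `l = 2 / 3`, `r =
1 / 3`. -/
theorem mul_mul_le_four_div {l r : ℝ} (hl : 0 ≤ l) (hr : 0 ≤ r) :
    l * r * (2 - l - 2 * r) ≤ 4 / 27 := by
  rcases le_total 0 (2 - l - 2 * r) with h | h
  · obtain ⟨c, hc⟩ : ∃ c, c = 2 - l - 2 * r := ⟨_, rfl⟩
    obtain ⟨b, hb⟩ : ∃ b, b = 2 * r := ⟨_, rfl⟩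
    rw [← hc] at h ⊢
    have hb0 : 0 ≤ b := by linarith
    have key : 27 * (l * b * c) ≤ (l + b + c) ^ 3 := by
      nlinarith [mul_nonneg hl (sq_nonneg (b - c)), mul_nonneg hl (sq_nonneg (l - c)),
        mul_nonneg hl (sq_nonneg (l - b)), mul_nonneg hb0 (sq_nonneg (b - c)),
        mul_nonneg hb0 (sq_nonneg (l - c)), mul_nonneg hb0 (sq_nonneg (l - b)),
        mul_nonneg h (sq_nonneg (b - c)), mul_nonneg h (sq_nonneg (l - c)),
        mul_nonneg h (sq_nonneg (l - b))]
    have hs : l + b + c = 2 := by rw [hc, hb]; ring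
    rw [hs] at key
    have : l * r * c = l * b * c / 2 := by rw [hb]; ring
    rw [this]
    linarith
  · have : l * r * (2 - l - 2 * r) ≤ 0 := mul_nonpos_of_nonneg_of_nonpos (by positivity) h
    linarith

/-- The numerical optimization behind the constant `4 / 27`. -/
theorem split_density_le {l r lam m₁ m₂ σ e : ℝ} (he : 0 ≤ e) (he1 : e ≤ 1) (hr : 0 ≤ r)
    (hrl : r ≤ l) (hl1 : l ≤ 1) (hlr : l + r ≤ 1 + e) (hm₁ : m₁ ≤ lam)
    (hlam0 : 0 ≤ lam) (hlam : lam ≤ l * r + e) (hσ : σ ≤ 1 + 4 * e)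
    (h₁ : m₁ + m₂ ≤ σ * (1 + 4 * e - σ) + 6 * e)
    (h₂ : m₁ + m₂ ≤ (1 - l) * σ + 37 * e) :
    l * m₁ + r * m₂ + (1 - l - r) * lam ≤ 4 / 27 + 40 * e := by
  have hr1 : r ≤ 1 := hrl.trans hl1
  have hl0 : 0 ≤ l := hr.trans hrl
  -- Write `l = r + (l - r)` and replace `m₁` by `lam` in the second share.
  have a1 : l * m₁ + r * m₂ + (1 - l - r) * lam ≤ r * (m₁ + m₂) + (1 - 2 * r) * lam := by
    nlinarith [mul_le_mul_of_nonneg_left hm₁ (sub_nonneg.2 hrl)]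
  have a2 : (1 - 2 * r) * lam ≤ (1 - 2 * r) * (l * r) + e := by
    rcases le_total 0 (1 - 2 * r) with h | h
    · nlinarith [mul_le_mul_of_nonneg_left hlam h]
    · have : (1 - 2 * r) * lam ≤ 0 := mul_nonpos_of_nonpos_of_nonneg h hlam0
      have hlr1 : l * r ≤ 1 := by nlinarith
      have hlr0 : 0 ≤ l * r := by positivity
      nlinarith
  have a3 : σ * (1 + 4 * e - σ) ≤ σ * (1 - σ) + 20 * e := by nlinarith
  rcases le_total (1 / 2) l with h | h
  -- The bounds `σ * (1 - σ)` and `(1 - l) * σ` cross at `σ = l`, which is the worst case when `l ≥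
  -- 1 / 2`.
  · have a4 : m₁ + m₂ ≤ l * (1 - l) + 37 * e := by
      rcases le_total σ l with h' | h'
      · nlinarith
      · nlinarith [mul_nonneg (sub_nonneg.2 h') (show 0 ≤ σ + l - 1 by linarith)]
    have a5 := mul_mul_le_four_div hl0 hr
    have a6 := mul_le_mul_of_nonneg_left a4 hr
    nlinarith
  -- Here the main term is at most `3 * r / 4 - r ^ 2`, maximal at `r = 3 / 8` with value `9 / 64 <
  -- 4 / 27`.
  · have a4 : m₁ + m₂ ≤ 1 / 4 + 26 * e := by nlinarith [sq_nonneg (σ - 1 / 2)]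
    have a6 := mul_le_mul_of_nonneg_left a4 hr
    have a7 : (1 - 2 * r) * (l * r) ≤ (1 - 2 * r) * (1 / 2 * r) :=
      mul_le_mul_of_nonneg_left (mul_le_mul_of_nonneg_right h hr) (by linarith)
    nlinarith [sq_nonneg (r - 3 / 8)]

/-! ### Counting in regions and the density bound -/

section frac

variable {β γ : Type*}

theorem frac_and_add_frac_not {W : Finset β} (p q : β → Prop) :
    (frac W fun v => p v ∧ q v) + (frac W fun v => p v ∧ ¬q v) = frac W p := by
  rw [frac, frac, frac, ← expect_add_distrib]
  refine expect_congr rfl fun v _ => ?_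
  by_cases h : p v <;> by_cases h' : q v <;> simp [ind, h, h']

/-- Bound for the mean of `f` by means of its essential upper bounds on three regions. -/
theorem expect_le_of_regions {T : Finset β} (hT : T.Nonempty) {f : β → ℝ} (hf : ∀ c ∈ T, f c ≤ 1)
    (a b : β → Prop) {lam m₁ m₂ e : ℝ} (he : 0 ≤ e) (h₁ : 0 ≤ m₁) (h₂ : 0 ≤ m₂)
    (hlam0 : 0 ≤ lam) (hlam : lam ≤ 1) (n₀ : (frac T fun c => lam + e ≤ f c) ≤ e)
    (n₁ : (frac T fun c => a c ∧ m₁ + e ≤ f c) ≤ e) (n₂ : (frac T fun c => b c ∧ m₂ + e ≤ f c) ≤ e)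
    (n₃ : (frac T fun c => b c ∧ a c) ≤ e) :
    𝔼 c ∈ T, f c ≤ frac T a * m₁ + frac T b * m₂ + (1 - frac T a - frac T b) * lam + 5 * e := by
  -- Pointwise, `f` is at most the bound of its region plus `e`, except on four sets of proportion
  -- at most `e`, where `f ≤ 1` is used.
  have key : 𝔼 c ∈ T, f c ≤ 𝔼 c ∈ T, (ind (a c) * (m₁ - lam) + ind (b c) * (m₂ - lam) + (lam + e) +
      ind (lam + e ≤ f c) + ind (a c ∧ m₁ + e ≤ f c) + ind (b c ∧ m₂ + e ≤ f c) +
      ind (b c ∧ a c)) := by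
    refine expect_le_expect fun c hc => ?_
    have h1 := hf c hc
    have i0 := ind_nonneg (lam + e ≤ f c)
    have i1 := ind_nonneg (a c ∧ m₁ + e ≤ f c)
    have i2 := ind_nonneg (b c ∧ m₂ + e ≤ f c)
    by_cases ha : a c
    · have j1 : f c ≤ m₁ + e + ind (a c ∧ m₁ + e ≤ f c) := by
        by_cases h : m₁ + e ≤ f c
        · rw [ind_of ⟨ha, h⟩]; linarith
        · linarith
      by_cases hb : b c
      · rw [ind_of ha, ind_of hb, ind_of (p := b c ∧ a c) ⟨hb, ha⟩]
        linarith
      · rw [ind_of ha, ind_of_not hb, ind_of_not (p := b c ∧ a c) fun h => hb h.1]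
        linarith
    · by_cases hb : b c
      · have j2 : f c ≤ m₂ + e + ind (b c ∧ m₂ + e ≤ f c) := by
          by_cases h : m₂ + e ≤ f c
          · rw [ind_of ⟨hb, h⟩]; linarith
          · linarith
        rw [ind_of_not ha, ind_of hb, ind_of_not (p := b c ∧ a c) fun h => ha h.2]
        linarith
      · rw [ind_of_not ha, ind_of_not hb, ind_of_not (p := b c ∧ a c) fun h => ha h.2]
        by_cases h : lam + e ≤ f c
        · rw [ind_of h]
          linarith
        · linarith
  simp only [expect_add_distrib, ← expect_mul, expect_const hT] at key
  unfold frac at *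
  linarith

/-- Counting edges between `A` and `B` when no edge leads from `P` to `Q`. -/
theorem frac_edges_le (U : Finset β) (W : Finset γ) (A P : β → Prop) (B Q : γ → Prop)
    (E : β → γ → Prop) {e : ℝ} (h : (frac (U ×ˢ W) fun u => P u.1 ∧ Q u.2 ∧ E u.1 u.2) ≤ e) :
    (frac (U ×ˢ W) fun u => A u.1 ∧ B u.2 ∧ E u.1 u.2) ≤
      (frac U fun u => A u ∧ ¬P u) * frac W B +
        (frac U fun u => A u ∧ P u) * (frac W fun v => B v ∧ ¬Q v) + e := by
  have h1 := frac_le_add (W := U ×ˢ W) (p := fun u => A u.1 ∧ B u.2 ∧ E u.1 u.2)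
    (q := fun u => ((A u.1 ∧ ¬P u.1) ∧ B u.2) ∨ ((A u.1 ∧ P u.1) ∧ (B u.2 ∧ ¬Q u.2)))
    (r := fun u => P u.1 ∧ Q u.2 ∧ E u.1 u.2) (fun u _ hu => by tauto)
  have h2 := frac_le_add (W := U ×ˢ W)
    (p := fun u => ((A u.1 ∧ ¬P u.1) ∧ B u.2) ∨ ((A u.1 ∧ P u.1) ∧ (B u.2 ∧ ¬Q u.2)))
    (fun u _ hu => hu)
  rw [frac_product_and U W (fun u => A u ∧ ¬P u) B,
    frac_product_and U W (fun u => A u ∧ P u) (fun v => B v ∧ ¬Q v)] at h2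
  linarith

/-- Counting edges between `A` and `B` when no edge leads from `P` to `Q`, nor from `O` to `O'`. -/
theorem frac_edges_le_of_independent (U : Finset β) (W : Finset γ) (A P O : β → Prop)
    (B Q O' : γ → Prop) (E : β → γ → Prop) {e : ℝ}
    (h : (frac (U ×ˢ W) fun u => P u.1 ∧ Q u.2 ∧ E u.1 u.2) ≤ e)
    (hO : (frac (U ×ˢ W) fun u => O u.1 ∧ O' u.2 ∧ E u.1 u.2) ≤ e) :
    (frac (U ×ˢ W) fun u => A u.1 ∧ B u.2 ∧ E u.1 u.2) ≤
      (frac U fun u => (A u ∧ ¬O u) ∧ ¬P u) * frac W B +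
        (frac U fun u => (A u ∧ ¬O u) ∧ P u) * (frac W fun v => B v ∧ ¬Q v) +
      (frac U A * (frac W fun v => (B v ∧ ¬O' v) ∧ ¬Q v) +
        (frac U fun u => A u ∧ ¬P u) * (frac W fun v => (B v ∧ ¬O' v) ∧ Q v)) + 2 * e := by
  -- Apart from the negligible ones, an edge starts outside `O` or ends outside `O'`, and also
  -- starts outside `P` or ends outside `Q`.
  have h1 := frac_le_add (W := U ×ˢ W) (p := fun u => A u.1 ∧ B u.2 ∧ E u.1 u.2)
    (q := fun u => (((A u.1 ∧ ¬O u.1) ∧ ¬P u.1) ∧ B u.2) ∨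
      (((A u.1 ∧ ¬O u.1) ∧ P u.1) ∧ (B u.2 ∧ ¬Q u.2)) ∨
      (A u.1 ∧ ((B u.2 ∧ ¬O' u.2) ∧ ¬Q u.2)) ∨
      ((A u.1 ∧ ¬P u.1) ∧ ((B u.2 ∧ ¬O' u.2) ∧ Q u.2)))
    (r := fun u => (P u.1 ∧ Q u.2 ∧ E u.1 u.2) ∨ (O u.1 ∧ O' u.2 ∧ E u.1 u.2))
    (fun u _ hu => by tauto)
  have h2 := frac_le_add (W := U ×ˢ W) (p := fun u => (P u.1 ∧ Q u.2 ∧ E u.1 u.2) ∨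
    (O u.1 ∧ O' u.2 ∧ E u.1 u.2)) (fun u _ hu => hu)
  have h3 := frac_le_add (W := U ×ˢ W) (p := fun u => (((A u.1 ∧ ¬O u.1) ∧ ¬P u.1) ∧ B u.2) ∨
      (((A u.1 ∧ ¬O u.1) ∧ P u.1) ∧ (B u.2 ∧ ¬Q u.2)) ∨
      (A u.1 ∧ ((B u.2 ∧ ¬O' u.2) ∧ ¬Q u.2)) ∨
      ((A u.1 ∧ ¬P u.1) ∧ ((B u.2 ∧ ¬O' u.2) ∧ Q u.2))) (fun u _ hu => hu)
  have h4 := frac_le_add (W := U ×ˢ W) (p := fun u =>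
      (((A u.1 ∧ ¬O u.1) ∧ P u.1) ∧ (B u.2 ∧ ¬Q u.2)) ∨
      (A u.1 ∧ ((B u.2 ∧ ¬O' u.2) ∧ ¬Q u.2)) ∨
      ((A u.1 ∧ ¬P u.1) ∧ ((B u.2 ∧ ¬O' u.2) ∧ Q u.2))) (fun u _ hu => hu)
  have h5 := frac_le_add (W := U ×ˢ W) (p := fun u =>
      (A u.1 ∧ ((B u.2 ∧ ¬O' u.2) ∧ ¬Q u.2)) ∨
      ((A u.1 ∧ ¬P u.1) ∧ ((B u.2 ∧ ¬O' u.2) ∧ Q u.2))) (fun u _ hu => hu)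
  rw [frac_product_and U W (fun u => (A u ∧ ¬O u) ∧ ¬P u) B] at h3
  rw [frac_product_and U W (fun u => (A u ∧ ¬O u) ∧ P u) (fun v => B v ∧ ¬Q v)] at h4
  rw [frac_product_and U W A (fun v => (B v ∧ ¬O' v) ∧ ¬Q v),
    frac_product_and U W (fun u => A u ∧ ¬P u) (fun v => (B v ∧ ¬O' v) ∧ Q v)] at h5
  linarith

/-- Six disjoint cells have total proportion at most one. -/
theorem frac_cells_le {U : Finset β} (hU : U.Nonempty) (a₁ a₂ b₁ b₂ O : β → Prop) {e : ℝ}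
    (n₁ : (frac U fun u => a₁ u ∧ a₂ u) ≤ e) (n₂ : (frac U fun u => b₁ u ∧ b₂ u) ≤ e)
    (n₃ : (frac U fun u => b₁ u ∧ a₁ u) ≤ e) (n₄ : (frac U fun u => b₂ u ∧ a₂ u) ≤ e) :
    (frac U fun u => (a₁ u ∧ ¬O u) ∧ ¬b₂ u) + (frac U fun u => (a₁ u ∧ ¬O u) ∧ b₂ u) +
    (frac U fun u => (b₁ u ∧ ¬O u) ∧ ¬a₂ u) + (frac U fun u => (b₁ u ∧ ¬O u) ∧ a₂ u) +
    (frac U fun u => (a₂ u ∧ ¬O u) ∧ ¬b₁ u) + (frac U fun u => (b₂ u ∧ ¬O u) ∧ ¬a₁ u) ≤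
      1 - frac U O + 4 * e := by
  have key : 𝔼 u ∈ U, (ind ((a₁ u ∧ ¬O u) ∧ ¬b₂ u) + ind ((a₁ u ∧ ¬O u) ∧ b₂ u) +
      ind ((b₁ u ∧ ¬O u) ∧ ¬a₂ u) + ind ((b₁ u ∧ ¬O u) ∧ a₂ u) +
      ind ((a₂ u ∧ ¬O u) ∧ ¬b₁ u) + ind ((b₂ u ∧ ¬O u) ∧ ¬a₁ u) + ind (O u)) ≤
      𝔼 u ∈ U, (1 + ind (a₁ u ∧ a₂ u) + ind (b₁ u ∧ b₂ u) + ind (b₁ u ∧ a₁ u) +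
        ind (b₂ u ∧ a₂ u)) := by
    refine expect_le_expect fun u _ => ?_
    by_cases h1 : a₁ u <;> by_cases h2 : a₂ u <;> by_cases h3 : b₁ u <;> by_cases h4 : b₂ u <;>
      by_cases h5 : O u <;> simp [ind, h1, h2, h3, h4, h5] <;> norm_num
  simp only [expect_add_distrib, expect_const hU] at key
  unfold frac at *
  linarith

end frac

set_option maxHeartbeats 1000000 in
/-- The density bound, for predicates describing the left sides `a` and right sides `b` of three
links in the part `U`, and likewise `c` and `d` in the part `W`. -/
theorem density_le_of_profiles {V : Type*} {U W : Finset V} (hU : U.Nonempty)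
    (a₀ a₁ a₂ b₀ b₁ b₂ c₀ c₁ c₂ d₀ d₁ d₂ : V → Prop) (E₀ E₁ E₂ : V → V → Prop)
    {D lam m₁ m₂ l' r' e : ℝ} (he : 0 ≤ e) (he1 : e ≤ 1)
    (hom : ∀ φ : Prop → Prop → Prop → Prop → Prop → Prop → Prop,
      |(frac U fun u => φ (a₀ u) (a₁ u) (a₂ u) (b₀ u) (b₁ u) (b₂ u)) -
        frac W fun u => φ (c₀ u) (c₁ u) (c₂ u) (d₀ u) (d₁ u) (d₂ u)| ≤ e)
    (hl' : |frac U a₀ - l'| ≤ e) (hr' : |frac U b₀ - r'| ≤ e)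
    (hD : D ≤ l' * m₁ + r' * m₂ + (1 - l' - r') * lam + 5 * e)
    (hm₁0 : 0 ≤ m₁) (hm₂0 : 0 ≤ m₂) (hm₁ : m₁ ≤ lam) (hm₂ : m₂ ≤ lam) (hlam1 : lam ≤ 1)
    (hlam : lam ≤ frac (U ×ˢ W) fun u => a₀ u.1 ∧ d₀ u.2 ∧ E₀ u.1 u.2)
    (hw₁ : m₁ ≤ frac (U ×ˢ W) fun u => a₁ u.1 ∧ d₁ u.2 ∧ E₁ u.1 u.2)
    (hw₂ : m₂ ≤ frac (U ×ˢ W) fun u => a₂ u.1 ∧ d₂ u.2 ∧ E₂ u.1 u.2)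
    (n₀ : (frac U fun u => b₀ u ∧ a₀ u) ≤ e) (n₁ : (frac U fun u => b₁ u ∧ a₁ u) ≤ e)
    (n₂ : (frac U fun u => b₂ u ∧ a₂ u) ≤ e) (na : (frac U fun u => a₁ u ∧ a₂ u) ≤ e)
    (nb : (frac U fun u => b₁ u ∧ b₂ u) ≤ e)
    (i₁ : (frac (U ×ˢ W) fun u => a₀ u.1 ∧ c₀ u.2 ∧ E₁ u.1 u.2) ≤ e)
    (i₂ : (frac (U ×ˢ W) fun u => a₀ u.1 ∧ c₀ u.2 ∧ E₂ u.1 u.2) ≤ e)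
    (j₁ : (frac (U ×ˢ W) fun u => b₀ u.1 ∧ d₀ u.2 ∧ E₁ u.1 u.2) ≤ e)
    (j₂ : (frac (U ×ˢ W) fun u => b₀ u.1 ∧ d₀ u.2 ∧ E₂ u.1 u.2) ≤ e)
    (k₁ : (frac (U ×ˢ W) fun u => b₂ u.1 ∧ c₂ u.2 ∧ E₁ u.1 u.2) ≤ e)
    (k₂ : (frac (U ×ˢ W) fun u => b₁ u.1 ∧ c₁ u.2 ∧ E₂ u.1 u.2) ≤ e) :
    D ≤ 4 / 27 + 47 * e := by
  -- Uniformity lets proportions in `W` be replaced by the corresponding ones in `U`.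
  have upper : ∀ φ : Prop → Prop → Prop → Prop → Prop → Prop → Prop,
      (frac W fun u => φ (c₀ u) (c₁ u) (c₂ u) (d₀ u) (d₁ u) (d₂ u)) ≤
        (frac U fun u => φ (a₀ u) (a₁ u) (a₂ u) (b₀ u) (b₁ u) (b₂ u)) + e := fun φ => by
    linarith [(abs_le.1 (hom φ)).1]
  obtain ⟨l, hl⟩ : ∃ l, l = frac U a₀ := ⟨_, rfl⟩
  obtain ⟨r, hr⟩ : ∃ r, r = frac U b₀ := ⟨_, rfl⟩
  -- The overlaps of `a₁` with `b₂` and of `b₁` with `a₂` are the only ones, among the sides of the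
  -- last two links, that need not be negligible.
  obtain ⟨p, hp⟩ : ∃ p, p = frac U fun u => a₁ u ∧ b₂ u := ⟨_, rfl⟩
  obtain ⟨q, hq⟩ : ∃ q, q = frac U fun u => b₁ u ∧ a₂ u := ⟨_, rfl⟩
  obtain ⟨x₁, hx₁⟩ : ∃ x₁, x₁ = frac U fun u => a₁ u ∧ ¬b₂ u := ⟨_, rfl⟩
  obtain ⟨y₁, hy₁⟩ : ∃ y₁, y₁ = frac U fun u => b₁ u ∧ ¬a₂ u := ⟨_, rfl⟩
  obtain ⟨x₂, hx₂⟩ : ∃ x₂, x₂ = frac U fun u => a₂ u ∧ ¬b₁ u := ⟨_, rfl⟩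
  obtain ⟨y₂, hy₂⟩ : ∃ y₂, y₂ = frac U fun u => b₂ u ∧ ¬a₁ u := ⟨_, rfl⟩
  have p0 : 0 ≤ p := hp ▸ frac_nonneg _ _
  have q0 : 0 ≤ q := hq ▸ frac_nonneg _ _
  have x₁0 : 0 ≤ x₁ := hx₁ ▸ frac_nonneg _ _
  have y₁0 : 0 ≤ y₁ := hy₁ ▸ frac_nonneg _ _
  have x₂0 : 0 ≤ x₂ := hx₂ ▸ frac_nonneg _ _
  have y₂0 : 0 ≤ y₂ := hy₂ ▸ frac_nonneg _ _
  have hp' : p = frac U fun u => b₂ u ∧ a₁ u := hp.trans (frac_congr fun u _ => and_comm)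
  have hq' : q = frac U fun u => a₂ u ∧ b₁ u := hq.trans (frac_congr fun u _ => and_comm)
  have ha₁ : frac U a₁ = p + x₁ := by rw [hp, hx₁, frac_and_add_frac_not]
  have hb₁ : frac U b₁ = q + y₁ := by rw [hq, hy₁, frac_and_add_frac_not]
  have ha₂ : frac U a₂ = q + x₂ := by rw [hq', hx₂, frac_and_add_frac_not]
  have hb₂ : frac U b₂ = p + y₂ := by rw [hp', hy₂, frac_and_add_frac_not]
  have hd₁ : frac W d₁ ≤ q + y₁ + e := hb₁ ▸ upper fun _ _ _ _ s _ => s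
  have hd₂ : frac W d₂ ≤ p + y₂ + e := hb₂ ▸ upper fun _ _ _ _ _ s => s
  have hd₁' : (frac W fun v => d₁ v ∧ ¬c₂ v) ≤ y₁ + e := hy₁ ▸ upper fun _ _ s _ s' _ => s' ∧ ¬s
  have hd₂' : (frac W fun v => d₂ v ∧ ¬c₁ v) ≤ y₂ + e := hy₂ ▸ upper fun _ s _ _ _ s' => s' ∧ ¬s
  have p1 : p ≤ 1 := hp ▸ frac_le_one _ _
  have q1 : q ≤ 1 := hq ▸ frac_le_one _ _
  have x₁1 : x₁ ≤ 1 := hx₁ ▸ frac_le_one _ _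
  have x₂1 : x₂ ≤ 1 := hx₂ ▸ frac_le_one _ _
  have l0 : 0 ≤ l := hl ▸ frac_nonneg _ _
  have r0 : 0 ≤ r := hr ▸ frac_nonneg _ _
  have l1 : l ≤ 1 := hl ▸ frac_le_one _ _
  have r1 : r ≤ 1 := hr ▸ frac_le_one _ _
  have lam0 : 0 ≤ lam := hm₁0.trans hm₁
  have cells := frac_cells_le hU a₁ a₂ b₁ b₂ (fun _ => False) na nb n₁ n₂
  simp only [not_false_eq_true, and_true] at cells
  rw [← hp, ← hq, ← hx₁, ← hx₂, ← hy₁, ← hy₂] at cells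
  have hst : p + q + x₁ + y₁ + x₂ + y₂ ≤ 1 + 4 * e := by linarith [frac_nonneg U fun _ => False]
  have hlr : l + r ≤ 1 + e := by
    have h1 := frac_and_add_frac_not (W := U) a₀ b₀
    have h2 : (frac U fun u => a₀ u ∧ ¬b₀ u) ≤ frac U fun u => ¬b₀ u :=
      frac_mono fun _ _ h => h.2
    have h3 : (frac U fun u => a₀ u ∧ b₀ u) ≤ e := (frac_mono fun _ _ h => h.symm).trans n₀
    rw [frac_not hU] at h2
    linarith
  have hlam' : lam ≤ l * r + e := by
    have h1 : (frac (U ×ˢ W) fun u => a₀ u.1 ∧ d₀ u.2 ∧ E₀ u.1 u.2) ≤ frac U a₀ * frac W d₀ := by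
      rw [← frac_product_and]
      exact frac_mono fun _ _ h => ⟨h.1, h.2.1⟩
    have h2 : frac W d₀ ≤ r + e := hr ▸ upper fun _ _ _ s _ _ => s
    rw [← hl] at h1
    linarith [mul_le_mul_of_nonneg_left h2 l0, mul_le_mul_of_nonneg_right l1 he]
  have e₁ := hw₁.trans (frac_edges_le U W a₁ b₂ d₁ c₂ E₁ k₁)
  have e₂ := hw₂.trans (frac_edges_le U W a₂ b₁ d₂ c₁ E₂ k₂)
  rw [← hx₁, ← hp] at e₁
  rw [← hx₂, ← hq'] at e₂
  have f₁ : m₁ ≤ x₁ * (q + y₁) + p * y₁ + 3 * e := by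
    linarith [mul_le_mul_of_nonneg_left hd₁ x₁0, mul_le_mul_of_nonneg_left hd₁' p0,
      mul_le_mul_of_nonneg_right x₁1 he, mul_le_mul_of_nonneg_right p1 he]
  have f₂ : m₂ ≤ x₂ * (p + y₂) + q * y₂ + 3 * e := by
    linarith [mul_le_mul_of_nonneg_left hd₂ x₂0, mul_le_mul_of_nonneg_left hd₂' q0,
      mul_le_mul_of_nonneg_right x₂1 he, mul_le_mul_of_nonneg_right q1 he]
  obtain ⟨s, hs⟩ : ∃ s, s = p + x₁ + y₂ := ⟨_, rfl⟩
  obtain ⟨t, ht⟩ : ∃ t, t = q + y₁ + x₂ := ⟨_, rfl⟩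
  have s0 : 0 ≤ s := by rw [hs]; positivity
  have t0 : 0 ≤ t := by rw [ht]; positivity
  have hst' : s + t ≤ 1 + 4 * e := by rw [hs, ht]; linarith
  -- Up to errors, `s` measures the union of `a₁` and `b₂`, and `t` that of `b₁` and `a₂`. The
  -- product `s * t` exceeds the two edge bounds by `p * q + x₁ * x₂ + y₁ * y₂`.
  have fst : m₁ + m₂ ≤ s * t + 6 * e := by
    rw [hs, ht]
    linarith [mul_nonneg p0 q0, mul_nonneg x₁0 x₂0, mul_nonneg y₂0 y₁0]
  obtain ⟨σ, hσ⟩ : ∃ σ, σ = max s t := ⟨_, rfl⟩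
  have hsσ : s ≤ σ := hσ ▸ le_max_left _ _
  have htσ : t ≤ σ := hσ ▸ le_max_right _ _
  have hσ1 : σ ≤ 1 + 4 * e := by rw [hσ]; exact max_le (by linarith) (by linarith)
  have g₁ : m₁ + m₂ ≤ σ * (1 + 4 * e - σ) + 6 * e := by
    rcases max_choice s t with h | h
    · rw [hσ, h]
      linarith [mul_le_mul_of_nonneg_left (show t ≤ 1 + 4 * e - s by linarith) s0]
    · rw [hσ, h]
      linarith [mul_le_mul_of_nonneg_left (show s ≤ 1 + 4 * e - t by linarith) t0]
  have g₂ : ∀ O O' : V → Prop, (frac (U ×ˢ W) fun u => O u.1 ∧ O' u.2 ∧ E₁ u.1 u.2) ≤ e →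
      (frac (U ×ˢ W) fun u => O u.1 ∧ O' u.2 ∧ E₂ u.1 u.2) ≤ e →
      (frac W fun v => (d₁ v ∧ ¬O' v) ∧ ¬c₂ v) ≤ (frac U fun v => (b₁ v ∧ ¬O v) ∧ ¬a₂ v) + e →
      (frac W fun v => (d₁ v ∧ ¬O' v) ∧ c₂ v) ≤ (frac U fun v => (b₁ v ∧ ¬O v) ∧ a₂ v) + e →
      (frac W fun v => (d₂ v ∧ ¬O' v) ∧ ¬c₁ v) ≤ (frac U fun v => (b₂ v ∧ ¬O v) ∧ ¬a₁ v) + e →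
      (frac W fun v => (d₂ v ∧ ¬O' v) ∧ c₁ v) ≤ (frac U fun v => (b₂ v ∧ ¬O v) ∧ a₁ v) + e →
      m₁ + m₂ ≤ (1 - frac U O) * σ + 37 * e := by
    intro O O' hO₁ hO₂ u₁ u₂ u₃ u₄
    have w₁ := hw₁.trans (frac_edges_le_of_independent U W a₁ b₂ O d₁ c₂ O' E₁ k₁ hO₁)
    have w₂ := hw₂.trans (frac_edges_le_of_independent U W a₂ b₁ O d₂ c₁ O' E₂ k₂ hO₂)
    have cells := frac_cells_le hU a₁ a₂ b₁ b₂ O na nb n₁ n₂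
    have hQ : (frac U fun v => (a₂ v ∧ ¬O v) ∧ b₁ v) = frac U fun v => (b₁ v ∧ ¬O v) ∧ a₂ v :=
      frac_congr fun _ _ => by tauto
    have hP : (frac U fun v => (b₂ v ∧ ¬O v) ∧ a₁ v) = frac U fun v => (a₁ v ∧ ¬O v) ∧ b₂ v :=
      frac_congr fun _ _ => by tauto
    rw [hQ, ← hx₂, ha₂] at w₂
    rw [← hx₁, ha₁] at w₁
    rw [hP] at u₄
    have X₁0 := frac_nonneg U fun u => (a₁ u ∧ ¬O u) ∧ ¬b₂ u
    have P0 := frac_nonneg U fun u => (a₁ u ∧ ¬O u) ∧ b₂ u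
    have Y₁0 := frac_nonneg U fun u => (b₁ u ∧ ¬O u) ∧ ¬a₂ u
    have Q0 := frac_nonneg U fun u => (b₁ u ∧ ¬O u) ∧ a₂ u
    have X₂0 := frac_nonneg U fun u => (a₂ u ∧ ¬O u) ∧ ¬b₁ u
    have Y₂0 := frac_nonneg U fun u => (b₂ u ∧ ¬O u) ∧ ¬a₁ u
    have X₁1 := frac_le_one U fun u => (a₁ u ∧ ¬O u) ∧ ¬b₂ u
    have P1 := frac_le_one U fun u => (a₁ u ∧ ¬O u) ∧ b₂ u
    have Q1 := frac_le_one U fun u => (b₁ u ∧ ¬O u) ∧ a₂ u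
    have X₂1 := frac_le_one U fun u => (a₂ u ∧ ¬O u) ∧ ¬b₁ u
    generalize (frac U fun u => (a₁ u ∧ ¬O u) ∧ ¬b₂ u) = X₁ at *
    generalize (frac U fun u => (a₁ u ∧ ¬O u) ∧ b₂ u) = P at *
    generalize (frac U fun u => (b₁ u ∧ ¬O u) ∧ ¬a₂ u) = Y₁ at *
    generalize (frac U fun u => (b₁ u ∧ ¬O u) ∧ a₂ u) = Q at *
    generalize (frac U fun u => (a₂ u ∧ ¬O u) ∧ ¬b₁ u) = X₂ at *
    generalize (frac U fun u => (b₂ u ∧ ¬O u) ∧ ¬a₁ u) = Y₂ at *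
    have v₁ : m₁ ≤ X₁ * (q + y₁) + P * y₁ + ((p + x₁) * Y₁ + x₁ * Q) + 7 * e := by
      have z₁ := mul_le_mul_of_nonneg_left hd₁ X₁0
      have z₂ := mul_le_mul_of_nonneg_left hd₁' P0
      have z₃ := mul_le_mul_of_nonneg_left u₁ (add_nonneg p0 x₁0)
      have z₄ := mul_le_mul_of_nonneg_left u₂ x₁0
      have y₁' := mul_le_mul_of_nonneg_right X₁1 he
      have y₂' := mul_le_mul_of_nonneg_right P1 he
      have y₃' := mul_le_mul_of_nonneg_right x₁1 he
      have y₄' := mul_le_mul_of_nonneg_right p1 he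
      linarith
    have v₂ : m₂ ≤ X₂ * (p + y₂) + Q * y₂ + ((q + x₂) * Y₂ + x₂ * P) + 7 * e := by
      have z₁ := mul_le_mul_of_nonneg_left hd₂ X₂0
      have z₂ := mul_le_mul_of_nonneg_left hd₂' Q0
      have z₃ := mul_le_mul_of_nonneg_left u₃ (add_nonneg q0 x₂0)
      have z₄ := mul_le_mul_of_nonneg_left u₄ x₂0
      have y₁' := mul_le_mul_of_nonneg_right X₂1 he
      have y₂' := mul_le_mul_of_nonneg_right Q1 he
      have y₃' := mul_le_mul_of_nonneg_right x₂1 he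
      have y₄' := mul_le_mul_of_nonneg_right q1 he
      linarith
    -- In the sum of the two bounds each of the six cells outside `O` has a coefficient contained in
    -- `s` or in `t`, hence at most `σ`; together the cells have size about `1 - frac U O`.
    have c₁ := mul_le_mul_of_nonneg_left (show q + y₁ ≤ σ by linarith) X₁0
    have c₂ := mul_le_mul_of_nonneg_left (show y₁ + x₂ ≤ σ by linarith) P0
    have c₃ := mul_le_mul_of_nonneg_left (show p + x₁ ≤ σ by linarith) Y₁0
    have c₄ := mul_le_mul_of_nonneg_left (show x₁ + y₂ ≤ σ by linarith) Q0
    have c₅ := mul_le_mul_of_nonneg_left (show p + y₂ ≤ σ by linarith) X₂0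
    have c₆ := mul_le_mul_of_nonneg_left (show q + x₂ ≤ σ by linarith) Y₂0
    have c₇ := mul_le_mul_of_nonneg_left cells (s0.trans hsσ)
    have c₈ : σ * e ≤ 5 * e := mul_le_mul_of_nonneg_right (by linarith) he
    linarith
  have final : l * m₁ + r * m₂ + (1 - l - r) * lam ≤ 4 / 27 + 40 * e := by
    rcases le_total r l with h | h
    · refine split_density_le he he1 r0 h l1 hlr hm₁ lam0 hlam' hσ1 g₁ ?_
      rw [hl]
      exact g₂ a₀ c₀ i₁ i₂ (upper fun s _ s₂ _ s' _ => (s' ∧ ¬s) ∧ ¬s₂)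
        (upper fun s _ s₂ _ s' _ => (s' ∧ ¬s) ∧ s₂) (upper fun s s₂ _ _ _ s' => (s' ∧ ¬s) ∧ ¬s₂)
        (upper fun s s₂ _ _ _ s' => (s' ∧ ¬s) ∧ s₂)
    · have := split_density_le (m₁ := m₂) (m₂ := m₁) he he1 l0 h r1 (by linarith) hm₂ lam0
        (by linarith) hσ1 (by linarith) (by
          rw [hr, add_comm]
          exact g₂ b₀ d₀ j₁ j₂ (upper fun _ _ s₂ s s' _ => (s' ∧ ¬s) ∧ ¬s₂)
            (upper fun _ _ s₂ s s' _ => (s' ∧ ¬s) ∧ s₂)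
            (upper fun _ s₂ _ s _ s' => (s' ∧ ¬s) ∧ ¬s₂)
            (upper fun _ s₂ _ s _ s' => (s' ∧ ¬s) ∧ s₂))
      linarith
  rw [← hl] at hl'
  rw [← hr] at hr'
  have q₁ : (l' - l) * (m₁ - lam) ≤ e := by
    have h1 := mul_le_mul_of_nonneg_right (abs_le.1 hl').2 (sub_nonneg.2 hm₁)
    have h2 := mul_le_mul_of_nonneg_left (show lam - m₁ ≤ 1 by linarith) he
    linarith
  have q₂ : (r' - r) * (m₂ - lam) ≤ e := by
    have h1 := mul_le_mul_of_nonneg_right (abs_le.1 hr').2 (sub_nonneg.2 hm₂)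
    have h2 := mul_le_mul_of_nonneg_left (show lam - m₂ ≤ 1 by linarith) he
    linarith
  linarith

/-! ### Uniform behaviour on quintuples -/

/-- `f` holds for all increasing quintuples in `Z`. -/
def Quint (Z : Finset ℕ) (f : ℕ → ℕ → ℕ → ℕ → ℕ → Prop) : Prop :=
  ∀ h ∈ Z, ∀ i ∈ Z, ∀ j ∈ Z, ∀ k ∈ Z, ∀ t ∈ Z, h < i → i < j → j < k → k < t → f h i j k t

/-- Colour quintuples by the truth values of all events and by `g`. On the homogeneous set, of size
`N₀ + m`, an event with colour true would hold throughout, contrary to hypothesis. -/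
theorem exists_avoiding (ι κ : Type*) [Finite ι] [Finite κ] (N₀ m : ℕ) :
    ∃ N : ℕ, ∀ Y : Finset ℕ, N ≤ #Y →
      ∀ (f : ι → ℕ → ℕ → ℕ → ℕ → ℕ → Prop) (g : ℕ → ℕ → ℕ → ℕ → ℕ → κ),
      (∀ b, ∀ Z ⊆ Y, N₀ ≤ #Z → ¬Quint Z (f b)) →
      ∃ Z ⊆ Y, #Z = m ∧ (∀ b, Quint Z fun h i j k t => ¬f b h i j k t) ∧
        ∃ c, Quint Z fun h i j k t => g h i j k t = c := by
  obtain ⟨N, hN⟩ := exists_homogeneous_five (κ := (ι → Prop) × κ) (N₀ + m)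
  refine ⟨N, fun Y hY f g hf => ?_⟩
  obtain ⟨Z, hZ, hm, c, hc⟩ := hN Y hY fun h i j k t => (fun b => f b h i j k t, g h i j k t)
  obtain ⟨Z', hZ', hm'⟩ := exists_subset_card_eq (show m ≤ #Z by omega)
  refine ⟨Z', hZ'.trans hZ, hm', fun b => ?_, c.2, ?_⟩
  · intro h hh i hi j hj k hk t ht h1 h2 h3 h4 hfb
    have hcb : c.1 b := by
      rw [← hc h (hZ' hh) i (hZ' hi) j (hZ' hj) k (hZ' hk) t (hZ' ht) h1 h2 h3 h4]
      exact hfb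
    refine hf b Z hZ (by omega) ?_
    intro h hh i hi j hj k hk t ht h1 h2 h3 h4
    have := congrFun (congrArg Prod.fst (hc h hh i hi j hj k hk t ht h1 h2 h3 h4)) b
    exact this.mpr hcb
  · intro h hh i hi j hj k hk t ht h1 h2 h3 h4
    exact congrArg Prod.snd (hc h (hZ' hh) i (hZ' hi) j (hZ' hj) k (hZ' hk) t (hZ' ht) h1 h2 h3 h4)

/-- For events that depend on fewer than five indices, the two elements on top fill the remaining
places. -/
theorem exists_two_above (Z : Finset ℕ) (N : ℕ) (hN : N + 2 ≤ #Z) :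
    ∃ A ⊆ Z, #A = N ∧ ∃ s ∈ Z, ∃ t ∈ Z, s < t ∧ ∀ a ∈ A, a < s := by
  obtain ⟨A, hA, T, hT, hcA, hcT, hlt⟩ := exists_split Z N 2 hN
  obtain ⟨s, t, hst, rfl⟩ := card_eq_two.1 hcT
  rcases lt_or_gt_of_ne hst with h | h
  · exact ⟨A, hA, hcA, s, hT (by simp), t, hT (by simp), h, fun a ha => hlt a ha s (by simp)⟩
  · exact ⟨A, hA, hcA, t, hT (by simp), s, hT (by simp), h, fun a ha => hlt a ha t (by simp)⟩

theorem Quint.quad {Z : Finset ℕ} {f : ℕ → ℕ → ℕ → ℕ → Prop}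
    (hZ : Quint Z fun h i j k _ => f h i j k) (N : ℕ) (hN : N + 2 ≤ #Z) :
    ∃ A ⊆ Z, N ≤ #A ∧ ∀ h ∈ A, ∀ i ∈ A, ∀ j ∈ A, ∀ k ∈ A, h < i → i < j → j < k → f h i j k := by
  obtain ⟨A, hA, hcA, s, hs, -, -, -, hlt⟩ := exists_two_above Z N hN
  exact ⟨A, hA, hcA.ge, fun h hh i hi j hj k hk h1 h2 h3 =>
    hZ h (hA hh) i (hA hi) j (hA hj) k (hA hk) s hs h1 h2 h3 (hlt k hk)⟩

theorem Quint.triple {Z : Finset ℕ} {f : ℕ → ℕ → ℕ → Prop}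
    (hZ : Quint Z fun h i j _ _ => f h i j) (N : ℕ) (hN : N + 2 ≤ #Z) :
    ∃ A ⊆ Z, N ≤ #A ∧ ∀ h ∈ A, ∀ i ∈ A, ∀ j ∈ A, h < i → i < j → f h i j := by
  obtain ⟨A, hA, hcA, s, hs, t, ht, hst, hlt⟩ := exists_two_above Z N hN
  exact ⟨A, hA, hcA.ge, fun h hh i hi j hj h1 h2 =>
    hZ h (hA hh) i (hA hi) j (hA hj) s hs t ht h1 h2 (hlt j hj) hst⟩

theorem exists_last_level {p : ℕ → Prop} {a b : ℕ} (ha : p a) (hb : ∀ s, b ≤ s → ¬p s) :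
    ∃ s, a ≤ s ∧ p s ∧ ¬p (s + 1) := by
  by_contra! h
  have : ∀ s, a ≤ s → p s := fun s hs => Nat.le_induction ha (fun s hs ih => h s hs ih) s hs
  exact hb (max a b) (le_max_right _ _) (this _ (le_max_left _ _))

/-! ### Attainable weight levels of top vertices -/

namespace TriSystem

section levels

variable {V : Type u} (S : TriSystem V) (ε d : ℝ) (n s : ℕ) (Y : Finset ℕ) (x y : ℕ → ℕ → V)

/-- The system is dense on `Y` but contains none of the configurations of size `n`. -/
structure Admissible : Prop where
  nonempty : S.NonemptyOn Y
  dense : ∀ i ∈ Y, ∀ j ∈ Y, ∀ k ∈ Y, i < j → j < k →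
    d ≤ 𝔼 c ∈ S.part i k, frac (S.part i j ×ˢ S.part j k) fun u => S.edge u.1 u.2 c
  free : ∀ J ⊆ Y, #J = n → ¬(S.Conf1 J ∨ S.Conf2 J ∨ S.Conf3 J ∨ S.Conf4 J)

/-- A choice of top vertices of weight at least `s * ε`. -/
structure Tops : Prop where
  choice : S.Choice Y x
  weight : ∀ i ∈ Y, ∀ j ∈ Y, ∀ k ∈ Y, i < j → j < k → s * ε ≤ S.weight ε i j k (x i k)

/-- The vertices `y` lie in the left sides of the links of `x`. -/
def LeftOf : Prop := ∀ i ∈ Y, ∀ j ∈ Y, ∀ k ∈ Y, i < j → j < k → y i j ∈ S.coreL ε i j k (x i k)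

/-- The vertices `y` lie in the right sides of the links of `x`. -/
def RightOf : Prop := ∀ i ∈ Y, ∀ j ∈ Y, ∀ k ∈ Y, i < j → j < k → y j k ∈ S.coreR ε i j k (x i k)

variable {S ε d n s Y x y} {Z : Finset ℕ}

theorem Admissible.mono (h : S.Admissible d n Y) (hZ : Z ⊆ Y) : S.Admissible d n Z :=
  ⟨h.1.mono hZ, fun i hi j hj k hk => h.2 i (hZ hi) j (hZ hj) k (hZ hk),
    fun J hJ => h.3 J (hJ.trans hZ)⟩

theorem Tops.mono (h : S.Tops ε s Y x) (hZ : Z ⊆ Y) : S.Tops ε s Z x :=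
  ⟨h.1.mono hZ, fun i hi j hj k hk => h.2 i (hZ hi) j (hZ hj) k (hZ hk)⟩

theorem LeftOf.mono (h : S.LeftOf ε Y x y) (hZ : Z ⊆ Y) : S.LeftOf ε Z x y :=
  fun i hi j hj k hk => h i (hZ hi) j (hZ hj) k (hZ hk)

theorem RightOf.mono (h : S.RightOf ε Y x y) (hZ : Z ⊆ Y) : S.RightOf ε Z x y :=
  fun i hi j hj k hk => h i (hZ hi) j (hZ hj) k (hZ hk)

theorem Admissible.le_expect_weight (h : S.Admissible d n Y) (hε : 0 ≤ ε) {i j k : ℕ} (hi : i ∈ Y)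
    (hj : j ∈ Y) (hk : k ∈ Y) (hij : i < j) (hjk : j < k) :
    d - 2 * ε ≤ 𝔼 c ∈ S.part i k, S.weight ε i j k c := by
  have h1 := h.dense i hi j hj k hk hij hjk
  have h2 : (𝔼 c ∈ S.part i k, frac (S.part i j ×ˢ S.part j k) fun u => S.edge u.1 u.2 c) ≤
      𝔼 c ∈ S.part i k, (S.weight ε i j k c + 2 * ε) :=
    expect_le_expect fun c _ => frac_link_le hε (h.nonempty i hi j hj hij) (h.nonempty j hj k hk hjk)
  rw [expect_add_distrib, expect_const (h.nonempty i hi k hk (hij.trans hjk))] at h2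
  linarith

/-- Some structure with property `P` exists on arbitrarily large index sets. -/
def Unbounded (P : ∀ V : Type u, TriSystem V → Finset ℕ → Prop) : Prop :=
  ∀ M : ℕ, ∃ (V : Type u) (_ : Nonempty V) (S : TriSystem V) (Y : Finset ℕ), M ≤ #Y ∧ P V S Y

/-- Level `s` is attained by top vertices. -/
def Level0 (ε d : ℝ) (n s : ℕ) : Prop :=
  Unbounded.{u} fun _ S Y => S.Admissible d n Y ∧ ∃ x, S.Tops ε s Y x

/-- Level `s` is attained by top vertices to the left of top vertices of level `s₀`. -/
def Level1 (ε d : ℝ) (n s₀ s : ℕ) : Prop :=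
  Unbounded.{u} fun _ S Y => S.Admissible d n Y ∧ ∃ x y, S.Tops ε s₀ Y x ∧ S.Tops ε s Y y ∧
    S.LeftOf ε Y x y

/-- Level `s` is attained by top vertices to the right of top vertices of level `s₀`, which have
top vertices of level `s₁` to their left. -/
def Level2 (ε d : ℝ) (n s₀ s₁ s : ℕ) : Prop :=
  Unbounded.{u} fun _ S Y => S.Admissible d n Y ∧ ∃ x y z, S.Tops ε s₀ Y x ∧ S.Tops ε s₁ Y y ∧
    S.LeftOf ε Y x y ∧ S.Tops ε s Y z ∧ S.RightOf ε Y x z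

theorem exists_triple {Y : Finset ℕ} (hY : 3 ≤ #Y) :
    ∃ i ∈ Y, ∃ j ∈ Y, ∃ k ∈ Y, i < j ∧ j < k := by
  obtain ⟨A, hA, hcA, s, hs, t, ht, hst, hlt⟩ := exists_two_above Y 1 hY
  obtain ⟨a, rfl⟩ := card_eq_one.1 hcA
  exact ⟨a, hA (by simp), s, hs, t, ht, hlt a (by simp), hst⟩

theorem Tops.mul_le_one (h : S.Tops ε s Y x) (hY : 3 ≤ #Y) : s * ε ≤ 1 := by
  obtain ⟨i, hi, j, hj, k, hk, hij, hjk⟩ := exists_triple hY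
  exact (h.weight i hi j hj k hk hij hjk).trans weight_le_one

theorem Level0.mul_le_one (h : Level0.{u} ε d n s) : s * ε ≤ 1 := by
  obtain ⟨V, _, S, Y, hY, -, x, hx⟩ := h 3
  exact hx.mul_le_one hY

theorem Level0.anti {s' : ℕ} (hε : 0 ≤ ε) (h : Level0.{u} ε d n s) (hs : s' ≤ s) :
    Level0.{u} ε d n s' := by
  intro M
  obtain ⟨V, hV, S, Y, hY, hA, x, hx⟩ := h M
  refine ⟨V, hV, S, Y, hY, hA, x, hx.1, fun i hi j hj k hk h1 h2 =>
    le_trans ?_ (hx.2 i hi j hj k hk h1 h2)⟩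
  have : (s' : ℝ) ≤ s := by exact_mod_cast hs
  gcongr

theorem Level1.level0 {s₀ : ℕ} (h : Level1.{u} ε d n s₀ s) : Level0.{u} ε d n s := by
  intro M
  obtain ⟨V, hV, S, Y, hY, hA, x, y, hx, hy, -⟩ := h M
  exact ⟨V, hV, S, Y, hY, hA, y, hy⟩

theorem Level2.level0 {s₀ s₁ : ℕ} (h : Level2.{u} ε d n s₀ s₁ s) : Level0.{u} ε d n s := by
  intro M
  obtain ⟨V, hV, S, Y, hY, hA, x, y, z, hx, hy, -, hz, -⟩ := h M
  exact ⟨V, hV, S, Y, hY, hA, z, hz⟩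

/-- The mean weight is at least `d - 2 * ε ≥ 2 * ε`, so an `ε` share of the vertices has weight at
least `ε`. -/
theorem level0_one (hε : 0 < ε) (hd : 4 * ε ≤ d)
    (h : Unbounded.{u} fun _ S Y => S.Admissible d n Y) : Level0.{u} ε d n 1 := by
  intro M
  obtain ⟨N, hN⟩ := exists_selection hε M
  obtain ⟨V, hV, S, Y, hY, hA⟩ := h N
  obtain ⟨Z, hZ, hM, x, hx⟩ := hN Y S.part (fun _ _ _ _ => True)
    (fun i j k c => ε ≤ S.weight ε i j k c) (fun _ _ _ _ => True) hY (by
    intro _ _ i hi j hj k hk _ _ _ h1 h2 _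
    have h3 := half_le_frac (W := S.part i k) (f := fun c => S.weight ε i j k c)
      (η := d - 2 * ε) (by linarith) (fun _ _ => weight_le_one)
      (hA.le_expect_weight hε.le hi hj hk h1 h2)
    refine le_trans (by linarith) (h3.trans (frac_mono fun c _ hc => ⟨trivial, ?_, trivial⟩))
    linarith)
  refine ⟨V, hV, S, Z, hM.ge, hA.mono hZ, x, fun i hi j hj hij => (hx i hi j hj hij).1, ?_⟩
  intro i hi j hj k hk h1 h2
  rw [Nat.cast_one, one_mul]
  exact (hx i hi k hk (h1.trans h2)).2.2.1 j hj h1 h2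

/-- Since `s₀ ≥ 1`, left sides contain an `ε` share of their part, and level 0 demands nothing of
the weight. -/
theorem Level0.level1 {s₀ : ℕ} (hε : 0 < ε) (hs : 1 ≤ s₀) (h : Level0.{u} ε d n s₀) :
    Level1.{u} ε d n s₀ 0 := by
  intro M
  obtain ⟨N, hN⟩ := exists_selection_right hε M
  obtain ⟨V, hV, S, Y, hY, hA, x, hx⟩ := h N
  have hs' : (1 : ℝ) ≤ s₀ := by exact_mod_cast hs
  obtain ⟨Z, hZ, hM, y, hy⟩ := hN Y S.part (fun i j k c => c ∈ S.coreL ε i j k (x i k)) hY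
    (fun i hi j hj k hk h1 h2 => le_trans (by nlinarith)
      ((hx.weight i hi j hj k hk h1 h2).trans weight_le_frac_coreL))
  refine ⟨V, hV, S, Z, hM.ge, hA.mono hZ, x, y, hx.mono hZ,
    ⟨fun i hi j hj hij => (hy i hi j hj hij).1, fun i hi j hj k hk h1 h2 => ?_⟩,
    fun i hi j hj k hk h1 h2 => (hy i hi j hj h1).2 k hk h2⟩
  rw [Nat.cast_zero, zero_mul]
  exact weight_nonneg

theorem Level1.level2 {s₀ s₁ : ℕ} (hε : 0 < ε) (hs : 1 ≤ s₀) (h : Level1.{u} ε d n s₀ s₁) :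
    Level2.{u} ε d n s₀ s₁ 0 := by
  intro M
  obtain ⟨N, hN⟩ := exists_selection_left hε M
  obtain ⟨V, hV, S, Y, hY, hA, x, y, hx, hy, hxy⟩ := h N
  have hs' : (1 : ℝ) ≤ s₀ := by exact_mod_cast hs
  obtain ⟨Z, hZ, hM, z, hz⟩ := hN Y S.part (fun i j k c => c ∈ S.coreR ε i j k (x i k)) hY
    (fun i hi j hj k hk h1 h2 => le_trans (by nlinarith)
      ((hx.weight i hi j hj k hk h1 h2).trans weight_le_frac_coreR))
  refine ⟨V, hV, S, Z, hM.ge, hA.mono hZ, x, y, z, hx.mono hZ, hy.mono hZ, hxy.mono hZ,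
    ⟨fun i hi j hj hij => (hz i hi j hj hij).1, fun i hi j hj k hk h1 h2 => ?_⟩,
    fun i hi j hj k hk h1 h2 => (hz j hj k hk h2).2 i hi h1⟩
  rw [Nat.cast_zero, zero_mul]
  exact weight_nonneg

end levels

/-- The joint distribution of a vertex of `part i j` with respect to the left sides (with top index
`k`) and the right sides (with bottom index `h`) of three families of links. -/
noncomputable def profile {V : Type*} (S : TriSystem V) (ε : ℝ) (x y z : ℕ → ℕ → V) (h i j k : ℕ)
    (φ : Prop → Prop → Prop → Prop → Prop → Prop → Prop) : ℝ :=
  frac (S.part i j) fun u => φ (u ∈ S.coreL ε i j k (x i k)) (u ∈ S.coreL ε i j k (y i k))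
    (u ∈ S.coreL ε i j k (z i k)) (u ∈ S.coreR ε h i j (x h j)) (u ∈ S.coreR ε h i j (y h j))
    (u ∈ S.coreR ε h i j (z h j))

/-- Rounding to multiples of `ε` turns proportions into finitely many colours, at the price of an
error `ε`. -/
theorem floor_lt_of_le_one {f ε : ℝ} (hε : 0 < ε) (hf : f ≤ 1) : ⌊f / ε⌋₊ < ⌊1 / ε⌋₊ + 1 :=
  Nat.lt_succ_of_le (Nat.floor_le_floor (by gcongr))

theorem abs_sub_le_of_floor_eq {f g ε : ℝ} (hε : 0 < ε) (hf : 0 ≤ f) (hg : 0 ≤ g)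
    (h : ⌊f / ε⌋₊ = ⌊g / ε⌋₊) : |f - g| ≤ ε := by
  have f1 := Nat.floor_le (div_nonneg hf hε.le)
  have f2 := Nat.lt_floor_add_one (f / ε)
  have g1 := Nat.floor_le (div_nonneg hg hε.le)
  have g2 := Nat.lt_floor_add_one (g / ε)
  rw [h] at f1 f2
  rw [le_div_iff₀ hε] at f1 g1
  rw [div_lt_iff₀ hε] at f2 g2
  rw [abs_le]
  constructor <;> linarith

end TriSystem

/-! ### Towers of extremal top vertices and the contradiction -/

namespace TriSystem

section tower

variable {V : Type u} (S : TriSystem V) (ε d : ℝ) (n s₀ s₁ s₂ : ℕ) (Y : Finset ℕ)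
  (x y z : ℕ → ℕ → V)

/-- Top vertices `x` with top vertices `y` to their left and `z` to their right. -/
structure Tower : Prop where
  admissible : S.Admissible d n Y
  top : S.Tops ε s₀ Y x
  left : S.Tops ε s₁ Y y
  right : S.Tops ε s₂ Y z
  leftOf : S.LeftOf ε Y x y
  rightOf : S.RightOf ε Y x z

/-- The events whose being negligible enters the density estimate. -/
def Dense : Fin 14 → ℕ → ℕ → ℕ → ℕ → ℕ → Prop
  | 0 => fun _ i j k _ => ε ≤ frac (S.part i k) fun c => s₀ * ε + ε ≤ S.weight ε i j k c
  | 1 => fun _ i j k t => ε ≤ frac (S.part i k) fun c =>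
      c ∈ S.coreL ε i k t (x i t) ∧ s₁ * ε + ε ≤ S.weight ε i j k c
  | 2 => fun h i j k _ => ε ≤ frac (S.part i k) fun c =>
      c ∈ S.coreR ε h i k (x h k) ∧ s₂ * ε + ε ≤ S.weight ε i j k c
  | 3 => fun i j k t _ => ε ≤ frac (S.part j k) fun u =>
      u ∈ S.coreR ε i j k (x i k) ∧ u ∈ S.coreL ε j k t (x j t)
  | 4 => fun i j k t _ => ε ≤ frac (S.part j k) fun u =>
      u ∈ S.coreR ε i j k (y i k) ∧ u ∈ S.coreL ε j k t (y j t)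
  | 5 => fun i j k t _ => ε ≤ frac (S.part j k) fun u =>
      u ∈ S.coreR ε i j k (z i k) ∧ u ∈ S.coreL ε j k t (z j t)
  | 6 => fun i j k _ _ => ε ≤ frac (S.part i j) fun u =>
      u ∈ S.coreL ε i j k (y i k) ∧ u ∈ S.coreL ε i j k (z i k)
  | 7 => fun i j k _ _ => ε ≤ frac (S.part j k) fun u =>
      u ∈ S.coreR ε i j k (y i k) ∧ u ∈ S.coreR ε i j k (z i k)
  | 8 => fun i j k t _ => ε ≤ frac (S.part i j ×ˢ S.part j k) fun u =>
      u.1 ∈ S.coreL ε i j k (x i k) ∧ u.2 ∈ S.coreL ε j k t (x j t) ∧ S.edge u.1 u.2 (y i k)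
  | 9 => fun i j k t _ => ε ≤ frac (S.part i j ×ˢ S.part j k) fun u =>
      u.1 ∈ S.coreL ε i j k (x i k) ∧ u.2 ∈ S.coreL ε j k t (x j t) ∧ S.edge u.1 u.2 (z i k)
  | 10 => fun h i j k _ => ε ≤ frac (S.part i j ×ˢ S.part j k) fun u =>
      u.1 ∈ S.coreR ε h i j (x h j) ∧ u.2 ∈ S.coreR ε i j k (x i k) ∧ S.edge u.1 u.2 (y i k)
  | 11 => fun h i j k _ => ε ≤ frac (S.part i j ×ˢ S.part j k) fun u =>
      u.1 ∈ S.coreR ε h i j (x h j) ∧ u.2 ∈ S.coreR ε i j k (x i k) ∧ S.edge u.1 u.2 (z i k)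
  | 12 => fun h i j k t => ε ≤ frac (S.part i j ×ˢ S.part j k) fun u =>
      u.1 ∈ S.coreR ε h i j (z h j) ∧ u.2 ∈ S.coreL ε j k t (z j t) ∧ S.edge u.1 u.2 (y i k)
  | 13 => fun h i j k t => ε ≤ frac (S.part i j ×ˢ S.part j k) fun u =>
      u.1 ∈ S.coreR ε h i j (y h j) ∧ u.2 ∈ S.coreL ε j k t (y j t) ∧ S.edge u.1 u.2 (z i k)

variable {S ε d n s₀ s₁ s₂ Y x y z} {Z : Finset ℕ}

theorem Tower.mono (h : S.Tower ε d n s₀ s₁ s₂ Y x y z) (hZ : Z ⊆ Y) :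
    S.Tower ε d n s₀ s₁ s₂ Z x y z :=
  ⟨h.1.mono hZ, h.2.mono hZ, h.3.mono hZ, h.4.mono hZ, h.5.mono hZ, h.6.mono hZ⟩

end tower

variable {ε d : ℝ} {n s₀ s₁ s₂ : ℕ}

/-- Events 0, 1, 2 would raise a maximal level. Events 3, 4, 5 and 10, 11 force the first
configuration, 8 and 9 the second, 12 and 13 the third, 6 and 7 the fourth. -/
theorem exists_not_quint_dense (hε : 0 < ε) (hε1 : ε ≤ 1) (h₀ : ¬Level0.{u} ε d n (s₀ + 1))
    (h₁ : ¬Level1.{u} ε d n s₀ (s₁ + 1)) (h₂ : ¬Level2.{u} ε d n s₀ s₁ (s₂ + 1)) (b : Fin 14) :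
    ∃ N : ℕ, ∀ {V : Type u} [Nonempty V] (S : TriSystem V) (Y : Finset ℕ) (x y z : ℕ → ℕ → V),
      N ≤ #Y → S.Tower ε d n s₀ s₁ s₂ Y x y z → ¬Quint Y (S.Dense ε s₀ s₁ s₂ x y z b) := by
  unfold Level0 Unbounded at h₀
  unfold Level1 Unbounded at h₁
  unfold Level2 Unbounded at h₂
  fin_cases b
  · obtain ⟨M, hM⟩ := not_forall.1 h₀
    obtain ⟨N, H⟩ := exists_selection hε M
    refine ⟨N, fun {V} _ S Y x y z hY hT hQ => hM ?_⟩
    obtain ⟨Z, hZ, hc, v, hv⟩ := H Y S.part (fun _ _ _ _ => True)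
      (fun i j k c => s₀ * ε + ε ≤ S.weight ε i j k c) (fun _ _ _ _ => True) hY
      (fun h hh i hi j hj k hk t ht a1 a2 a3 a4 =>
        le_trans (hQ h hh i hi j hj k hk t ht a1 a2 a3 a4)
          (frac_mono fun c _ hc => ⟨trivial, hc, trivial⟩))
    refine ⟨V, ‹_›, S, Z, hc.ge, hT.admissible.mono hZ, v,
      fun i hi j hj h => (hv i hi j hj h).1, fun i hi j hj k hk a1 a2 => ?_⟩
    have := (hv i hi k hk (a1.trans a2)).2.2.1 j hj a1 a2
    push_cast
    linarith
  · obtain ⟨M, hM⟩ := not_forall.1 h₁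
    obtain ⟨N, H⟩ := exists_selection hε M
    refine ⟨N, fun {V} _ S Y x y z hY hT hQ => hM ?_⟩
    obtain ⟨Z, hZ, hc, v, hv⟩ := H Y S.part (fun _ _ _ _ => True)
      (fun i j k c => s₁ * ε + ε ≤ S.weight ε i j k c)
      (fun i k t c => c ∈ S.coreL ε i k t (x i t)) hY
      (fun h hh i hi j hj k hk t ht a1 a2 a3 a4 =>
        le_trans (hQ h hh i hi j hj k hk t ht a1 a2 a3 a4)
          (frac_mono fun c _ hc => ⟨trivial, hc.2, hc.1⟩))
    refine ⟨V, ‹_›, S, Z, hc.ge, hT.admissible.mono hZ, x, v, hT.top.mono hZ,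
      ⟨fun i hi j hj h => (hv i hi j hj h).1, fun i hi j hj k hk a1 a2 => ?_⟩,
      fun i hi j hj k hk a1 a2 => (hv i hi j hj a1).2.2.2 k hk a2⟩
    have := (hv i hi k hk (a1.trans a2)).2.2.1 j hj a1 a2
    push_cast
    linarith
  · obtain ⟨M, hM⟩ := not_forall.1 h₂
    obtain ⟨N, H⟩ := exists_selection hε M
    refine ⟨N, fun {V} _ S Y x y z hY hT hQ => hM ?_⟩
    obtain ⟨Z, hZ, hc, v, hv⟩ := H Y S.part (fun h i k c => c ∈ S.coreR ε h i k (x h k))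
      (fun i j k c => s₂ * ε + ε ≤ S.weight ε i j k c) (fun _ _ _ _ => True) hY
      (fun h hh i hi j hj k hk t ht a1 a2 a3 a4 =>
        le_trans (hQ h hh i hi j hj k hk t ht a1 a2 a3 a4)
          (frac_mono fun c _ hc => ⟨hc.1, hc.2, trivial⟩))
    refine ⟨V, ‹_›, S, Z, hc.ge, hT.admissible.mono hZ, x, y, v, hT.top.mono hZ, hT.left.mono hZ,
      hT.leftOf.mono hZ,
      ⟨fun i hi j hj h => (hv i hi j hj h).1, fun i hi j hj k hk a1 a2 => ?_⟩,
      fun i hi j hj k hk a1 a2 => (hv j hj k hk a2).2.1 i hi a1⟩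
    have := (hv i hi k hk (a1.trans a2)).2.2.1 j hj a1 a2
    push_cast
    linarith
  · obtain ⟨N, H⟩ := exists_conf1_of_overlap hε hε n
    refine ⟨N + 2, fun {V} _ S Y x y z hY hT hQ => ?_⟩
    obtain ⟨A, hA, hN, hQA⟩ := Quint.quad hQ N hY
    replace hT := hT.mono hA
    obtain ⟨J, hJ, hc, hJ'⟩ := H S A x hN hT.admissible.nonempty hT.top.choice hQA
    exact hT.admissible.free J hJ hc (Or.inl hJ')
  · obtain ⟨N, H⟩ := exists_conf1_of_overlap hε hε n
    refine ⟨N + 2, fun {V} _ S Y x y z hY hT hQ => ?_⟩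
    obtain ⟨A, hA, hN, hQA⟩ := Quint.quad hQ N hY
    replace hT := hT.mono hA
    obtain ⟨J, hJ, hc, hJ'⟩ := H S A y hN hT.admissible.nonempty hT.left.choice hQA
    exact hT.admissible.free J hJ hc (Or.inl hJ')
  · obtain ⟨N, H⟩ := exists_conf1_of_overlap hε hε n
    refine ⟨N + 2, fun {V} _ S Y x y z hY hT hQ => ?_⟩
    obtain ⟨A, hA, hN, hQA⟩ := Quint.quad hQ N hY
    replace hT := hT.mono hA
    obtain ⟨J, hJ, hc, hJ'⟩ := H S A z hN hT.admissible.nonempty hT.right.choice hQA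
    exact hT.admissible.free J hJ hc (Or.inl hJ')
  · obtain ⟨N, H⟩ := exists_conf4_of_left hε hε n
    refine ⟨N + 2, fun {V} _ S Y x y z hY hT hQ => ?_⟩
    obtain ⟨A, hA, hN, hQA⟩ := Quint.triple hQ N hY
    replace hT := hT.mono hA
    obtain ⟨J, hJ, hc, hJ'⟩ := H S A x y z hN hT.admissible.nonempty hT.top.choice hT.left.choice
      hT.right.choice hT.leftOf hT.rightOf hQA
    exact hT.admissible.free J hJ hc (Or.inr (Or.inr (Or.inr hJ')))
  · obtain ⟨N, H⟩ := exists_conf4_of_right hε hε n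
    refine ⟨N + 2, fun {V} _ S Y x y z hY hT hQ => ?_⟩
    obtain ⟨A, hA, hN, hQA⟩ := Quint.triple hQ N hY
    replace hT := hT.mono hA
    obtain ⟨J, hJ, hc, hJ'⟩ := H S A x y z hN hT.admissible.nonempty hT.top.choice hT.left.choice
      hT.right.choice hT.leftOf hT.rightOf hQA
    exact hT.admissible.free J hJ hc (Or.inr (Or.inr (Or.inr hJ')))
  · obtain ⟨N, H⟩ := exists_conf2 hε hε n
    refine ⟨N + 2, fun {V} _ S Y x y z hY hT hQ => ?_⟩
    obtain ⟨A, hA, hN, hQA⟩ := Quint.quad hQ N hY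
    replace hT := hT.mono hA
    obtain ⟨J, hJ, hc, hJ'⟩ := H S A x y hN hT.admissible.nonempty hT.top.choice hT.left.choice hQA
    exact hT.admissible.free J hJ hc (Or.inr (Or.inl hJ'))
  · obtain ⟨N, H⟩ := exists_conf2 hε hε n
    refine ⟨N + 2, fun {V} _ S Y x y z hY hT hQ => ?_⟩
    obtain ⟨A, hA, hN, hQA⟩ := Quint.quad hQ N hY
    replace hT := hT.mono hA
    obtain ⟨J, hJ, hc, hJ'⟩ := H S A x z hN hT.admissible.nonempty hT.top.choice hT.right.choice hQA
    exact hT.admissible.free J hJ hc (Or.inr (Or.inl hJ'))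
  · obtain ⟨N, H⟩ := exists_conf1 hε hε n
    refine ⟨N + 2, fun {V} _ S Y x y z hY hT hQ => ?_⟩
    obtain ⟨A, hA, hN, hQA⟩ := Quint.quad hQ N hY
    replace hT := hT.mono hA
    obtain ⟨J, hJ, hc, hJ'⟩ := H S A x y hN hT.admissible.nonempty hT.top.choice hT.left.choice hQA
    exact hT.admissible.free J hJ hc (Or.inl hJ')
  · obtain ⟨N, H⟩ := exists_conf1 hε hε n
    refine ⟨N + 2, fun {V} _ S Y x y z hY hT hQ => ?_⟩
    obtain ⟨A, hA, hN, hQA⟩ := Quint.quad hQ N hY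
    replace hT := hT.mono hA
    obtain ⟨J, hJ, hc, hJ'⟩ := H S A x z hN hT.admissible.nonempty hT.top.choice hT.right.choice hQA
    exact hT.admissible.free J hJ hc (Or.inl hJ')
  · obtain ⟨N, H⟩ := exists_conf3 hε hε1 hε n
    refine ⟨N, fun {V} _ S Y x y z hY hT hQ => ?_⟩
    obtain ⟨J, hJ, hc, hJ'⟩ := H S Y z y hY hT.admissible.nonempty hT.right.choice hT.left.choice hQ
    exact hT.admissible.free J hJ hc (Or.inr (Or.inr (Or.inl hJ')))
  · obtain ⟨N, H⟩ := exists_conf3 hε hε1 hε n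
    refine ⟨N, fun {V} _ S Y x y z hY hT hQ => ?_⟩
    obtain ⟨J, hJ, hc, hJ'⟩ := H S Y y z hY hT.admissible.nonempty hT.left.choice hT.right.choice hQ
    exact hT.admissible.free J hJ hc (Or.inr (Or.inr (Or.inl hJ')))

/-- The density estimate for a tower in which the relevant events are negligible. -/
theorem Tower.density_le {V : Type u} {S : TriSystem V} {Z : Finset ℕ} {x y z : ℕ → ℕ → V}
    (hT : S.Tower ε d n s₀ s₁ s₂ Z x y z) (hε : 0 < ε) (hε1 : ε ≤ 1) (h₁ : s₁ ≤ s₀) (h₂ : s₂ ≤ s₀)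
    (hZ : #Z = 6) (hno : ∀ b, Quint Z fun h i j k t => ¬S.Dense ε s₀ s₁ s₂ x y z b h i j k t)
    {c : (Prop → Prop → Prop → Prop → Prop → Prop → Prop) → ℕ}
    (hc : Quint Z fun h i j k _ => (fun φ => ⌊S.profile ε x y z h i j k φ / ε⌋₊) = c) :
    d ≤ 4 / 27 + 49 * ε := by
  obtain ⟨h, hh, i, hi, j, hj, k, hk, t, ht, s, hs, a1, a2, a3, a4, a5⟩ :
      ∃ h ∈ Z, ∃ i ∈ Z, ∃ j ∈ Z, ∃ k ∈ Z, ∃ t ∈ Z, ∃ s ∈ Z,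
        h < i ∧ i < j ∧ j < k ∧ k < t ∧ t < s := by
    have mem := Z.orderEmbOfFin_mem hZ
    have lt : ∀ {p q : Fin 6}, p < q → Z.orderEmbOfFin hZ p < Z.orderEmbOfFin hZ q :=
      fun h => (Z.orderEmbOfFin hZ).strictMono h
    exact ⟨_, mem 0, _, mem 1, _, mem 2, _, mem 3, _, mem 4, _, mem 5, lt (by decide),
      lt (by decide), lt (by decide), lt (by decide), lt (by decide)⟩
  have hlam1 : s₀ * ε ≤ 1 := hT.top.mul_le_one (by omega)
  have hne := hT.admissible.nonempty
  have near : ∀ {p q r w p' q' r' w'}, (fun φ => ⌊S.profile ε x y z p q r w φ / ε⌋₊) = c →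
      (fun φ => ⌊S.profile ε x y z p' q' r' w' φ / ε⌋₊) = c → ∀ φ,
      |S.profile ε x y z p q r w φ - S.profile ε x y z p' q' r' w' φ| ≤ ε := by
    intro p q r w p' q' r' w' e₁ e₂ φ
    exact abs_sub_le_of_floor_eq hε (frac_nonneg _ _) (frac_nonneg _ _)
      (congrFun (e₁.trans e₂.symm) φ)
  -- Equal colours compare three parts: `c₀` and `c₁` relate `part i j` to `part j k`, while `c₀`
  -- and `c₂` relate `part i j` to `part i k`, where the top vertices live. The sixth index supplies
  -- the right end of the shifted quintuples.
  have c₀ := hc h hh i hi j hj k hk t ht a1 a2 a3 a4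
  have c₁ := hc i hi j hj k hk t ht s hs a2 a3 a4 a5
  have c₂ := hc h hh i hi k hk t ht s hs a1 (a2.trans a3) a4 a5
  have main : ∀ b, ¬S.Dense ε s₀ s₁ s₂ x y z b h i j k t := fun b =>
    hno b h hh i hi j hj k hk t ht a1 a2 a3 a4
  have shift : ∀ b, ¬S.Dense ε s₀ s₁ s₂ x y z b i j k t s := fun b =>
    hno b i hi j hj k hk t ht s hs a2 a3 a4 a5
  have skip : ∀ b, ¬S.Dense ε s₀ s₁ s₂ x y z b h i k t s := fun b =>
    hno b h hh i hi k hk t ht s hs a1 (a2.trans a3) a4 a5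
  have hmean := hT.admissible.le_expect_weight hε.le hi hj hk a2 a3
  have hreg := expect_le_of_regions (hne i hi k hk (a2.trans a3))
    (f := S.weight ε i j k) (fun _ _ => weight_le_one) (· ∈ S.coreL ε i k t (x i t))
    (· ∈ S.coreR ε h i k (x h k)) (lam := s₀ * ε) (m₁ := s₁ * ε) (m₂ := s₂ * ε) hε.le
    (by positivity) (by positivity) (by positivity) hlam1 (not_le.1 (main 0)).le
    (not_le.1 (main 1)).le (not_le.1 (main 2)).le (not_le.1 (skip 3)).le
  have h₁' : (s₁ : ℝ) ≤ s₀ := by exact_mod_cast h₁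
  have h₂' : (s₂ : ℝ) ≤ s₀ := by exact_mod_cast h₂
  have := density_le_of_profiles (hne i hi j hj a2) (W := S.part j k)
    (· ∈ S.coreL ε i j k (x i k)) (· ∈ S.coreL ε i j k (y i k)) (· ∈ S.coreL ε i j k (z i k))
    (· ∈ S.coreR ε h i j (x h j)) (· ∈ S.coreR ε h i j (y h j)) (· ∈ S.coreR ε h i j (z h j))
    (· ∈ S.coreL ε j k t (x j t)) (· ∈ S.coreL ε j k t (y j t)) (· ∈ S.coreL ε j k t (z j t))
    (· ∈ S.coreR ε i j k (x i k)) (· ∈ S.coreR ε i j k (y i k)) (· ∈ S.coreR ε i j k (z i k))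
    (S.edge · · (x i k)) (S.edge · · (y i k)) (S.edge · · (z i k))
    hε.le hε1 (near c₀ c₁) (near c₀ c₂ fun p _ _ _ _ _ => p) (near c₀ c₂ fun _ _ _ p _ _ => p)
    (hmean.trans hreg) (by positivity) (by positivity) (by gcongr) (by gcongr) hlam1
    (hT.top.weight i hi j hj k hk a2 a3) (hT.left.weight i hi j hj k hk a2 a3)
    (hT.right.weight i hi j hj k hk a2 a3)
    (not_le.1 (main 3)).le (not_le.1 (main 4)).le (not_le.1 (main 5)).le
    (not_le.1 (shift 6)).le (not_le.1 (main 7)).le (not_le.1 (shift 8)).le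
    (not_le.1 (shift 9)).le (not_le.1 (main 10)).le (not_le.1 (main 11)).le
    (not_le.1 (main 12)).le (not_le.1 (main 13)).le
  linarith

theorem not_unbounded_admissible {δ : ℝ} (hδ : 0 < δ) (n : ℕ) :
    ¬Unbounded.{u} fun _ S Y => S.Admissible (4 / 27 + δ) n Y := by
  intro hU
  -- The total error `49 * ε` stays below `δ`, and `4 * ε` below the density.
  obtain ⟨ε, hε, hε1, hεδ⟩ : ∃ ε : ℝ, 0 < ε ∧ ε ≤ 1 / 100 ∧ ε ≤ δ / 100 :=
    ⟨min (1 / 100) (δ / 100), by positivity, min_le_left _ _, min_le_right _ _⟩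
  obtain ⟨B, hB⟩ := exists_nat_gt (1 / ε)
  have bound : ∀ s, B ≤ s → ¬Level0.{u} ε (4 / 27 + δ) n s := fun s hs h => by
    have h1 := h.mul_le_one
    rw [← le_div_iff₀ hε] at h1
    have h2 : (B : ℝ) ≤ s := by exact_mod_cast hs
    linarith
  -- The three levels are maximised successively, each relative to the earlier ones. The later two
  -- cannot exceed `s₀`, since their vertices are themselves candidates for the first.
  obtain ⟨s₀, hs₀, p₀, q₀⟩ := exists_last_level (level0_one hε (by linarith) hU) bound
  obtain ⟨s₁, -, p₁, q₁⟩ := exists_last_level (p₀.level1 hε hs₀) fun s hs h => bound s hs h.level0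
  obtain ⟨s₂, -, p₂, q₂⟩ := exists_last_level (p₁.level2 hε hs₀) fun s hs h => bound s hs h.level0
  have h₁ : s₁ ≤ s₀ := by
    by_contra! h
    exact q₀ (p₁.level0.anti hε.le h)
  have h₂ : s₂ ≤ s₀ := by
    by_contra! h
    exact q₀ (p₂.level0.anti hε.le h)
  choose N₀ hN₀ using exists_not_quint_dense.{u} hε (by linarith) q₀ q₁ q₂
  have f₃ : Finite (Prop → Prop → Prop → Prop) := inferInstance
  have f₆ : Finite (Prop → Prop → Prop → Prop → Prop → Prop → Prop) := inferInstance
  obtain ⟨N, hN⟩ := exists_avoiding (Fin 14)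
    ((Prop → Prop → Prop → Prop → Prop → Prop → Prop) → Fin (⌊1 / ε⌋₊ + 1)) (univ.sup N₀) 6
  obtain ⟨V, _, S, Y, hY, hA, x, y, z, hx, hy, hxy, hz, hxz⟩ := p₂ N
  have hT : S.Tower ε (4 / 27 + δ) n s₀ s₁ s₂ Y x y z := ⟨hA, hx, hy, hz, hxy, hxz⟩
  obtain ⟨Z, hZ, hcZ, hno, c, hc⟩ := hN Y hY (S.Dense ε s₀ s₁ s₂ x y z)
    (fun h i j k _ φ => ⟨⌊S.profile ε x y z h i j k φ / ε⌋₊, floor_lt_of_le_one hε (frac_le_one _ _)⟩)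
    (fun b Z hZ hcZ => hN₀ b S Z x y z ((le_sup (mem_univ b)).trans hcZ) (hT.mono hZ))
  have := (hT.mono hZ).density_le hε (by linarith) h₁ h₂ hcZ hno (c := fun φ => c φ)
    fun h hh i hi j hj k hk t ht a1 a2 a3 a4 => funext fun φ =>
      congrArg Fin.val (congrFun (hc h hh i hi j hj k hk t ht a1 a2 a3 a4) φ)
  linarith

/-- Every dense system contains one of the four configurations. -/
theorem exists_conf {δ : ℝ} (hδ : 0 < δ) (n : ℕ) :
    ∃ N : ℕ, ∀ {V : Type u} [Nonempty V] (S : TriSystem V) (Y : Finset ℕ), N ≤ #Y →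
      S.NonemptyOn Y → (∀ i ∈ Y, ∀ j ∈ Y, ∀ k ∈ Y, i < j → j < k → 4 / 27 + δ ≤
        𝔼 c ∈ S.part i k, frac (S.part i j ×ˢ S.part j k) fun u => S.edge u.1 u.2 c) →
      ∃ J ⊆ Y, #J = n ∧ (S.Conf1 J ∨ S.Conf2 J ∨ S.Conf3 J ∨ S.Conf4 J) := by
  obtain ⟨M, hM⟩ := not_forall.1 (not_unbounded_admissible.{u} hδ n)
  refine ⟨M, fun {V} _ S Y hY hne hd => ?_⟩
  by_contra h
  exact hM ⟨V, ‹_›, S, Y, hY, hne, hd, fun J hJ hc hJ' => h ⟨J, hJ, hc, hJ'⟩⟩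

end TriSystem

/-! ### Transfer to partitioned hypergraphs -/

namespace PartitionedHypergraph

section

variable {V : Type*} [DecidableEq V] {I J : Finset ℕ} (H : PartitionedHypergraph V I)
  {i j k : ℕ} {a b c : V}

/-- The system of links of a partitioned hypergraph. -/
def toTriSystem : TriSystem V where
  part := H.part
  edge a b c := {a, b, c} ∈ H.edges

/-- Every edge of the triad is listed by at least one vertex triple, so counting triples can only
increase the density. -/
theorem triadDensity_le_expect :
    H.triadDensity i j k ≤ 𝔼 c ∈ H.part i k,
      frac (H.part i j ×ˢ H.part j k) fun u => {u.1, u.2, c} ∈ H.edges := by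
  have hcard : #(H.triad i j k) ≤ #{w ∈ H.part i k ×ˢ (H.part i j ×ˢ H.part j k) |
      ({w.2.1, w.2.2, w.1} : Finset V) ∈ H.edges} := by
    refine (card_le_card fun e he => ?_).trans
      (card_image_le (f := fun w : V × V × V => ({w.2.1, w.2.2, w.1} : Finset V)))
    obtain ⟨he, a, ha, b, hb, c, hc, rfl⟩ := mem_filter.1 he
    exact mem_image.2 ⟨(c, a, b), mem_filter.2
      ⟨mem_product.2 ⟨hc, mem_product.2 ⟨ha, hb⟩⟩, he⟩, rfl⟩
  rw [← frac_product (H.part i k) (H.part i j ×ˢ H.part j k)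
    fun w => ({w.2.1, w.2.2, w.1} : Finset V) ∈ H.edges, frac_eq_card_div, triadDensity,
    card_product, card_product]
  push_cast
  rw [mul_comm (#(H.part i j) : ℝ), mul_assoc]
  gcongr

variable {H}

theorem nonempty_of_triadDensity_pos (h : 0 < H.triadDensity i j k) :
    (H.part i j).Nonempty ∧ (H.part i k).Nonempty ∧ (H.part j k).Nonempty := by
  simp only [nonempty_iff_ne_empty]
  refine ⟨?_, ?_, ?_⟩ <;> intro h0 <;> simp [triadDensity, h0] at h

variable (H)

open Classical in
/-- The subhypergraph consisting of all edges with vertices in parts indexed by `J`. -/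
noncomputable def restrict (J : Finset ℕ) (hJ : J ⊆ I) : PartitionedHypergraph V J where
  part := H.part
  edges := H.edges.filter fun e => ∃ i ∈ J, ∃ j ∈ J, ∃ k ∈ J, i < j ∧ j < k ∧
    ∃ a ∈ H.part i j, ∃ b ∈ H.part j k, ∃ c ∈ H.part i k, e = {a, b, c}
  part_disjoint i hi j hj i' hi' j' hj' :=
    H.part_disjoint i (hJ hi) j (hJ hj) i' (hJ hi') j' (hJ hj')
  edges_spec _ he := (mem_filter.1 he).2

theorem restrict_isSubhypergraph (hJ : J ⊆ I) : (H.restrict J hJ).IsSubhypergraph H :=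
  ⟨hJ, fun _ _ _ _ _ => rfl, filter_subset _ _⟩

variable {H}

theorem mem_restrict_triad (hJ : J ⊆ I) (hi : i ∈ J) (hj : j ∈ J) (hk : k ∈ J) (hij : i < j)
    (hjk : j < k) (ha : a ∈ H.part i j) (hb : b ∈ H.part j k) (hc : c ∈ H.part i k)
    (h : {a, b, c} ∈ H.edges) : {a, b, c} ∈ (H.restrict J hJ).triad i j k :=
  mem_filter.2 ⟨mem_filter.2 ⟨h, i, hi, j, hj, k, hk, hij, hjk, a, ha, b, hb, c, hc, rfl⟩,
    a, ha, b, hb, c, hc, rfl⟩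

theorem mem_restrict_edges (hJ : J ⊆ I) (hi : i ∈ J) (hj : j ∈ J) (hk : k ∈ J) (hij : i < j)
    (hjk : j < k) (ha : a ∈ H.part i j) (hb : b ∈ H.part j k) (hc : c ∈ H.part i k)
    (h : {a, b, c} ∈ H.edges) : {a, b, c} ∈ (H.restrict J hJ).edges :=
  (mem_filter.1 (mem_restrict_triad hJ hi hj hk hij hjk ha hb hc h)).1

theorem config1_restrict (hJ : J ⊆ I) (h : H.toTriSystem.Conf1 J) :
    (H.restrict J hJ).Config1 := by
  obtain ⟨α, β, γ₀, ω, αω, γω, ⟨hα, hβ, hγ₀, hω, hαω, hγω⟩, h⟩ := h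
  refine ⟨α, β, γ₀, ω, αω, γω, ⟨hα, hβ, hγ₀, hω, hαω, hγω⟩, fun i hi j hj k hk hij hjk => ?_⟩
  have hik := hij.trans hjk
  obtain ⟨e₁, e₂, e₃⟩ := h i hi j hj k hk hij hjk
  exact ⟨mem_restrict_edges hJ hi hj hk hij hjk (hα i hi j hj hij) (hβ j hj k hk hjk)
      (hγ₀ i hi k hk hik) e₁,
    mem_restrict_edges hJ hi hj hk hij hjk (hω i hi j hj hij) (hβ j hj k hk hjk)
      (hγω i hi k hk hik) e₂,
    mem_restrict_edges hJ hi hj hk hij hjk (hαω i hi j hj hij) (hω j hj k hk hjk)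
      (hγ₀ i hi k hk hik) e₃⟩

theorem config2_restrict (hJ : J ⊆ I) (h : H.toTriSystem.Conf2 J) :
    (H.restrict J hJ).Config2 := by
  obtain ⟨α, β, γ₀, ω, βω, γω, ⟨hα, hβ, hγ₀, hω, hβω, hγω⟩, h⟩ := h
  refine ⟨α, β, γ₀, ω, βω, γω, ⟨hα, hβ, hγ₀, hω, hβω, hγω⟩, fun i hi j hj k hk hij hjk => ?_⟩
  have hik := hij.trans hjk
  obtain ⟨e₁, e₂, e₃⟩ := h i hi j hj k hk hij hjk
  exact ⟨mem_restrict_edges hJ hi hj hk hij hjk (hα i hi j hj hij) (hβ j hj k hk hjk)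
      (hγ₀ i hi k hk hik) e₁,
    mem_restrict_edges hJ hi hj hk hij hjk (hα i hi j hj hij) (hω j hj k hk hjk)
      (hγω i hi k hk hik) e₂,
    mem_restrict_edges hJ hi hj hk hij hjk (hω i hi j hj hij) (hβω j hj k hk hjk)
      (hγ₀ i hi k hk hik) e₃⟩

theorem config3_restrict (hJ : J ⊆ I) (h : H.toTriSystem.Conf3 J) :
    (H.restrict J hJ).Config3 := by
  obtain ⟨α, β, α', β', γ₀, γb, βb, αb, ⟨hα, hβ, hα', hβ', hγ₀, hγb⟩, h, h'⟩ := h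
  refine ⟨α, β, α', β', γ₀, γb, βb, αb, ⟨hα, hβ, hα', hβ', hγ₀, hγb⟩,
    fun i hi j hj k hk s hs t ht hij hjk hks hst => ?_⟩
  have hik := hij.trans hjk
  obtain ⟨hβb, hαb, e₁, e₂, e₃⟩ := h' i hi j hj k hk s hs t ht hij hjk hks hst
  exact ⟨⟨hβb, hαb⟩,
    mem_restrict_triad hJ hi hj hk hij hjk (hα i hi j hj hij) (hβ j hj k hk hjk)
      (hγ₀ i hi k hk hik) (h i hi j hj k hk hij hjk),
    mem_restrict_triad hJ hi hj hk hij hjk (hα' i hi j hj hij) hβb (hγ₀ i hi k hk hik) e₁,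
    mem_restrict_triad hJ hj hk hs hjk hks hβb hαb (hγb j hj s hs (hjk.trans hks)) e₂,
    mem_restrict_triad hJ hk hs ht hks hst hαb (hβ' s hs t ht hst)
      (hγ₀ k hk t ht (hks.trans hst)) e₃⟩

theorem config4_restrict (hJ : J ⊆ I) {n : ℕ} (hn : 1 ≤ n) {idx : ℕ → ℕ}
    (hmono : StrictMonoOn idx (Set.Icc 1 (4 * n))) (himage : J = (Icc 1 (4 * n)).image idx)
    (h : H.toTriSystem.Conf4 J) : (H.restrict J hJ).Config4 n idx := by
  obtain ⟨αs, βs, γ, α₁, β₁, γ₁, α₂, β₂, γ₂, u, v,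
    ⟨hαs, hβs, hγ, hα₁, hβ₁, hγ₁, hα₂, hβ₂, hγ₂, hu, hv⟩, h⟩ := h
  have hmem : ∀ m, 1 ≤ m → m ≤ 4 * n → idx m ∈ J := fun m h1 h2 =>
    himage ▸ mem_image_of_mem idx (mem_Icc.2 ⟨h1, h2⟩)
  have hlt : ∀ m m', 1 ≤ m → m < m' → m' ≤ 4 * n → idx m < idx m' := fun m m' h1 h2 h3 =>
    hmono ⟨h1, by omega⟩ ⟨by omega, h3⟩ h2
  refine ⟨αs, βs, γ, α₁, β₁, γ₁, α₂, β₂, γ₂, ⟨hαs, hβs, hγ, hα₁, hβ₁, hγ₁, hα₂, hβ₂, hγ₂⟩,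
    fun i hi j hj k hk hij hjk => ?_, ?_⟩
  · have hik := hij.trans hjk
    obtain ⟨⟨e₁, e₂, e₃, e₄⟩, -⟩ := h i hi j hj k hk hij hjk
    exact ⟨mem_restrict_edges hJ hi hj hk hij hjk (hγ₁ i hi j hj hij) (hβs j hj k hk hjk)
        (hγ i hi k hk hik) e₁,
      mem_restrict_edges hJ hi hj hk hij hjk (hαs i hi j hj hij) (hγ₂ j hj k hk hjk)
        (hγ i hi k hk hik) e₂,
      mem_restrict_edges hJ hi hj hk hij hjk (hα₁ i hi j hj hij) (hβ₁ j hj k hk hjk)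
        (hγ₁ i hi k hk hik) e₃,
      mem_restrict_edges hJ hi hj hk hij hjk (hα₂ i hi j hj hij) (hβ₂ j hj k hk hjk)
        (hγ₂ i hi k hk hik) e₄⟩
  -- The extra vertices are `u` and `v` at the parts around `idx (2 * n + 1)`. All positions used
  -- are at most `4 * n` because `n ≥ 1`.
  · have m₀ := hmem n hn (by omega)
    have m₁ := hmem (2 * n) (by omega) (by omega)
    have m₂ := hmem (2 * n + 1) (by omega) (by omega)
    have m₃ := hmem (2 * n + 2) (by omega) (by omega)
    have m₄ := hmem (3 * n + 1) (by omega) (by omega)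
    have l₀ := hlt n (2 * n + 1) hn (by omega) (by omega)
    have l₁ := hlt (2 * n) (2 * n + 1) (by omega) (by omega) (by omega)
    have l₂ := hlt (2 * n + 1) (2 * n + 2) (by omega) (by omega) (by omega)
    have l₃ := hlt (2 * n + 1) (3 * n + 1) (by omega) (by omega) (by omega)
    obtain ⟨b, hb, eb⟩ := (h _ m₁ _ m₂ _ m₄ l₁ l₃).2.1
    obtain ⟨a, ha, ea⟩ := (h _ m₀ _ m₂ _ m₃ l₀ l₂).2.2.1
    obtain ⟨c, hc, ec⟩ := (h _ m₁ _ m₂ _ m₃ l₁ l₂).2.2.2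
    have hu' := hu _ m₁ _ m₂ l₁
    have hv' := hv _ m₂ _ m₃ l₂
    have hc₂ := hγ₂ _ m₁ _ m₄ (l₁.trans l₃)
    have hc₁ := hγ₁ _ m₀ _ m₃ (l₀.trans l₂)
    exact ⟨_, hu', _, hv',
      ⟨hu', hc₂, _, mem_restrict_triad hJ m₁ m₂ m₄ l₁ l₃ hu' hb hc₂ eb, by simp, by simp⟩,
      ⟨hv', hc₁, _, mem_restrict_triad hJ m₀ m₂ m₃ l₀ l₂ ha hv' hc₁ ea, by simp, by simp⟩,
      _, mem_restrict_triad hJ m₁ m₂ m₃ l₁ l₂ hu' hv' hc ec, by simp, by simp⟩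

end

theorem exists_index_enumeration (J : Finset ℕ) : ∃ idx : ℕ → ℕ,
    StrictMonoOn idx (Set.Icc 1 #J) ∧ J = (Icc 1 #J).image idx := by
  have key : ∀ m (h : m ∈ Set.Icc 1 #J), m - 1 < #J := fun m h => by
    have := h.1; have := h.2; omega
  -- Positions are counted from 1, hence the shift; the value 0 outside the interval is a dummy.
  let idx : ℕ → ℕ := fun m => if h : m ∈ Set.Icc 1 #J then J.orderEmbOfFin rfl ⟨m - 1, key m h⟩ else 0
  have hidx : ∀ m (h : m ∈ Set.Icc 1 #J), idx m = J.orderEmbOfFin rfl ⟨m - 1, key m h⟩ :=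
    fun m h => dif_pos h
  have hmono : StrictMonoOn idx (Set.Icc 1 #J) := by
    intro a ha b hb hab
    rw [hidx a ha, hidx b hb]
    refine (J.orderEmbOfFin rfl).strictMono (Fin.mk_lt_mk.2 ?_)
    have := ha.1
    omega
  refine ⟨idx, hmono, (eq_of_subset_of_card_le (fun x hx => ?_) ?_).symm⟩
  · obtain ⟨m, hm, rfl⟩ := mem_image.1 hx
    rw [hidx m (mem_Icc.1 hm)]
    exact orderEmbOfFin_mem _ _ _
  · rw [card_image_of_injOn (by simpa using hmono.injOn), Nat.card_Icc]
    omega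

/-- Each pair of indices extends to a triple: above `j`, below `i`, or, for the pair of extremes, by
the index 2. -/
theorem exists_part_nonempty {V : Type*} [DecidableEq V] {N : ℕ} (hN : 3 ≤ N)
    {H : PartitionedHypergraph V (Icc 1 N)}
    (h : ∀ i ∈ Icc 1 N, ∀ j ∈ Icc 1 N, ∀ k ∈ Icc 1 N, i < j → j < k → 0 < H.triadDensity i j k) :
    H.toTriSystem.NonemptyOn (Icc 1 N) := by
  intro i hi j hj hij
  simp only [mem_Icc] at hi hj h
  rcases Nat.lt_or_ge j N with h1 | h1
  · exact (nonempty_of_triadDensity_pos (h i hi j hj N (by omega) hij h1)).1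
  rcases Nat.lt_or_ge 1 i with h2 | h2
  · exact (nonempty_of_triadDensity_pos (h 1 (by omega) i hi j hj h2 hij)).2.2
  · exact (nonempty_of_triadDensity_pos (h i hi 2 (by omega) j hj (by omega) (by omega))).2.1

end PartitionedHypergraph

end

theorem mainTheorem5 (δ : ℝ) (hδ : 0 < δ) (n : ℕ) (hn : 1 ≤ n) :
    ∃ N : ℕ, ∀ (V : Type*) [DecidableEq V] (H : PartitionedHypergraph V (Finset.Icc 1 N)),
      ((4 / 27 + δ : ℝ) : WithTop ℝ) ≤ H.density →
      ∃ (I : Finset ℕ) (idx : ℕ → ℕ) (H₀ : PartitionedHypergraph V I),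
        StrictMonoOn idx (Set.Icc 1 (4 * n)) ∧ I = (Finset.Icc 1 (4 * n)).image idx ∧
        H₀.IsSubhypergraph H ∧
        (H₀.Config1 ∨ H₀.Config2 ∨ H₀.Config3 ∨ H₀.Config4 n idx) := by
  obtain ⟨M, hM⟩ := TriSystem.exists_conf hδ (4 * n)
  -- At least three indices are needed for the density hypothesis to speak about any triad, and thus
  -- to make the parts nonempty.
  refine ⟨max M 3, fun V _ H hH => ?_⟩
  rw [PartitionedHypergraph.le_density_iff] at hH
  have hne := PartitionedHypergraph.exists_part_nonempty (le_max_right M 3)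
    fun i hi j hj k hk hij hjk => lt_of_lt_of_le (by positivity) (hH i hi j hj k hk hij hjk)
  have : Nonempty V := by
    obtain ⟨v, -⟩ := hne 1 (by simp) 2 (by simp) (by norm_num)
    exact ⟨v⟩
  obtain ⟨J, hJ, hcard, hconf⟩ := hM H.toTriSystem (Finset.Icc 1 (max M 3)) (by simp) hne
    fun i hi j hj k hk hij hjk => (hH i hi j hj k hk hij hjk).trans H.triadDensity_le_expect
  obtain ⟨idx, hmono, himage⟩ := PartitionedHypergraph.exists_index_enumeration J
  rw [hcard] at hmono himage
  refine ⟨J, idx, H.restrict J hJ, hmono, himage, H.restrict_isSubhypergraph hJ, ?_⟩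
  rcases hconf with h | h | h | h
  · exact Or.inl (PartitionedHypergraph.config1_restrict hJ h)
  · exact Or.inr (Or.inl (PartitionedHypergraph.config2_restrict hJ h))
  · exact Or.inr (Or.inr (Or.inl (PartitionedHypergraph.config3_restrict hJ h)))
  · exact Or.inr (Or.inr (Or.inr (PartitionedHypergraph.config4_restrict hJ hn hmono himage h)))
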